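/- Let $P$ be a finite set of at least $5$ points in the plane, no three of them collinear, whose convex hull is a triangle, that is, exactly three points of $P$ are vertices of the convex hull of $P$. Then $P$ admits a noncomplex triangulation if and only if $P$ is not anomalous. Here a triangulation of $P$ is a plane graph with vertex set $P$ whose edges are line segments, whose outer face has the boundary of the convex hull of $P$ as its boundary, and all of whose other faces are bounded by triangles. A chord of a triangulation is an edge joining two non-consecutive vertices of the convex hull of $P$. A complex triangle of a triangulation is a triangle formed by three of its edges that contains a point of $P$ in its interior and another point of $P$ in its exterior. A triangulation is noncomplex if it has neither chords nor complex triangles. The set $P$, with a triangular convex hull, is anomalous if for some vertex $p$ of its convex hull all points of $P\setminus\{p\}$ are vertices of the convex hull of $P\setminus\{p\}$. -/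

import Mathlib

/-- The Euclidean plane. -/
abbrev Plane : Type := EuclideanSpace ℝ (Fin 2)

/-- No three distinct points of `P` are collinear. -/
def GeneralPosition (P : Set Plane) : Prop :=
  ∀ a ∈ P, ∀ b ∈ P, ∀ c ∈ P, a ≠ b → a ≠ c → b ≠ c → ¬ Collinear ℝ {a, b, c}

/-- The vertices of the convex hull of `P`; for a finite `P` these all belong to `P`. -/
def hullVertices (P : Set Plane) : Set Plane :=
  (convexHull ℝ P).extremePoints ℝ

/-- The straight-line drawing of a graph with vertex set `P`: the points of `P` together with
the segments joining adjacent points. -/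
def drawing {P : Set Plane} (T : SimpleGraph P) : Set Plane :=
  P ∪ {x | ∃ u v : P, T.Adj u v ∧ x ∈ segment ℝ (u : Plane) v}

/-- The straight-line drawing of `T` is plane: no vertex lies in the relative interior of an edge,
and the relative interiors of distinct edges are disjoint. -/
def IsPlane {P : Set Plane} (T : SimpleGraph P) : Prop :=
  (∀ u v w : P, T.Adj u v → (w : Plane) ∉ openSegment ℝ (u : Plane) v) ∧
  (∀ u v w x : P, T.Adj u v → T.Adj w x → s(u, v) ≠ s(w, x) →
    Disjoint (openSegment ℝ (u : Plane) v) (openSegment ℝ (w : Plane) x))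

/-- The faces: the connected components of the complement of the drawing. -/
def IsFace {P : Set Plane} (T : SimpleGraph P) (F : Set Plane) : Prop :=
  ∃ x ∈ (drawing T)ᶜ, F = connectedComponentIn (drawing T)ᶜ x

/-- A triangulation of `P`: a plane straight-line graph with vertex set `P` whose outer face has
the boundary of the convex hull of `P` as its boundary, and all of whose other faces are the
(open) triangles spanned by three pairwise adjacent vertices. -/
structure IsTriangulation {P : Set Plane} (T : SimpleGraph P) : Prop where
  isPlane : IsPlane T
  outer : ∀ F, IsFace T F → ¬ Bornology.IsBounded F → frontier F = frontier (convexHull ℝ P)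
  inner : ∀ F, IsFace T F → Bornology.IsBounded F →
    ∃ a b c : P, T.Adj a b ∧ T.Adj b c ∧ T.Adj a c ∧
      F = interior (convexHull ℝ {(a : Plane), (b : Plane), (c : Plane)})

/-- A chord: an edge between two hull vertices that are not consecutive on the hull, that is,
the edge does not run along the boundary of the hull. -/
def IsChord {P : Set Plane} (T : SimpleGraph P) (u v : P) : Prop :=
  T.Adj u v ∧ (u : Plane) ∈ hullVertices P ∧ (v : Plane) ∈ hullVertices P ∧
    ¬ segment ℝ (u : Plane) v ⊆ frontier (convexHull ℝ P)

/-- A complex triangle: three pairwise adjacent vertices that span a triangle with a point of `P`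
in its interior and another point of `P` in its exterior. -/
def IsComplexTriangle {P : Set Plane} (T : SimpleGraph P) (a b c : P) : Prop :=
  T.Adj a b ∧ T.Adj b c ∧ T.Adj a c ∧
    (∃ p ∈ P, p ∈ interior (convexHull ℝ {(a : Plane), (b : Plane), (c : Plane)})) ∧
    (∃ q ∈ P, q ∉ convexHull ℝ {(a : Plane), (b : Plane), (c : Plane)})

/-- `P` admits a noncomplex triangulation: one with neither chords nor complex triangles. -/
def AdmitsNoncomplexTriangulation (P : Set Plane) : Prop :=
  ∃ T : SimpleGraph P, IsTriangulation T ∧ (∀ u v, ¬ IsChord T u v) ∧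
    (∀ a b c, ¬ IsComplexTriangle T a b c)

/-- `P` is anomalous: its hull is a triangle, and removing some hull vertex leaves a set
all of whose points are vertices of its own convex hull. -/
def IsAnomalous (P : Set Plane) : Prop :=
  (hullVertices P).ncard = 3 ∧
    ∃ p ∈ hullVertices P, P \ {p} ⊆ hullVertices (P \ {p})

set_option linter.unusedSimpArgs false
set_option linter.unusedSectionVars false

open Filter Topology

/-! Necessity (`IsTriangulation.exists_complex`). If all points except the hull vertex `p` are in
convex position, then no segment between two of them blocks the view from `p` to a third. A
triangulation is a maximal plane graph, so `p` is joined to every other point. At least four points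
remain, so two segments between them cross, and some edge `ad` of the triangulation avoiding `p` is
crossed by a segment `ef` between further points. The triangle `pad` then has one of `e`, `f` inside
and the other outside.

Sufficiency rests on a stronger statement for larger hulls (`good_of_four_le`): with at least four
hull vertices and at least one non-extreme point there is a triangulation with neither chords nor
nonempty triangles. It is proved by deleting a hull vertex `a`, triangulating the rest, and joining
`a` to everything it sees. The visible points are hull vertices of the rest. By chord-freeness a new
triangle at `a` stands on a hull edge of the rest, so it contains either no point or all the others.
The fan creates a chord only where a hull edge of the rest facing `a` has both ends still extreme;
flipping that edge removes the chord. With exactly four hull vertices the deletion may leave convex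
position, and then an explicit cone triangulation starts the construction.

For a triangular hull, suppose that some hull vertex can be deleted to leave at least four hull
vertices. Since `P` is not anomalous, the previous result and one fan suffice. Otherwise each
deletion of a hull vertex `a`, `b`, `c` exposes exactly one new hull vertex `a'`, `b'`, `c'`
(`Nested`). If `P \ {a}` is itself not anomalous, induction triangulates it. Adding `a` makes `a'bc`
a complex triangle, and flipping `a'b` or `a'c` to an edge at `a` destroys it
(`Nested.exists_nc_of_erase`). Deleting `b` or `c` from `P \ {a}` never leaves convex position, so
the only remaining case is that `P \ {a, a'}` is convex, where a cone from `b`, two fans and one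
flip work (`Nested.exists_nc_of_convex`).

Geometry enters through signs of `cr`: facts about four or five points are checked over the sign
patterns allowed by the affine and Grassmann–Plücker relations. Triangulations are first handled in
the combinatorial form `Tri`, where only generic points need be covered by empty triangles;
`Tri.isTriangulation` recovers the topological faces. -/

/-- Twice the signed area of the triangle `abc`. -/
def cr (a b c : Plane) : ℝ := (b 0 - a 0) * (c 1 - a 1) - (b 1 - a 1) * (c 0 - a 0)

/-- `p` and `q` lie strictly on the same side of the line `uv`. -/
def SameSide (u v p q : Plane) : Prop :=
  (0 < cr u v p ∧ 0 < cr u v q) ∨ (cr u v p < 0 ∧ cr u v q < 0)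

/-- `p` and `q` lie strictly on opposite sides of the line `uv`. -/
def OppSide (u v p q : Plane) : Prop :=
  (0 < cr u v p ∧ cr u v q < 0) ∨ (cr u v p < 0 ∧ 0 < cr u v q)

/-- `x` lies in the open triangle `abc`. -/
def InTri (a b c x : Plane) : Prop :=
  (0 < cr a b x ∧ 0 < cr b c x ∧ 0 < cr c a x) ∨ (cr a b x < 0 ∧ cr b c x < 0 ∧ cr c a x < 0)

/-- The open segments `ab` and `cd` cross transversally. -/
def Cross (a b c d : Plane) : Prop := OppSide a b c d ∧ OppSide c d a b

/-! ### Orientation identities and admissible sign patterns -/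

theorem cr_rot (a b c : Plane) : cr b c a = cr a b c := by unfold cr; ring
theorem cr_swap (a b c : Plane) : cr b a c = - cr a b c := by unfold cr; ring
theorem cr_swap' (a b c : Plane) : cr a c b = - cr a b c := by unfold cr; ring
theorem cr_four (a b c d : Plane) : cr b c d - cr a c d + cr a b d - cr a b c = 0 := by
  unfold cr; ring

structure Gen4 (a b c d : Plane) : Prop where
  abc : cr a b c ≠ 0
  abd : cr a b d ≠ 0
  acd : cr a c d ≠ 0
  bcd : cr b c d ≠ 0

structure Gen5 (a b c d e : Plane) : Prop where
  abc : cr a b c ≠ 0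
  abd : cr a b d ≠ 0
  abe : cr a b e ≠ 0
  acd : cr a c d ≠ 0
  ace : cr a c e ≠ 0
  ade : cr a d e ≠ 0
  bcd : cr b c d ≠ 0
  bce : cr b c e ≠ 0
  bde : cr b d e ≠ 0
  cde : cr c d e ≠ 0

theorem cr_perm (a b c : Plane) : cr b c a = cr a b c ∧ cr c a b = cr a b c ∧
    cr b a c = - cr a b c ∧ cr a c b = - cr a b c ∧ cr c b a = - cr a b c := by
  refine ⟨?_, ?_, ?_, ?_, ?_⟩ <;> (unfold cr; ring)

theorem cr_perm4 (a b c d : Plane) : type_of% (cr_perm a b c) ∧ type_of% (cr_perm a b d) ∧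
    type_of% (cr_perm a c d) ∧ type_of% (cr_perm b c d) :=
  ⟨cr_perm _ _ _, cr_perm _ _ _, cr_perm _ _ _, cr_perm _ _ _⟩

theorem cr_perm5 (a b c d e : Plane) : type_of% (cr_perm4 a b c d) ∧ type_of% (cr_perm a b e) ∧
    type_of% (cr_perm a c e) ∧ type_of% (cr_perm a d e) ∧ type_of% (cr_perm b c e) ∧
    type_of% (cr_perm b d e) ∧ type_of% (cr_perm c d e) :=
  ⟨cr_perm4 _ _ _ _, cr_perm _ _ _, cr_perm _ _ _, cr_perm _ _ _, cr_perm _ _ _, cr_perm _ _ _,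
   cr_perm _ _ _⟩

/-- The sign patterns compatible with the linear relation `cr_four`. -/
def alt4 (p q r s : Bool) : Bool := !(p && !q && r && !s) && !(!p && q && !r && s)

/-- The sign patterns compatible with a three-term quadratic relation. -/
def gp6 (p q r s t u : Bool) : Bool :=
  !((p == q) && !(r == s) && (t == u)) && !(!(p == q) && (r == s) && !(t == u))

theorem exists_sign {x : ℝ} (h : x ≠ 0) : ∃ s : Bool, (0 < x ↔ s = true) ∧ (x < 0 ↔ s = false) := by
  rcases h.lt_or_gt with h | h
  · exact ⟨false, by simp [h, h.le], by simp [h]⟩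
  · exact ⟨true, by simp [h], by simp [h.le]⟩

/-- Signs become Booleans so that a four-point statement is a finite check. An alternating pattern
would give all terms of `cr_four` the same sign. -/
theorem Gen4.signs {a b c d : Plane} (h : Gen4 a b c d) : ∃ s1 s2 s3 s4 : Bool,
    ((0 < cr a b c ↔ s1 = true) ∧ (cr a b c < 0 ↔ s1 = false)) ∧
    ((0 < cr a b d ↔ s2 = true) ∧ (cr a b d < 0 ↔ s2 = false)) ∧
    ((0 < cr a c d ↔ s3 = true) ∧ (cr a c d < 0 ↔ s3 = false)) ∧
    ((0 < cr b c d ↔ s4 = true) ∧ (cr b c d < 0 ↔ s4 = false)) ∧ alt4 s1 s2 s3 s4 = true := by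
  obtain ⟨s1, h1⟩ := exists_sign h.abc
  obtain ⟨s2, h2⟩ := exists_sign h.abd
  obtain ⟨s3, h3⟩ := exists_sign h.acd
  obtain ⟨s4, h4⟩ := exists_sign h.bcd
  refine ⟨s1, s2, s3, s4, h1, h2, h3, h4, ?_⟩
  have := cr_four a b c d
  cases s1 <;> cases s2 <;> cases s3 <;> cases s4 <;> simp [alt4] at * <;> linarith

/-- Three nonzero terms with vanishing sum cannot all have the same sign. -/
theorem gp6_of {p q r s t u : ℝ} {p' q' r' s' t' u' : Bool} (h : p * q - r * s + t * u = 0)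
   (hp : (0 < p ↔ p' = true) ∧ (p < 0 ↔ p' = false))
   (hq : (0 < q ↔ q' = true) ∧ (q < 0 ↔ q' = false))
   (hr : (0 < r ↔ r' = true) ∧ (r < 0 ↔ r' = false))
   (hs : (0 < s ↔ s' = true) ∧ (s < 0 ↔ s' = false))
   (ht : (0 < t ↔ t' = true) ∧ (t < 0 ↔ t' = false))
   (hu : (0 < u ↔ u' = true) ∧ (u < 0 ↔ u' = false)) : gp6 p' q' r' s' t' u' = true := by
  have key : ∀ {x y : ℝ} {x' y' : Bool}, (0 < x ↔ x' = true) ∧ (x < 0 ↔ x' = false) →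
    (0 < y ↔ y' = true) ∧ (y < 0 ↔ y' = false) → (0 < x * y ↔ (x' == y') = true) ∧
      (x * y < 0 ↔ (x' == y') = false) := by
    intro x y x' y' hx hy
    cases x' <;> cases y' <;> simp at hx hy <;> simp
    · have := mul_pos_of_neg_of_neg hx.2 hy.2; exact ⟨this, this.le⟩
    · have := mul_neg_of_neg_of_pos hx.2 hy.1; exact ⟨this.le, this⟩
    · have := mul_neg_of_pos_of_neg hx.1 hy.2; exact ⟨this.le, this⟩
    · have := mul_pos hx.1 hy.1; exact ⟨this, this.le⟩
  have h1 := key hp hq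
  have h2 := key hr hs
  have h3 := key ht hu
  unfold gp6
  generalize (p' == q') = x at *
  generalize (r' == s') = y at *
  generalize (t' == u') = z at *
  cases x <;> cases y <;> cases z <;> simp at * <;> linarith

/-- There is one affine relation for each four of the points, and one three-term Grassmann–Plücker
relation for each choice of the point common to all its factors. -/
theorem Gen5.signs {a b c d e : Plane} (h : Gen5 a b c d e) : ∃ s1 s2 s3 s4 s5 s6 s7 s8 s9 s0 : Bool,
    ((0 < cr a b c ↔ s1 = true) ∧ (cr a b c < 0 ↔ s1 = false)) ∧
    ((0 < cr a b d ↔ s2 = true) ∧ (cr a b d < 0 ↔ s2 = false)) ∧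
    ((0 < cr a b e ↔ s3 = true) ∧ (cr a b e < 0 ↔ s3 = false)) ∧
    ((0 < cr a c d ↔ s4 = true) ∧ (cr a c d < 0 ↔ s4 = false)) ∧
    ((0 < cr a c e ↔ s5 = true) ∧ (cr a c e < 0 ↔ s5 = false)) ∧
    ((0 < cr a d e ↔ s6 = true) ∧ (cr a d e < 0 ↔ s6 = false)) ∧
    ((0 < cr b c d ↔ s7 = true) ∧ (cr b c d < 0 ↔ s7 = false)) ∧
    ((0 < cr b c e ↔ s8 = true) ∧ (cr b c e < 0 ↔ s8 = false)) ∧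
    ((0 < cr b d e ↔ s9 = true) ∧ (cr b d e < 0 ↔ s9 = false)) ∧
    ((0 < cr c d e ↔ s0 = true) ∧ (cr c d e < 0 ↔ s0 = false)) ∧
    (alt4 s1 s2 s4 s7 && alt4 s1 s3 s5 s8 && alt4 s2 s3 s6 s9 && alt4 s4 s5 s6 s0 &&
     alt4 s7 s8 s9 s0 && gp6 s1 s6 s2 s5 s3 s4 && gp6 s1 s9 s2 s8 s3 s7 && gp6 s1 s0 s4 s8 s5 s7 &&
     gp6 s2 s0 s4 s9 s6 s7 && gp6 s3 s0 s5 s9 s6 s8) = true := by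
  obtain ⟨s1, h1⟩ := exists_sign h.abc
  obtain ⟨s2, h2⟩ := exists_sign h.abd
  obtain ⟨s3, h3⟩ := exists_sign h.abe
  obtain ⟨s4, h4⟩ := exists_sign h.acd
  obtain ⟨s5, h5⟩ := exists_sign h.ace
  obtain ⟨s6, h6⟩ := exists_sign h.ade
  obtain ⟨s7, h7⟩ := exists_sign h.bcd
  obtain ⟨s8, h8⟩ := exists_sign h.bce
  obtain ⟨s9, h9⟩ := exists_sign h.bde
  obtain ⟨s0, h0⟩ := exists_sign h.cde
  refine ⟨s1, s2, s3, s4, s5, s6, s7, s8, s9, s0, h1, h2, h3, h4, h5, h6, h7, h8, h9, h0, ?_⟩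
  have alt : ∀ {p q r s : ℝ} {p' q' r' s' : Bool}, s - r + q - p = 0 →
     (0 < p ↔ p' = true) ∧ (p < 0 ↔ p' = false) →
     (0 < q ↔ q' = true) ∧ (q < 0 ↔ q' = false) →
     (0 < r ↔ r' = true) ∧ (r < 0 ↔ r' = false) →
     (0 < s ↔ s' = true) ∧ (s < 0 ↔ s' = false) → alt4 p' q' r' s' = true := by
    intro p q r s p' q' r' s' h h1 h2 h3 h4
    cases p' <;> cases q' <;> cases r' <;> cases s' <;> simp [alt4] at * <;> linarith
  simp only [Bool.and_eq_true]
  refine ⟨⟨⟨⟨⟨⟨⟨⟨⟨alt (cr_four _ _ _ _) h1 h2 h4 h7, alt (cr_four _ _ _ _) h1 h3 h5 h8⟩,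
    alt (cr_four _ _ _ _) h2 h3 h6 h9⟩, alt (cr_four _ _ _ _) h4 h5 h6 h0⟩,
    alt (cr_four _ _ _ _) h7 h8 h9 h0⟩, gp6_of ?_ h1 h6 h2 h5 h3 h4⟩, gp6_of ?_ h1 h9 h2 h8 h3 h7⟩,
    gp6_of ?_ h1 h0 h4 h8 h5 h7⟩, gp6_of ?_ h2 h0 h4 h9 h6 h7⟩, gp6_of ?_ h3 h0 h5 h9 h6 h8⟩ <;>
    (unfold cr; ring)

/-! ### Distinctness and symmetries of the side, triangle and crossing predicates -/

theorem cr_self_left (a b : Plane) : cr a a b = 0 := by unfold cr; ring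
theorem cr_self_right (a b : Plane) : cr a b b = 0 := by unfold cr; ring
theorem cr_self_outer (a b : Plane) : cr a b a = 0 := by unfold cr; ring

theorem cr_ne {a b c : Plane} (h : cr a b c ≠ 0) : a ≠ b ∧ a ≠ c ∧ b ≠ c := by
  refine ⟨?_, ?_, ?_⟩ <;> rintro rfl <;> apply h <;> (unfold cr; ring)

theorem InTri.ne {a b c x : Plane} (h : InTri a b c x) :
    a ≠ b ∧ a ≠ c ∧ b ≠ c ∧ x ≠ a ∧ x ≠ b ∧ x ≠ c := by
  have h1 : cr a b x ≠ 0 ∧ cr b c x ≠ 0 ∧ cr c a x ≠ 0 := by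
    rcases h with ⟨h1, h2, h3⟩ | ⟨h1, h2, h3⟩
    · exact ⟨h1.ne', h2.ne', h3.ne'⟩
    · exact ⟨h1.ne, h2.ne, h3.ne⟩
  have a1 := cr_ne h1.1
  have a2 := cr_ne h1.2.1
  have a3 := cr_ne h1.2.2
  exact ⟨a1.1, a3.1.symm, a2.1, a1.2.1.symm, a1.2.2.symm, a2.2.2.symm⟩

theorem OppSide.ne {u v p q : Plane} (h : OppSide u v p q) :
    u ≠ v ∧ u ≠ p ∧ v ≠ p ∧ u ≠ q ∧ v ≠ q ∧ p ≠ q := by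
  have h1 : cr u v p ≠ 0 ∧ cr u v q ≠ 0 ∧ p ≠ q := by
    rcases h with ⟨h1, h2⟩ | ⟨h1, h2⟩
    · exact ⟨h1.ne', h2.ne, by rintro rfl; linarith⟩
    · exact ⟨h1.ne, h2.ne', by rintro rfl; linarith⟩
  have a1 := cr_ne h1.1
  have a2 := cr_ne h1.2.1
  exact ⟨a1.1, a1.2.1, a1.2.2, a2.2.1, a2.2.2, h1.2.2⟩

theorem SameSide.ne {u v p q : Plane} (h : SameSide u v p q) :
    u ≠ v ∧ u ≠ p ∧ v ≠ p ∧ u ≠ q ∧ v ≠ q := by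
  have h1 : cr u v p ≠ 0 ∧ cr u v q ≠ 0 := by
    rcases h with ⟨h1, h2⟩ | ⟨h1, h2⟩
    · exact ⟨h1.ne', h2.ne'⟩
    · exact ⟨h1.ne, h2.ne⟩
  have a1 := cr_ne h1.1
  have a2 := cr_ne h1.2
  exact ⟨a1.1, a1.2.1, a1.2.2, a2.2.1, a2.2.2⟩

theorem Cross.ne {a b c d : Plane} (h : Cross a b c d) :
    a ≠ b ∧ a ≠ c ∧ a ≠ d ∧ b ≠ c ∧ b ≠ d ∧ c ≠ d := by
  have h1 := h.1.ne
  exact ⟨h1.1, h1.2.1, h1.2.2.2.1, h1.2.2.1, h1.2.2.2.2.1, h1.2.2.2.2.2⟩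

theorem SameSide.comm {u v p q : Plane} : SameSide u v p q ↔ SameSide u v q p := by
  unfold SameSide; tauto
theorem OppSide.comm {u v p q : Plane} : OppSide u v p q ↔ OppSide u v q p := by
  unfold OppSide; tauto
theorem SameSide.swap {u v p q : Plane} : SameSide u v p q ↔ SameSide v u p q := by
  simp only [SameSide, cr_swap u v, neg_pos, neg_lt_zero]; tauto
theorem OppSide.swap {u v p q : Plane} : OppSide u v p q ↔ OppSide v u p q := by
  simp only [OppSide, cr_swap u v, neg_pos, neg_lt_zero]; tauto
theorem InTri.rot {a b c x : Plane} : InTri a b c x ↔ InTri b c a x := by unfold InTri; tauto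
theorem InTri.swap {a b c x : Plane} : InTri a b c x ↔ InTri b a c x := by
  unfold InTri
  rw [cr_swap a b x, cr_swap c a x, cr_swap b c x]
  simp only [neg_pos, neg_lt_zero]; tauto
theorem InTri.swap_right {a b c x : Plane} : InTri a b c x ↔ InTri a c b x := by
  rw [InTri.rot, InTri.swap, InTri.rot, InTri.rot]
theorem Cross.comm {a b c d : Plane} : Cross a b c d ↔ Cross c d a b := by
  unfold Cross; exact and_comm
theorem Cross.swap {a b c d : Plane} : Cross a b c d ↔ Cross b a c d := by
  unfold Cross; rw [OppSide.swap, OppSide.comm (u := c)]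
theorem Cross.swap_right {a b c d : Plane} : Cross a b c d ↔ Cross a b d c := by
  rw [Cross.comm, Cross.swap, Cross.comm]

theorem SameSide.trans {u v p q r : Plane} (h : SameSide u v p q) (h' : SameSide u v q r) :
    SameSide u v p r := by
  rcases h with ⟨h1, h2⟩ | ⟨h1, h2⟩ <;> rcases h' with ⟨h3, h4⟩ | ⟨h3, h4⟩
  · exact .inl ⟨h1, h4⟩
  · linarith
  · linarith
  · exact .inr ⟨h1, h4⟩

theorem SameSide.not_oppSide {u v p q : Plane} (h : SameSide u v p q) : ¬ OppSide u v p q := by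
  rintro (⟨h1, h2⟩ | ⟨h1, h2⟩) <;> rcases h with ⟨h3, h4⟩ | ⟨h3, h4⟩ <;> linarith

theorem sameSide_or_oppSide {u v p q : Plane} (hp : cr u v p ≠ 0) (hq : cr u v q ≠ 0) :
    SameSide u v p q ∨ OppSide u v p q := by
  unfold SameSide OppSide
  rcases hp.lt_or_gt with h | h <;> rcases hq.lt_or_gt with h' | h' <;> tauto

theorem OppSide.trans {u v p q r : Plane} (h : OppSide u v p q) (h' : OppSide u v q r) :
    SameSide u v p r := by
  rcases h with ⟨h1, h2⟩ | ⟨h1, h2⟩ <;> rcases h' with ⟨h3, h4⟩ | ⟨h3, h4⟩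
  · linarith
  · exact .inl ⟨h1, h4⟩
  · exact .inr ⟨h1, h4⟩
  · linarith

theorem OppSide.trans_same {u v p q r : Plane} (h : OppSide u v p q) (h' : SameSide u v q r) :
    OppSide u v p r := by
  rcases h with ⟨h1, h2⟩ | ⟨h1, h2⟩ <;> rcases h' with ⟨h3, h4⟩ | ⟨h3, h4⟩
  · linarith
  · exact .inl ⟨h1, h4⟩
  · exact .inr ⟨h1, h4⟩
  · linarith

/-! ### Configurations of four and five points -/

/-- Radon's theorem for four points. Here and in the lemmas that follow, the goal is rewritten in
Boolean signs and decided by propositional search over the admissible patterns. -/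
theorem four_cases {a b c d : Plane} (h : Gen4 a b c d) :
    InTri a b c d ∨ InTri a b d c ∨ InTri a c d b ∨ InTri b c d a ∨ Cross a b c d ∨ Cross a c b d ∨
      Cross a d b c := by
  obtain ⟨s1, s2, s3, s4, e1, e2, e3, e4, hv⟩ := h.signs
  simp only [InTri, Cross, SameSide, OppSide, cr_perm4 a b c d, neg_pos, neg_lt_zero, e1, e2, e3, e4]
  clear e1 e2 e3 e4 h
  simp only [alt4] at hv
  grind (splits := 30)

theorem inTri_of_not_cross {a u v w : Plane} (h : Gen4 a u v w) :
    SameSide u v a w → ¬ Cross a u v w → ¬ Cross a v u w → ¬ InTri u v w a → InTri a u v w := by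
  obtain ⟨s1, s2, s3, s4, e1, e2, e3, e4, hv⟩ := h.signs
  simp only [InTri, Cross, SameSide, OppSide, cr_perm4 a u v w, neg_pos, neg_lt_zero, e1, e2, e3, e4]
  clear e1 e2 e3 e4 h
  simp only [alt4] at hv
  grind (splits := 30)

theorem cross_or_inTri_of_oppSide {a v w x : Plane} (h : Gen4 a v w x) :
    OppSide a v w x → Cross a v w x ∨ InTri v w x a ∨ InTri a w x v := by
  obtain ⟨s1, s2, s3, s4, e1, e2, e3, e4, hv⟩ := h.signs
  simp only [InTri, Cross, SameSide, OppSide, cr_perm4 a v w x, neg_pos, neg_lt_zero, e1, e2, e3, e4]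
  clear e1 e2 e3 e4 h
  simp only [alt4] at hv
  grind (splits := 30)

theorem cross_of_sameSide {u v r a : Plane} (h : Gen4 u v r a) :
    SameSide u v r a → ¬ InTri u v a r → ¬ InTri u v r a →
    Cross u r v a ∨ Cross u a v r := by
  obtain ⟨s1, s2, s3, s4, e1, e2, e3, e4, hv⟩ := h.signs
  simp only [InTri, Cross, SameSide, OppSide, cr_perm4 u v r a, neg_pos, neg_lt_zero, e1, e2, e3, e4]
  clear e1 e2 e3 e4 h
  simp only [alt4] at hv
  grind (splits := 30)

theorem cross_of_oppSide {u v a q : Plane} (h : Gen4 u v a q) :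
    OppSide u v a q → ¬ InTri a q v u → ¬ InTri a q u v → Cross a q u v := by
  obtain ⟨s1, s2, s3, s4, e1, e2, e3, e4, hv⟩ := h.signs
  simp only [InTri, Cross, SameSide, OppSide, cr_perm4 u v a q, neg_pos, neg_lt_zero, e1, e2, e3, e4]
  clear e1 e2 e3 e4 h
  simp only [alt4] at hv
  grind (splits := 30)

theorem not_cross_of_oppSide_four {a u v x : Plane} (h : Gen4 a u v x) :
    OppSide u v a x → ¬ Cross a u v x := by
  obtain ⟨s1, s2, s3, s4, e1, e2, e3, e4, hv⟩ := h.signs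
  simp only [InTri, Cross, SameSide, OppSide, cr_perm4 a u v x, neg_pos, neg_lt_zero, e1, e2, e3, e4]
  clear e1 e2 e3 e4 h
  simp only [alt4] at hv
  grind (splits := 30)

theorem InTri.sameSide {a b c x : Plane} (h : Gen4 a b c x) :
    InTri a b c x → SameSide b c a x := by
  obtain ⟨s1, s2, s3, s4, e1, e2, e3, e4, hv⟩ := h.signs
  simp only [InTri, Cross, SameSide, OppSide, cr_perm4 a b c x, neg_pos, neg_lt_zero, e1, e2, e3, e4]
  clear e1 e2 e3 e4 h
  simp only [alt4] at hv
  grind (splits := 30)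

theorem inTri_of_sameSide {u v z q : Plane} (h : Gen4 u v z q) :
    SameSide u v z q → SameSide v z u q → SameSide u z v q → InTri u v z q := by
  obtain ⟨s1, s2, s3, s4, e1, e2, e3, e4, hv⟩ := h.signs
  simp only [InTri, Cross, SameSide, OppSide, cr_perm4 u v z q, neg_pos, neg_lt_zero, e1, e2, e3, e4]
  clear e1 e2 e3 e4 h
  simp only [alt4] at hv
  grind (splits := 30)

theorem InTri.oppSide_vertex {a b c p : Plane} (h : Gen4 a b c p) :
    InTri a b c p → OppSide p b a c := by
  obtain ⟨s1, s2, s3, s4, e1, e2, e3, e4, hv⟩ := h.signs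
  simp only [InTri, Cross, SameSide, OppSide, cr_perm4 a b c p, neg_pos, neg_lt_zero, e1, e2, e3, e4]
  clear e1 e2 e3 e4 h
  simp only [alt4] at hv
  grind (splits := 30)

theorem sameSide_of_not_inTri {b c q w : Plane} (h : Gen4 b c q w) :
    SameSide b c q w → OppSide q c b w → ¬ InTri b c w q → SameSide b q c w := by
  obtain ⟨s1, s2, s3, s4, e1, e2, e3, e4, hv⟩ := h.signs
  simp only [InTri, Cross, SameSide, OppSide, cr_perm4 b c q w, neg_pos, neg_lt_zero, e1, e2, e3, e4]
  clear e1 e2 e3 e4 h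
  simp only [alt4] at hv
  grind (splits := 30)

theorem Cross.sameSide {a b c d : Plane} (h : Gen4 a b c d) :
    Cross a b c d → SameSide b c a d := by
  obtain ⟨s1, s2, s3, s4, e1, e2, e3, e4, hv⟩ := h.signs
  simp only [InTri, Cross, SameSide, OppSide, cr_perm4 a b c d, neg_pos, neg_lt_zero, e1, e2, e3, e4]
  clear e1 e2 e3 e4 h
  simp only [alt4] at hv
  grind (splits := 30)

theorem seg_enters {p q r u a : Plane} (h : Gen5 p q r u a) :
    InTri p q r u → ¬ InTri p q r a → Cross a u p q ∨ Cross a u q r ∨ Cross a u r p := by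
  obtain ⟨s1, s2, s3, s4, s5, s6, s7, s8, s9, s0, e1, e2, e3, e4, e5, e6, e7, e8, e9, e0, hv⟩ := h.signs
  simp only [InTri, Cross, SameSide, OppSide, cr_perm5 p q r u a, neg_pos, neg_lt_zero, e1, e2, e3, e4, e5, e6, e7,
    e8, e9, e0]
  clear e1 e2 e3 e4 e5 e6 e7 e8 e9 e0 h
  simp only [alt4, gp6] at hv
  grind (splits := 30)

/-- The improvement step behind `exists_entry`. The sign alternatives say that the right side of
`cr_exchange` is negative and that the two denominators agree in sign, so replacing `u` by `w`
lowers the ratio minimised there. -/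
theorem entry_step {a u v x w : Plane} (h : Gen5 a u v x w) :
    InTri a u v x → SameSide u v a w → SameSide a x u w → ¬ InTri u v w x →
    ¬ InTri u v w a → InTri a w v x ∧
    ((cr v u w < 0 ∧ 0 < cr v a x ∧ 0 < cr u v a ∧ 0 < cr w v a) ∨
      (0 < cr v u w ∧ cr v a x < 0 ∧ cr u v a < 0 ∧ cr w v a < 0)) := by
  obtain ⟨s1, s2, s3, s4, s5, s6, s7, s8, s9, s0, e1, e2, e3, e4, e5, e6, e7, e8, e9, e0, hv⟩ := h.signs
  simp only [InTri, Cross, SameSide, OppSide, cr_perm5 a u v x w, neg_pos, neg_lt_zero, e1, e2, e3, e4, e5, e6, e7,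
    e8, e9, e0]
  clear e1 e2 e3 e4 e5 e6 e7 e8 e9 e0 h
  simp only [alt4, gp6] at hv
  grind (splits := 30)

/-- The counterpart of `entry_step` for `exists_exit`: the right side of `cr_exchange` is now
positive, so the ratio grows. -/
theorem exit_step {a u v x w : Plane} (h : Gen5 a u v x w) :
    InTri a u v x → OppSide u v a w → SameSide a x u w → InTri a w v x ∧
    ((0 < cr v u w ∧ 0 < cr v a x ∧ 0 < cr u v a ∧ 0 < cr w v a) ∨
      (cr v u w < 0 ∧ cr v a x < 0 ∧ cr u v a < 0 ∧ cr w v a < 0)) := by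
  obtain ⟨s1, s2, s3, s4, s5, s6, s7, s8, s9, s0, e1, e2, e3, e4, e5, e6, e7, e8, e9, e0, hv⟩ := h.signs
  simp only [InTri, Cross, SameSide, OppSide, cr_perm5 a u v x w, neg_pos, neg_lt_zero, e1, e2, e3, e4, e5, e6, e7,
    e8, e9, e0]
  clear e1 e2 e3 e4 e5 e6 e7 e8 e9 e0 h
  simp only [alt4, gp6] at hv
  grind (splits := 30)

theorem not_cross_of_oppSide {a u v w x : Plane} (h : Gen5 a u v w x) :
    OppSide u v a w → OppSide u v a x → ¬ Cross a u w x := by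
  obtain ⟨s1, s2, s3, s4, s5, s6, s7, s8, s9, s0, e1, e2, e3, e4, e5, e6, e7, e8, e9, e0, hv⟩ := h.signs
  simp only [InTri, Cross, SameSide, OppSide, cr_perm5 a u v w x, neg_pos, neg_lt_zero, e1, e2, e3, e4, e5, e6, e7,
    e8, e9, e0]
  clear e1 e2 e3 e4 e5 e6 e7 e8 e9 e0 h
  simp only [alt4, gp6] at hv
  grind (splits := 30)

theorem cross_side {a z u w x : Plane} (h : Gen5 a z u w x) :
    Cross a z w x → SameSide a z u w → ¬ InTri a z u w → Cross w x a u ∨ Cross w x z u := by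
  obtain ⟨s1, s2, s3, s4, s5, s6, s7, s8, s9, s0, e1, e2, e3, e4, e5, e6, e7, e8, e9, e0, hv⟩ := h.signs
  simp only [InTri, Cross, SameSide, OppSide, cr_perm5 a z u w x, neg_pos, neg_lt_zero, e1, e2, e3, e4, e5, e6, e7,
    e8, e9, e0]
  clear e1 e2 e3 e4 e5 e6 e7 e8 e9 e0 h
  simp only [alt4, gp6] at hv
  grind (splits := 30)

theorem inTri_flip {a z u v w : Plane} (h : Gen5 a z u v w) :
    Cross a z u v → InTri a z u w → InTri u v a w ∨ InTri u v z w := by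
  obtain ⟨s1, s2, s3, s4, s5, s6, s7, s8, s9, s0, e1, e2, e3, e4, e5, e6, e7, e8, e9, e0, hv⟩ := h.signs
  simp only [InTri, Cross, SameSide, OppSide, cr_perm5 a z u v w, neg_pos, neg_lt_zero, e1, e2, e3, e4, e5, e6, e7,
    e8, e9, e0]
  clear e1 e2 e3 e4 e5 e6 e7 e8 e9 e0 h
  simp only [alt4, gp6] at hv
  grind (splits := 30)

theorem inTri_flip_symm {a z u v x : Plane} (h : Gen5 a z u v x) :
    Cross a z u v → InTri u v a x → InTri a z u x ∨ InTri a z v x := by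
  obtain ⟨s1, s2, s3, s4, s5, s6, s7, s8, s9, s0, e1, e2, e3, e4, e5, e6, e7, e8, e9, e0, hv⟩ := h.signs
  simp only [InTri, Cross, SameSide, OppSide, cr_perm5 a z u v x, neg_pos, neg_lt_zero, e1, e2, e3, e4, e5, e6, e7,
    e8, e9, e0]
  clear e1 e2 e3 e4 e5 e6 e7 e8 e9 e0 h
  simp only [alt4, gp6] at hv
  grind (splits := 30)

theorem nested_not_inTri {a b c p q : Plane} (h : Gen5 a b c p q) :
    InTri a b c p → InTri p b c q → ¬ InTri a p c q := by
  obtain ⟨s1, s2, s3, s4, s5, s6, s7, s8, s9, s0, e1, e2, e3, e4, e5, e6, e7, e8, e9, e0, hv⟩ := h.signs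
  simp only [InTri, Cross, SameSide, OppSide, cr_perm5 a b c p q, neg_pos, neg_lt_zero, e1, e2, e3, e4, e5, e6, e7,
    e8, e9, e0]
  clear e1 e2 e3 e4 e5 e6 e7 e8 e9 e0 h
  simp only [alt4, gp6] at hv
  grind (splits := 30)

theorem nested_cross {a b c p q : Plane} (h : Gen5 a b c p q) :
    InTri a b c p → InTri a b c q → InTri p b c q → InTri a q c p → Cross a q p b := by
  obtain ⟨s1, s2, s3, s4, s5, s6, s7, s8, s9, s0, e1, e2, e3, e4, e5, e6, e7, e8, e9, e0, hv⟩ := h.signs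
  simp only [InTri, Cross, SameSide, OppSide, cr_perm5 a b c p q, neg_pos, neg_lt_zero, e1, e2, e3, e4, e5, e6, e7,
    e8, e9, e0]
  clear e1 e2 e3 e4 e5 e6 e7 e8 e9 e0 h
  simp only [alt4, gp6] at hv
  grind (splits := 30)

theorem nested_oppSide {a b c p q : Plane} (h : Gen5 a b c p q) :
    InTri a b c p → InTri p b c q → OppSide p b a q := by
  obtain ⟨s1, s2, s3, s4, s5, s6, s7, s8, s9, s0, e1, e2, e3, e4, e5, e6, e7, e8, e9, e0, hv⟩ := h.signs
  simp only [InTri, Cross, SameSide, OppSide, cr_perm5 a b c p q, neg_pos, neg_lt_zero, e1, e2, e3, e4, e5, e6, e7,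
    e8, e9, e0]
  clear e1 e2 e3 e4 e5 e6 e7 e8 e9 e0 h
  simp only [alt4, gp6] at hv
  grind (splits := 30)

theorem cross_of_sameSide_cevian {a b c p z : Plane} (h : Gen5 a b c p z) :
    InTri a b c p → InTri p b c z → SameSide a p b z → Cross a z p b := by
  obtain ⟨s1, s2, s3, s4, s5, s6, s7, s8, s9, s0, e1, e2, e3, e4, e5, e6, e7, e8, e9, e0, hv⟩ := h.signs
  simp only [InTri, Cross, SameSide, OppSide, cr_perm5 a b c p z, neg_pos, neg_lt_zero, e1, e2, e3, e4, e5, e6, e7,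
    e8, e9, e0]
  clear e1 e2 e3 e4 e5 e6 e7 e8 e9 e0 h
  simp only [alt4, gp6] at hv
  grind (splits := 30)

theorem cross_or_inTri_of_rays {a p b z y : Plane} (h : Gen5 a p b z y) :
    OppSide p b a z → OppSide p b a y → OppSide a p b z → SameSide a p b y →
    InTri p b z y ∨ Cross p y b z := by
  obtain ⟨s1, s2, s3, s4, s5, s6, s7, s8, s9, s0, e1, e2, e3, e4, e5, e6, e7, e8, e9, e0, hv⟩ := h.signs
  simp only [InTri, Cross, SameSide, OppSide, cr_perm5 a p b z y, neg_pos, neg_lt_zero, e1, e2, e3, e4, e5, e6, e7,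
    e8, e9, e0]
  clear e1 e2 e3 e4 e5 e6 e7 e8 e9 e0 h
  simp only [alt4, gp6] at hv
  grind (splits := 30)

theorem nested_orient {a c p q r : Plane} (h : Gen5 a c p q r) :
    0 < cr a q p → 0 < cr q c p → 0 < cr c a p → 0 < cr a q r → 0 < cr q c r →
    0 < cr c a r → 0 < cr c p r → 0 < cr r a p → 0 < cr p q r := by
  obtain ⟨s1, s2, s3, s4, s5, s6, s7, s8, s9, s0, e1, e2, e3, e4, e5, e6, e7, e8, e9, e0, hv⟩ := h.signs
  simp only [InTri, Cross, SameSide, OppSide, cr_perm5 a c p q r, neg_pos, neg_lt_zero, e1, e2, e3, e4, e5, e6, e7,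
    e8, e9, e0]
  clear e1 e2 e3 e4 e5 e6 e7 e8 e9 e0 h
  simp only [alt4, gp6] at hv
  grind (splits := 30)

theorem inTri_cone {p q r x b : Plane} (h : Gen5 p q r x b) :
    InTri p q r x → InTri b p q x ∨ InTri b q r x ∨ InTri b p r x := by
  obtain ⟨s1, s2, s3, s4, s5, s6, s7, s8, s9, s0, e1, e2, e3, e4, e5, e6, e7, e8, e9, e0, hv⟩ := h.signs
  simp only [InTri, Cross, SameSide, OppSide, cr_perm5 p q r x b, neg_pos, neg_lt_zero, e1, e2, e3, e4, e5, e6, e7,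
    e8, e9, e0]
  clear e1 e2 e3 e4 e5 e6 e7 e8 e9 e0 h
  simp only [alt4, gp6] at hv
  grind (splits := 30)

/-! ### General position, barycentric coordinates and convex hulls -/

/-- Any three distinct points of `P` span a proper triangle. -/
def GP (P : Finset Plane) : Prop :=
  ∀ a ∈ P, ∀ b ∈ P, ∀ c ∈ P, a ≠ b → a ≠ c → b ≠ c → cr a b c ≠ 0

theorem GP.mono {P Q : Finset Plane} (h : GP P) (hQ : Q ⊆ P) : GP Q :=
  fun a ha b hb c hc => h a (hQ ha) b (hQ hb) c (hQ hc)

theorem GP.gen4 {P : Finset Plane} (h : GP P) {a b c d : Plane} (ha : a ∈ P) (hb : b ∈ P)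
    (hc : c ∈ P) (hd : d ∈ P)
    (hn : a ≠ b ∧ a ≠ c ∧ a ≠ d ∧ b ≠ c ∧ b ≠ d ∧ c ≠ d) : Gen4 a b c d := by
  constructor <;> apply h <;> tauto

theorem GP.gen5 {P : Finset Plane} (h : GP P) {a b c d e : Plane} (ha : a ∈ P) (hb : b ∈ P)
    (hc : c ∈ P) (hd : d ∈ P) (he : e ∈ P)
    (hn : a ≠ b ∧ a ≠ c ∧ a ≠ d ∧ a ≠ e ∧ b ≠ c ∧ b ≠ d ∧ b ≠ e ∧ c ≠ d ∧ c ≠ e ∧ d ≠ e) :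
    Gen5 a b c d e := by
  constructor <;> apply h <;> tauto

/-- `x` lies in an open triangle spanned by points of `P`. -/
def InHull (P : Finset Plane) (x : Plane) : Prop :=
  ∃ u ∈ P, ∃ v ∈ P, ∃ w ∈ P, InTri u v w x

theorem InHull.mono {P Q : Finset Plane} {x : Plane} (h : InHull Q x) (hQ : Q ⊆ P) :
    InHull P x := by
  obtain ⟨u, hu, v, hv, w, hw, h⟩ := h
  exact ⟨u, hQ hu, v, hQ hv, w, hQ hw, h⟩

theorem InHull.erase [DecidableEq Plane] {P : Finset Plane} {x : Plane} (h : InHull P x) :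
    InHull (P.erase x) x := by
  obtain ⟨u, hu, v, hv, w, hw, h⟩ := h
  have := h.ne
  exact ⟨u, by simp [hu, this.2.2.2.1.symm], v, by simp [hv, this.2.2.2.2.1.symm], w,
    by simp [hw, this.2.2.2.2.2.symm], h⟩

theorem cr_sum (a b c x : Plane) : cr b c x + cr c a x + cr a b x = cr a b c := by
  unfold cr; ring

theorem cr_barycentric (a b c x u v : Plane) :
    cr u v x * cr a b c = cr u v a * cr b c x + cr u v b * cr c a x + cr u v c * cr a b x := by
  unfold cr; ring

theorem cr_combo (u v a b c : Plane) {α β γ : ℝ} (h : α + β + γ = 1) :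
    cr u v (α • a + β • b + γ • c) = α * cr u v a + β * cr u v b + γ * cr u v c := by
  have : γ = 1 - α - β := by linarith
  subst this
  simp [cr]; ring

theorem cr_combo_two (u v a b : Plane) {α β : ℝ} (h : α + β = 1) :
    cr u v (α • a + β • b) = α * cr u v a + β * cr u v b := by
  have : β = 1 - α := by linarith
  subst this
  simp [cr]; ring

/-- Cramer's rule: the barycentric coordinates are quotients of signed areas. -/
theorem eq_barycentric {a b c : Plane} (h : cr a b c ≠ 0) (x : Plane) :
    x = (cr b c x / cr a b c) • a + (cr c a x / cr a b c) • b + (cr a b x / cr a b c) • c := by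
  ext i
  simp only [PiLp.add_apply, PiLp.smul_apply, smul_eq_mul]
  field_simp
  fin_cases i <;> simp [cr] <;> ring

theorem InTri.cr_pos {a b c x : Plane} (h : InTri a b c x) :
    0 < cr b c x / cr a b c ∧ 0 < cr c a x / cr a b c ∧ 0 < cr a b x / cr a b c := by
  have := cr_sum a b c x
  rcases h with ⟨h1, h2, h3⟩ | ⟨h1, h2, h3⟩
  · have h4 : 0 < cr a b c := by linarith
    exact ⟨div_pos h2 h4, div_pos h3 h4, div_pos h1 h4⟩
  · have h4 : cr a b c < 0 := by linarith
    exact ⟨div_pos_of_neg_of_neg h2 h4, div_pos_of_neg_of_neg h3 h4,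
      div_pos_of_neg_of_neg h1 h4⟩

theorem InTri.cr_ne {a b c x : Plane} (h : InTri a b c x) : cr a b c ≠ 0 := by
  have := h.cr_pos.1
  intro h0
  simp [h0] at this

theorem exists_combo_of_inTri {a b c x : Plane} (h : InTri a b c x) :
    ∃ α β γ : ℝ, 0 < α ∧ 0 < β ∧ 0 < γ ∧ α + β + γ = 1 ∧ x = α • a + β • b + γ • c := by
  refine ⟨_, _, _, h.cr_pos.1, h.cr_pos.2.1, h.cr_pos.2.2, ?_, eq_barycentric h.cr_ne x⟩
  have := h.cr_ne
  field_simp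
  exact cr_sum a b c x

/-- `x` lies in the closed triangle `abc`. -/
def InTriClosed (a b c x : Plane) : Prop :=
  (0 ≤ cr a b x ∧ 0 ≤ cr b c x ∧ 0 ≤ cr c a x) ∨ (cr a b x ≤ 0 ∧ cr b c x ≤ 0 ∧ cr c a x ≤ 0)

theorem InTri.closed {a b c x : Plane} (h : InTri a b c x) : InTriClosed a b c x := by
  rcases h with ⟨h1, h2, h3⟩ | ⟨h1, h2, h3⟩
  · exact .inl ⟨h1.le, h2.le, h3.le⟩
  · exact .inr ⟨h1.le, h2.le, h3.le⟩

theorem InTriClosed.cr_nonneg {a b c x : Plane} (h : InTriClosed a b c x) :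
    0 ≤ cr b c x / cr a b c ∧ 0 ≤ cr c a x / cr a b c ∧ 0 ≤ cr a b x / cr a b c := by
  have := cr_sum a b c x
  rcases h with ⟨h1, h2, h3⟩ | ⟨h1, h2, h3⟩
  · have h4 : 0 ≤ cr a b c := by linarith
    exact ⟨div_nonneg h2 h4, div_nonneg h3 h4, div_nonneg h1 h4⟩
  · have h4 : cr a b c ≤ 0 := by linarith
    exact ⟨div_nonneg_of_nonpos h2 h4, div_nonneg_of_nonpos h3 h4,
      div_nonneg_of_nonpos h1 h4⟩

theorem combo_mem_convexHull {s : Set Plane} {a b c : Plane} (ha : a ∈ convexHull ℝ s)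
    (hb : b ∈ convexHull ℝ s) (hc : c ∈ convexHull ℝ s) {α β γ : ℝ} (h1 : 0 ≤ α) (h2 : 0 ≤ β)
    (h3 : 0 ≤ γ) (h : α + β + γ = 1) : α • a + β • b + γ • c ∈ convexHull ℝ s := by
  have := (convex_convexHull ℝ s).sum_mem (t := Finset.univ) (w := ![α, β, γ])
    (z := ![a, b, c]) (by intro i _; fin_cases i <;> simpa)
    (by simp [Fin.sum_univ_three, h]) (by intro i _; fin_cases i <;> simpa)
  simpa [Fin.sum_univ_three] using this

theorem mem_convexHull_triple_iff {a b c : Plane} (h : cr a b c ≠ 0) (x : Plane) :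
    x ∈ convexHull ℝ {a, b, c} ↔ InTriClosed a b c x := by
  constructor
  · intro hx
    have key : ∀ u v : Plane, Convex ℝ {y | 0 ≤ cr u v y} ∧ Convex ℝ {y | cr u v y ≤ 0} := by
      intro u v
      constructor <;>
      · intro p hp q hq s t hs ht hst
        simp only [Set.mem_ofPred_eq] at *
        rw [cr_combo_two _ _ _ _ hst]
        nlinarith
    have h2 := cr_perm a b c
    rcases h.lt_or_gt with h1 | h1
    · right
      refine ⟨convexHull_min (t := {y | cr a b y ≤ 0}) ?_ (key a b).2 hx,
        convexHull_min (t := {y | cr b c y ≤ 0}) ?_ (key b c).2 hx,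
        convexHull_min (t := {y | cr c a y ≤ 0}) ?_ (key c a).2 hx⟩ <;>
      · rintro y (rfl | rfl | rfl) <;>
        simp [cr_self_right, cr_self_outer, h1.le, h2.1, h2.2.1]
    · left
      refine ⟨convexHull_min (t := {y | 0 ≤ cr a b y}) ?_ (key a b).1 hx,
        convexHull_min (t := {y | 0 ≤ cr b c y}) ?_ (key b c).1 hx,
        convexHull_min (t := {y | 0 ≤ cr c a y}) ?_ (key c a).1 hx⟩ <;>
      · rintro y (rfl | rfl | rfl) <;>
        simp [cr_self_right, cr_self_outer, h1.le, h2.1, h2.2.1]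
  · intro hx
    rw [eq_barycentric h x]
    refine combo_mem_convexHull (subset_convexHull _ _ (by simp))
      (subset_convexHull _ _ (by simp)) (subset_convexHull _ _ (by simp)) hx.cr_nonneg.1
      hx.cr_nonneg.2.1 hx.cr_nonneg.2.2 ?_
    field_simp
    exact cr_sum a b c x

theorem InHull.mem_convexHull {P : Finset Plane} {x : Plane} (h : InHull P x) :
    x ∈ convexHull ℝ (P : Set Plane) := by
  obtain ⟨u, hu, v, hv, w, hw, h⟩ := h
  have := (mem_convexHull_triple_iff h.cr_ne x).2 h.closed
  refine convexHull_mono ?_ this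
  rintro y (rfl | rfl | rfl) <;> simpa

/-- Carathéodory's theorem supplies at most three affinely independent points. General position
excludes one or two of them and makes the inequalities for three strict. -/
theorem inHull_of_mem_convexHull [DecidableEq Plane] {P : Finset Plane} {x : Plane}
    (hgp : GP (insert x P)) (hx : x ∉ P) (h : x ∈ convexHull ℝ (P : Set Plane)) : InHull P x := by
  rw [convexHull_eq_union] at h
  simp only [Set.mem_iUnion] at h
  obtain ⟨t, htP, hai, hxt⟩ := h
  have hcard : t.card ≤ 3 := by
    have := hai.card_le_finrank_succ
    have h2 := Submodule.finrank_le (vectorSpan ℝ (Set.range ((↑) : t → Plane)))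
    simp only [Fintype.card_coe, finrank_euclideanSpace, Fintype.card_fin] at this h2
    omega
  have hne : t.Nonempty := by
    by_contra h0
    rw [Finset.not_nonempty_iff_eq_empty] at h0
    simp [h0] at hxt
  have hmem : ∀ {y}, y ∈ t → y ∈ insert x P := fun hy =>
    Finset.mem_insert_of_mem (htP hy)
  have hnx : ∀ {y}, y ∈ t → x ≠ y := by rintro y hy rfl; exact hx (htP hy)
  have h1 := Finset.card_pos.2 hne
  obtain h3 | h3 | h3 : t.card = 1 ∨ t.card = 2 ∨ t.card = 3 := by omega
  · obtain ⟨u, rfl⟩ := Finset.card_eq_one.1 h3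
    simp only [Finset.coe_singleton, convexHull_singleton, Set.mem_singleton_iff] at hxt
    exact absurd hxt (hnx (by simp))
  · obtain ⟨u, v, huv, rfl⟩ := Finset.card_eq_two.1 h3
    simp only [Finset.coe_insert, Finset.coe_singleton, convexHull_pair] at hxt
    obtain ⟨s, t, hs, ht, hst, rfl⟩ := hxt
    exfalso
    refine hgp u (hmem (by simp)) v (hmem (by simp)) _ (Finset.mem_insert_self _ _) huv
      (hnx (by simp)).symm (hnx (by simp)).symm ?_
    rw [cr_combo_two _ _ _ _ hst, cr_self_outer, cr_self_right]
    ring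
  · obtain ⟨u, v, w, huv, huw, hvw, rfl⟩ := Finset.card_eq_three.1 h3
    have hu := @hmem u (by simp)
    have hv := @hmem v (by simp)
    have hw := @hmem w (by simp)
    have hxx := Finset.mem_insert_self x P
    have xu := (hnx (y := u) (by simp)).symm
    have xv := (hnx (y := v) (by simp)).symm
    have xw := (hnx (y := w) (by simp)).symm
    simp only [Finset.coe_insert, Finset.coe_singleton] at hxt
    rw [mem_convexHull_triple_iff (hgp u hu v hv w hw huv huw hvw)] at hxt
    refine ⟨u, htP (by simp), v, htP (by simp), w, htP (by simp), ?_⟩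
    have a1 := hgp u hu v hv x hxx huv xu xv
    have a2 := hgp v hv w hw x hxx hvw xv xw
    have a3 := hgp w hw u hu x hxx huw.symm xw xu
    rcases hxt with ⟨h1, h2, h3⟩ | ⟨h1, h2, h3⟩
    · exact .inl ⟨lt_of_le_of_ne h1 a1.symm, lt_of_le_of_ne h2 a2.symm, lt_of_le_of_ne h3 a3.symm⟩
    · exact .inr ⟨lt_of_le_of_ne h1 a1, lt_of_le_of_ne h2 a2, lt_of_le_of_ne h3 a3⟩

/-! ### Extreme points -/

/-- The points of `P` that are not in an open triangle spanned by other points of `P`. -/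
noncomputable def ext (P : Finset Plane) : Finset Plane :=
  @Finset.filter _ (fun p => ¬ InHull P p) (Classical.decPred _) P

theorem mem_ext {P : Finset Plane} {p : Plane} : p ∈ ext P ↔ p ∈ P ∧ ¬ InHull P p :=
  @Finset.mem_filter _ _ (Classical.decPred _) _ _

theorem ext_subset (P : Finset Plane) : ext P ⊆ P :=
  @Finset.filter_subset _ _ (Classical.decPred _) _

theorem not_mem_convexHull_erase_iff [DecidableEq Plane] {P : Finset Plane} (hgp : GP P)
    {p : Plane} (hp : p ∈ P) : p ∉ convexHull ℝ ((P.erase p : Finset Plane) : Set Plane) ↔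
      p ∈ ext P := by
  rw [mem_ext]
  constructor
  · exact fun h => ⟨hp, fun h' => h h'.erase.mem_convexHull⟩
  · rintro ⟨-, h⟩ h'
    refine h ((inHull_of_mem_convexHull ?_ (by simp) h').mono (Finset.erase_subset _ _))
    rwa [Finset.insert_erase hp]

/-- Both sides say that the point is not in the convex hull of the others;
`not_mem_convexHull_erase_iff` supplies this for `ext`. -/
theorem hullVertices_eq_ext {P : Finset Plane} (hgp : GP P) :
    hullVertices (P : Set Plane) = ext P := by
  classical
  ext p
  rw [Finset.mem_coe, hullVertices]
  constructor
  · intro h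
    have hp : p ∈ P := extremePoints_convexHull_subset h
    rw [← not_mem_convexHull_erase_iff hgp hp]
    rw [(convex_convexHull ℝ _).mem_extremePoints_iff_mem_sdiff_convexHull_sdiff] at h
    refine fun h' => h.2 (convexHull_mono ?_ h')
    intro y hy
    simp only [Finset.coe_erase, Set.mem_sdiff, Finset.mem_coe, Set.mem_singleton_iff] at hy
    exact ⟨subset_convexHull _ _ hy.1, hy.2⟩
  · intro h
    have hp := ext_subset P h
    have h' := (not_mem_convexHull_erase_iff hgp hp).2 h
    refine ⟨subset_convexHull _ _ hp, ?_⟩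
    intro x hx y hy hxy
    by_contra hne
    apply h'
    have hPe : (P : Set Plane) = insert p ((P.erase p : Finset Plane) : Set Plane) := by
      rw [← Finset.coe_insert, Finset.insert_erase hp]
    have hnon : ((P.erase p : Finset Plane) : Set Plane).Nonempty := by
      by_contra h0
      rw [Set.not_nonempty_iff_eq_empty] at h0
      rw [hPe, h0] at hx hy
      simp only [insert_empty_eq, convexHull_singleton, Set.mem_singleton_iff] at hx hy
      exact hne (by simp [hx])
    rw [hPe, convexHull_insert hnon, convexJoin_singleton_left] at hx hy
    simp only [Set.mem_iUnion] at hx hy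
    obtain ⟨x', hx', s, t, hs, ht, hst, rfl⟩ := hx
    obtain ⟨y', hy', s', t', hs', ht', hst', rfl⟩ := hy
    obtain ⟨a, b, ha, hb, hab, he⟩ := hxy
    have ht0 : 0 < t := by
      rcases ht.lt_or_eq with h | h
      · exact h
      · exfalso; apply hne
        obtain rfl : s = 1 := by linarith
        simp [← h]
    have hc : 0 < a * t + b * t' := by
      have := mul_pos ha ht0
      have := mul_nonneg hb.le ht'
      linarith
    -- Both ends of the segment through `p` are mixtures of `p` with points `x'`, `y'` of the hull
    -- of the others. Cancelling the multiples of `p` leaves `p` as a convex combination of `x'` and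
    -- `y'`.
    have : p = (a * t / (a * t + b * t')) • x' + (b * t' / (a * t + b * t')) • y' := by
      have e : s = 1 - t := by linarith
      have e' : s' = 1 - t' := by linarith
      have eb : b = 1 - a := by linarith
      subst e e' eb
      ext i
      have := congrArg (fun z : Plane => z i) he
      simp only [PiLp.add_apply, PiLp.smul_apply, smul_eq_mul] at this ⊢
      field_simp
      linarith
    have hb' := mul_nonneg hb.le ht'
    have hm := (convex_convexHull ℝ _) hx' hy' (a := a * t / (a * t + b * t'))
      (b := b * t' / (a * t + b * t')) (by positivity) (by positivity) (by field_simp)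
    rwa [← this] at hm

/-- By Krein–Milman the extreme points alone span the hull, so Carathéodory can be applied to them.
-/
theorem exists_ext_triple {P : Finset Plane} (hgp : GP P) {x : Plane} (hx : x ∈ P)
    (hxe : x ∉ ext P) : ∃ u ∈ ext P, ∃ v ∈ ext P, ∃ w ∈ ext P, InTri u v w x := by
  classical
  have hc : x ∈ convexHull ℝ ((ext P : Finset Plane) : Set Plane) := by
    have h1 := closure_convexHull_extremePoints
      (s := convexHull ℝ (P : Set Plane)) (P.finite_toSet.isCompact_convexHull ℝ)
      (convex_convexHull ℝ _)
    change closure (convexHull ℝ (hullVertices (P : Set Plane))) = _ at h1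
    rw [hullVertices_eq_ext hgp, ((ext P).finite_toSet.isCompact_convexHull ℝ).isClosed.closure_eq]
      at h1
    rw [h1]
    exact subset_convexHull _ _ hx
  refine inHull_of_mem_convexHull (hgp.mono ?_) hxe hc
  exact Finset.insert_subset hx (ext_subset P)

/-! ### Hull edges, visibility and combinatorial triangulations -/

/-- `uv` is an edge of the convex hull of `Q`. -/
def HullEdge (Q : Finset Plane) (u v : Plane) : Prop :=
  u ∈ Q ∧ v ∈ Q ∧ u ≠ v ∧
    ∀ p ∈ Q, ∀ q ∈ Q, p ≠ u → p ≠ v → q ≠ u → q ≠ v → SameSide u v p q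

theorem HullEdge.symm {Q : Finset Plane} {u v : Plane} (h : HullEdge Q u v) : HullEdge Q v u :=
  ⟨h.2.1, h.1, h.2.2.1.symm, fun p hp q hq h1 h2 h3 h4 =>
    SameSide.swap.1 (h.2.2.2 p hp q hq h2 h1 h4 h3)⟩

/-- The open segment from `a` to the point `q` of `Q` crosses no segment between points of `Q`. -/
def Vis (Q : Finset Plane) (a q : Plane) : Prop :=
  q ∈ Q ∧ ∀ w ∈ Q, ∀ x ∈ Q, ¬ Cross a q w x

/-- The points `u, v, w` are pairwise adjacent and no point of `P` lies in the open triangle. -/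
def Face (P : Finset Plane) (G : SimpleGraph Plane) (u v w : Plane) : Prop :=
  G.Adj u v ∧ G.Adj v w ∧ G.Adj u w ∧ ∀ p ∈ P, ¬ InTri u v w p

theorem Face.rot {P : Finset Plane} {G : SimpleGraph Plane} {u v w : Plane}
    (h : Face P G u v w) : Face P G v w u :=
  ⟨h.2.1, h.2.2.1.symm, h.1.symm, fun p hp hi => h.2.2.2 p hp (InTri.rot.2 hi)⟩

theorem Face.swap {P : Finset Plane} {G : SimpleGraph Plane} {u v w : Plane}
    (h : Face P G u v w) : Face P G v u w :=
  ⟨h.1.symm, h.2.2.1, h.2.1, fun p hp hi => h.2.2.2 p hp (InTri.swap.2 hi)⟩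

/-- `x` is not on any line through two points of `P`. -/
def Generic [DecidableEq Plane] (P : Finset Plane) (x : Plane) : Prop :=
  x ∉ P ∧ GP (insert x P)

/-- A plane straight-line graph on `P` whose empty triangles cover the convex hull of `P`. -/
structure Tri [DecidableEq Plane] (P : Finset Plane) (G : SimpleGraph Plane) : Prop where
  mem : ∀ {u v}, G.Adj u v → u ∈ P
  plane : ∀ {u v w x}, G.Adj u v → G.Adj w x → ¬ Cross u v w x
  cover : ∀ {x}, Generic P x → InHull P x → ∃ u v w, Face P G u v w ∧ InTri u v w x

theorem div_lt_div_of_same_sign {a b c d : ℝ} (h : (0 < b ∧ 0 < d) ∨ (b < 0 ∧ d < 0))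
    (h' : a * d < c * b) : a / b < c / d := by
  have hbd : 0 < b * d := by
    rcases h with ⟨h1, h2⟩ | ⟨h1, h2⟩
    · exact mul_pos h1 h2
    · exact mul_pos_of_neg_of_neg h1 h2
  have hb : b ≠ 0 := by rintro rfl; simp at hbd
  have hd : d ≠ 0 := by rintro rfl; simp at hbd
  rw [← sub_neg]
  have : a / b - c / d = (a * d - c * b) / (b * d) := by field_simp
  rw [this]
  exact div_neg_of_neg_of_pos (by linarith) hbd

/-- A Grassmann–Plücker relation with pivot `v`; it is the numerator when the ratios `cr w v x / cr
w v a` and `cr u v x / cr u v a` are subtracted. -/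
theorem cr_exchange (a u v w x : Plane) :
    cr w v x * cr u v a - cr u v x * cr w v a = cr v u w * cr v a x := by
  unfold cr; ring

theorem InTri.oppSide_ray {a u v x : Plane} (h : InTri a u v x) : OppSide a x u v := by
  have h1 := cr_swap' a u x
  have h2 := cr_rot v a x
  rcases h with ⟨h3, h4, h5⟩ | ⟨h3, h4, h5⟩
  · right; constructor <;> linarith
  · left; constructor <;> linarith

section
variable [DecidableEq Plane] {Q : Finset Plane} {a x : Plane}

/-- The ratio `cr u v x / cr u v a` is the barycentric weight of `a` in `x`. Minimising it selects
the segment `uv` that the ray from `a` through `x` meets first. A point of `Q` on the side of `a`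
would yield a nearer segment by `entry_step`, so the minimiser separates `a` from the rest of `Q`.
-/
theorem exists_entry (hgp : GP (insert a (insert x Q))) (hxQ : x ∉ Q) (haQ : a ∉ Q)
    (hx : ¬ InHull Q x) (ha : ¬ InHull Q a)
    (h : ∃ u ∈ Q, ∃ v ∈ Q, InTri a u v x) :
    ∃ u ∈ Q, ∃ v ∈ Q, InTri a u v x ∧ ∀ w ∈ Q, w ≠ u → w ≠ v → OppSide u v a w := by
  have hQ : ∀ {y}, y ∈ Q → y ∈ insert a (insert x Q) := by intro y hy; simp [hy]
  have haI : a ∈ insert a (insert x Q) := by simp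
  have hxI : x ∈ insert a (insert x Q) := by simp
  let f : Plane × Plane → ℝ := fun p => cr p.1 p.2 x / cr p.1 p.2 a
  have fsymm : ∀ u v, f (u, v) = f (v, u) := by
    intro u v
    simp only [f]
    rw [cr_swap v u x, cr_swap v u a, neg_div_neg_eq]
  have key : ∀ u ∈ Q, ∀ v ∈ Q, ∀ w ∈ Q, InTri a u v x → SameSide u v a w → SameSide a x u w →
      w ≠ u → InTri a w v x ∧ f (w, v) < f (u, v) := by
    intro u hu v hv w hw hi h1 h2 hwu
    have n1 := hi.ne
    have n2 := h1.ne
    have n3 := h2.ne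
    have hg := hgp.gen5 haI (hQ hu) (hQ hv) hxI (hQ hw) (by grind)
    have hstep := entry_step hg hi h1 h2 (fun h => hx ⟨u, hu, v, hv, w, hw, h⟩)
      (fun h => ha ⟨u, hu, v, hv, w, hw, h⟩)
    refine ⟨hstep.1, ?_⟩
    have e := cr_exchange a u v w x
    refine div_lt_div_of_same_sign ?_ ?_
    · have := hstep.2; tauto
    · rcases hstep.2 with ⟨s1, s2, -⟩ | ⟨s1, s2, -⟩
      · have := mul_neg_of_neg_of_pos s1 s2
        linarith
      · have := mul_neg_of_pos_of_neg s1 s2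
        linarith
  classical
  obtain ⟨u₀, hu₀, v₀, hv₀, hi₀⟩ := h
  obtain ⟨⟨u, v⟩, huv, hmin⟩ := Finset.exists_min_image
    ((Q ×ˢ Q).filter fun p => InTri a p.1 p.2 x) f ⟨(u₀, v₀), by simp [hu₀, hv₀, hi₀]⟩
  simp only [Finset.mem_filter, Finset.mem_product, and_imp, Prod.forall] at huv hmin
  obtain ⟨⟨hu, hv⟩, hi⟩ := huv
  refine ⟨u, hu, v, hv, hi, ?_⟩
  intro w hw hwu hwv
  have n1 := hi.ne
  have c1 : cr u v a ≠ 0 := hgp _ (hQ hu) _ (hQ hv) _ haI n1.2.2.1 n1.1.symm n1.2.1.symm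
  have c2 : cr u v w ≠ 0 := hgp _ (hQ hu) _ (hQ hv) _ (hQ hw) n1.2.2.1 hwu.symm hwv.symm
  rcases sameSide_or_oppSide c1 c2 with h1 | h1
  · exfalso
    have hxw : x ≠ w := by rintro rfl; exact hxQ hw
    have haw : a ≠ w := by rintro rfl; exact haQ hw
    have c3 : cr a x u ≠ 0 := hgp _ haI _ hxI _ (hQ hu) n1.2.2.2.1.symm n1.1 n1.2.2.2.2.1
    have c4 : cr a x w ≠ 0 := hgp _ haI _ hxI _ (hQ hw) n1.2.2.2.1.symm haw hxw
    rcases sameSide_or_oppSide c3 c4 with h2 | h2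
    · obtain ⟨k1, k2⟩ := key u hu v hv w hw hi h1 h2 hwu
      exact absurd (hmin w v hw hv k1) (not_le.2 k2)
    -- The ray `ax` separates `u` from `v`, so a point `w` not on the side of `u` replaces `u` in
    -- the role of `v`.
    · have h3 : SameSide a x v w := (OppSide.comm.1 hi.oppSide_ray).trans h2
      obtain ⟨k1, k2⟩ := key v hv u hu w hw (InTri.swap_right.1 hi) (SameSide.swap.1 h1) h3 hwv
      rw [fsymm v u] at k2
      exact absurd (hmin w u hw hu k1) (not_le.2 k2)
  · exact h1

/-- The open segment `au` stays strictly on the side of `a`, while a segment between points of `Q`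
never enters that side of the line `uv`. -/
theorem vis_of_oppSide (hgp : GP (insert a Q)) (haQ : a ∉ Q) {u v : Plane} (hu : u ∈ Q)
    (hv : v ∈ Q) (huv : u ≠ v) (h : ∀ w ∈ Q, w ≠ u → w ≠ v → OppSide u v a w) : Vis Q a u := by
  refine ⟨hu, ?_⟩
  intro w hw x hx hc
  have n := hc.ne
  have hQ : ∀ {y}, y ∈ Q → y ∈ insert a Q := by intro y hy; simp [hy]
  have haI : a ∈ insert a Q := by simp
  have hav : a ≠ v := by rintro rfl; exact haQ hv
  by_cases hwv : w = v
  · subst hwv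
    refine not_cross_of_oppSide_four
      (hgp.gen4 haI (hQ hu) (hQ hv) (hQ hx) (by grind)) (h x hx ?_ ?_) hc <;> tauto
  by_cases hxv : x = v
  · subst hxv
    refine not_cross_of_oppSide_four
      (hgp.gen4 haI (hQ hu) (hQ hv) (hQ hw) (by grind)) (h w hw ?_ ?_)
      (Cross.swap_right.1 hc) <;> tauto
  · refine not_cross_of_oppSide
      (hgp.gen5 haI (hQ hu) (hQ hv) (hQ hw) (hQ hx) ?_) (h w hw ?_ ?_) (h x hx ?_ ?_) hc
    · grind
    all_goals tauto

theorem hullEdge_of_oppSide {u v : Plane} (hu : u ∈ Q)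
    (hv : v ∈ Q) (huv : u ≠ v) (h : ∀ w ∈ Q, w ≠ u → w ≠ v → OppSide u v a w) :
    HullEdge Q u v :=
  ⟨hu, hv, huv, fun p hp q hq h1 h2 h3 h4 =>
    (OppSide.comm.1 (h p hp h1 h2)).trans (h q hq h3 h4)⟩

end

/-! ### Perturbation to generic points -/

/-- The determinant of two vectors. -/
def wedge (d e : Plane) : ℝ := d 0 * e 1 - d 1 * e 0

/-- A parabolic arc starting at `m`. -/
noncomputable def arc (m d e : Plane) (ε : ℝ) : Plane := m + ε • d + ε ^ 2 • e

theorem cr_arc (p q m d e : Plane) (ε : ℝ) :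
    cr p q (arc m d e ε) = cr p q m + ε * wedge (q - p) d + ε ^ 2 * wedge (q - p) e := by
  simp [cr, arc, wedge]; ring

theorem continuous_cr (p q : Plane) : Continuous fun x => cr p q x := by
  unfold cr; fun_prop

theorem tendsto_arc (m d e : Plane) : Tendsto (arc m d e) (𝓝[>] 0) (𝓝 m) := by
  have h : Continuous (arc m d e) := by unfold arc; fun_prop
  have := h.tendsto 0
  simp only [arc, zero_smul, add_zero, ne_eq, OfNat.ofNat_ne_zero, not_false_eq_true, zero_pow] at this
  exact this.mono_left nhdsWithin_le_nhds

/-- For small positive `ε` the lowest nonzero coefficient dominates. -/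
theorem eventually_quadratic_ne {A B C : ℝ} (h : ¬ (A = 0 ∧ B = 0 ∧ C = 0)) :
    ∀ᶠ ε in 𝓝[>] (0 : ℝ), A + ε * B + ε ^ 2 * C ≠ 0 := by
  have aux : ∀ A B C : ℝ, A ≠ 0 → ∀ᶠ ε in 𝓝[>] (0 : ℝ), A + ε * B + ε ^ 2 * C ≠ 0 := by
    intro A B C hA
    have hc : Continuous fun ε : ℝ => A + ε * B + ε ^ 2 * C := by fun_prop
    have := hc.tendsto 0
    simp only [zero_mul, add_zero, ne_eq, OfNat.ofNat_ne_zero, not_false_eq_true, zero_pow] at this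
    exact (this.mono_left nhdsWithin_le_nhds).eventually_ne hA
  by_cases hA : A = 0
  · subst hA
    by_cases hB : B = 0
    · subst hB
      have hC : C ≠ 0 := by tauto
      filter_upwards [self_mem_nhdsWithin] with ε hε
      have : ε ≠ 0 := ne_of_gt hε
      simp [hC, this]
    · filter_upwards [self_mem_nhdsWithin, aux B C 0 hB] with ε hε h
      have h0 : ε ≠ 0 := ne_of_gt hε
      have : 0 + ε * B + ε ^ 2 * C = ε * (B + ε * C + ε ^ 2 * 0) := by ring
      rw [this]
      exact mul_ne_zero h0 h
  · exact aux A B C hA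

theorem isClosed_inTriClosed (u v w : Plane) : IsClosed {x | InTriClosed u v w x} := by
  have h1 := continuous_cr u v
  have h2 := continuous_cr v w
  have h3 := continuous_cr w u
  have : {x | InTriClosed u v w x} = {x | 0 ≤ cr u v x ∧ 0 ≤ cr v w x ∧ 0 ≤ cr w u x} ∪
      {x | cr u v x ≤ 0 ∧ cr v w x ≤ 0 ∧ cr w u x ≤ 0} := by
    ext x; simp [InTriClosed]
  rw [this]
  refine IsClosed.union ?_ ?_
  · exact (isClosed_le continuous_const h1).inter
      ((isClosed_le continuous_const h2).inter (isClosed_le continuous_const h3))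
  · exact (isClosed_le h1 continuous_const).inter
      ((isClosed_le h2 continuous_const).inter (isClosed_le h3 continuous_const))

section
variable [DecidableEq Plane] {P : Finset Plane} {G : SimpleGraph Plane}

theorem generic_of_ne {x : Plane} (hgp : GP P) (hcard : 2 ≤ P.card)
    (h : ∀ p ∈ P, ∀ q ∈ P, p ≠ q → cr p q x ≠ 0) : Generic P x := by
  have hx : x ∉ P := by
    intro hx
    obtain ⟨y, hy, hyx⟩ := Finset.exists_mem_ne (show 1 < P.card by omega) x
    exact h x hx y hy hyx.symm (cr_self_outer _ _)
  refine ⟨hx, ?_⟩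
  intro a ha b hb c hc hab hac hbc
  rw [Finset.mem_insert] at ha hb hc
  rcases ha with rfl | ha <;> rcases hb with rfl | hb <;> rcases hc with rfl | hc
  any_goals tauto
  · rw [← cr_rot]; exact h b hb c hc hbc
  · rw [cr_swap', neg_ne_zero]; exact h a ha c hc hac
  · exact hgp a ha b hb c hc hab hac hbc

/-- A straight approach to `m` could run inside a line spanned by `P`. With `d` and `e` independent,
the defining form of each such line restricts to a nonzero quadratic along the arc. -/
theorem eventually_generic (hgp : GP P) (hcard : 2 ≤ P.card) {m d e : Plane}
    (hd : wedge d e ≠ 0) : ∀ᶠ ε in 𝓝[>] (0 : ℝ), Generic P (arc m d e ε) := by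
  have : ∀ᶠ ε in 𝓝[>] (0 : ℝ), ∀ p ∈ P, ∀ q ∈ P, p ≠ q → cr p q (arc m d e ε) ≠ 0 := by
    rw [Filter.eventually_all_finset]
    intro p hp
    rw [Filter.eventually_all_finset]
    intro q hq
    by_cases hpq : p = q
    · simp [hpq]
    · have hz : ¬ (cr p q m = 0 ∧ wedge (q - p) d = 0 ∧ wedge (q - p) e = 0) := by
        rintro ⟨-, h1, h2⟩
        apply hd
        by_contra h3
        apply hpq
        have hx : (q - p) 0 * wedge d e = 0 := by
          have : (q - p) 0 * wedge d e = d 0 * wedge (q - p) e - e 0 * wedge (q - p) d := by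
            unfold wedge; ring
          rw [this, h1, h2]; ring
        have hy : (q - p) 1 * wedge d e = 0 := by
          have : (q - p) 1 * wedge d e = d 1 * wedge (q - p) e - e 1 * wedge (q - p) d := by
            unfold wedge; ring
          rw [this, h1, h2]; ring
        have hx' := (mul_eq_zero.1 hx).resolve_right h3
        have hy' := (mul_eq_zero.1 hy).resolve_right h3
        simp only [PiLp.sub_apply] at hx' hy'
        ext i
        fin_cases i
        · simp; linarith
        · simp; linarith
      filter_upwards [eventually_quadratic_ne hz] with ε hε _
      rwa [cr_arc]
  filter_upwards [this] with ε hε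
  exact generic_of_ne hgp hcard hε

/-- This extends the covering from generic points to arbitrary limits of them. There are finitely
many faces, each closed; if all missed `m`, they would miss the generic points of the arc close to
`m`. -/
theorem Tri.exists_face_closed (hT : Tri P G) (hgp : GP P) (hcard : 2 ≤ P.card) {m d e : Plane}
    (hd : wedge d e ≠ 0) (hin : ∀ᶠ ε in 𝓝[>] (0 : ℝ), InHull P (arc m d e ε)) :
    ∃ u v w, Face P G u v w ∧ InTriClosed u v w m := by
  by_contra hcon
  have hcon' : ∀ u v w, Face P G u v w → ¬ InTriClosed u v w m :=
    fun u v w h h' => hcon ⟨u, v, w, h, h'⟩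
  have ev : ∀ᶠ ε in 𝓝[>] (0 : ℝ), ∀ u ∈ P, ∀ v ∈ P, ∀ w ∈ P,
      ¬ (Face P G u v w ∧ InTri u v w (arc m d e ε)) := by
    simp_rw [Filter.eventually_all_finset]
    intro u _ v _ w _
    by_cases hF : Face P G u v w
    · have := (isClosed_inTriClosed u v w).isOpen_compl.mem_nhds (hcon' u v w hF)
      filter_upwards [(tendsto_arc m d e) this] with ε hε h
      exact hε h.2.closed
    · exact Eventually.of_forall fun ε h => hF h.1
  have : ∀ᶠ ε in 𝓝[>] (0 : ℝ), False := by
    filter_upwards [ev, hin, eventually_generic hgp hcard hd] with ε h1 h2 h3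
    obtain ⟨u, v, w, hF, hi⟩ := hT.cover h3 h2
    exact h1 u (hT.mem hF.1) v (hT.mem hF.2.1) w (hT.mem hF.2.1.symm) ⟨hF, hi⟩
  exact this.exists.choose_spec

theorem inTri_of_mul_pos {u v w x : Plane} {c : ℝ} (h1 : 0 < c * cr u v x) (h2 : 0 < c * cr v w x)
    (h3 : 0 < c * cr w u x) : InTri u v w x := by
  have hc : c ≠ 0 := by rintro rfl; simp at h1
  rcases hc.lt_or_gt with hc | hc
  · exact .inr ⟨by nlinarith, by nlinarith, by nlinarith⟩
  · exact .inl ⟨by nlinarith, by nlinarith, by nlinarith⟩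

/-- Some closed face contains the midpoint `m` of the hull edge. Since `P` lies on one side of the
line `uv`, only the vertices `u` and `v` can carry weight in `m`, and as `m` is not in `P` both must
occur. In particular, hull edges are edges of `G`. -/
theorem Tri.exists_face_of_hullEdge (hT : Tri P G) (hgp : GP P) (hcard : 3 ≤ P.card) {u v : Plane}
    (huv : HullEdge P u v) : ∃ z, Face P G u v z := by
  obtain ⟨hu, hv, hne, hs⟩ := huv
  obtain ⟨w, hw, hwu, hwv⟩ : ∃ w ∈ P, w ≠ u ∧ w ≠ v := by
    by_contra! h
    have : P ⊆ {u, v} := by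
      intro w hw
      by_cases h1 : w = u
      · simp [h1]
      · simp [h w hw h1]
    have := Finset.card_le_card this
    have := Finset.card_le_two (a := u) (b := v)
    omega
  set m : Plane := (1 / 2 : ℝ) • u + (1 / 2 : ℝ) • v with hm
  have hc : cr u v w ≠ 0 := hgp u hu v hv w hw hne hwu.symm hwv.symm
  have hm0 : cr u v m = 0 := by
    rw [hm, cr_combo_two _ _ _ _ (by norm_num), cr_self_outer, cr_self_right]; ring
  -- The arc leaves `m` towards `w`, hence into the triangle `uvw`; its quadratic term is parallel
  -- to `uv` and so does not affect the distance to that line.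
  have hd : wedge (w - m) (v - u) ≠ 0 := by
    have : wedge (w - m) (v - u) = - cr u v w := by
      simp [wedge, hm, cr]; ring
    rw [this]; exact neg_ne_zero.2 hc
  have hin : ∀ᶠ ε in 𝓝[>] (0 : ℝ), InHull P (arc m (w - m) (v - u) ε) := by
    have h2 : ∀ᶠ ε in 𝓝[>] (0 : ℝ), 0 < cr u v w * cr v w (arc m (w - m) (v - u) ε) := by
      have t := ((continuous_cr v w).tendsto m).comp (tendsto_arc m (w - m) (v - u))
      refine (t.const_mul (cr u v w)).eventually (lt_mem_nhds ?_)
      have : cr u v w * cr v w m = (1 / 2) * cr u v w ^ 2 := by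
        rw [hm, cr_combo_two _ _ _ _ (by norm_num), cr_self_outer, cr_rot u v w]; ring
      rw [this]; positivity
    have h3 : ∀ᶠ ε in 𝓝[>] (0 : ℝ), 0 < cr u v w * cr w u (arc m (w - m) (v - u) ε) := by
      have t := ((continuous_cr w u).tendsto m).comp (tendsto_arc m (w - m) (v - u))
      refine (t.const_mul (cr u v w)).eventually (lt_mem_nhds ?_)
      have : cr u v w * cr w u m = (1 / 2) * cr u v w ^ 2 := by
        rw [hm, cr_combo_two _ _ _ _ (by norm_num), cr_self_right, cr_rot v w u, cr_rot u v w]; ring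
      rw [this]; positivity
    filter_upwards [h2, h3, self_mem_nhdsWithin] with ε a1 a2 a3
    have a3' : 0 < ε := a3
    refine ⟨u, hu, v, hv, w, hw, inTri_of_mul_pos ?_ a1 a2⟩
    have : cr u v (arc m (w - m) (v - u) ε) = ε * cr u v w := by
      simp [cr, arc, hm]; ring
    rw [this]
    have := mul_pos a3' (mul_self_pos.2 hc)
    linarith
  obtain ⟨p, q, r, hF, hi⟩ := hT.exists_face_closed hgp (by omega) hd hin
  have hp := hT.mem hF.1
  have hq := hT.mem hF.2.1
  have hr := hT.mem hF.2.1.symm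
  have npq := hF.1.ne
  have nqr := hF.2.1.ne
  have npr := hF.2.2.1.ne
  have hpqr : cr p q r ≠ 0 := hgp p hp q hq r hr npq npr nqr
  have hmP : m ∉ P := by
    intro hmP
    by_cases h1 : m = u
    · apply hne
      have : (1 / 2 : ℝ) • (u - v) = 0 := by
        rw [← sub_eq_zero] at h1
        rw [← neg_eq_zero, ← h1, hm]; module
      simpa [sub_eq_zero] using this
    by_cases h2 : m = v
    · apply hne
      have : (1 / 2 : ℝ) • (u - v) = 0 := by
        rw [← sub_eq_zero] at h2
        rw [← h2, hm]; module
      simpa [sub_eq_zero] using this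
    exact hgp u hu v hv m hmP hne (Ne.symm h1) (Ne.symm h2) hm0
  have nn : ∀ y ∈ P, 0 ≤ cr u v w * cr u v y ∧ (y ≠ u → y ≠ v → 0 < cr u v w * cr u v y) := by
    intro y hy
    have pos : y ≠ u → y ≠ v → 0 < cr u v w * cr u v y := by
      intro h1 h2
      rcases hs w hw y hy hwu hwv h1 h2 with ⟨a, b⟩ | ⟨a, b⟩
      · exact mul_pos a b
      · exact mul_pos_of_neg_of_neg a b
    refine ⟨?_, pos⟩
    by_cases h1 : y = u
    · simp [h1, cr_self_outer]
    by_cases h2 : y = v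
    · simp [h2, cr_self_right]
    exact (pos h1 h2).le
  obtain ⟨k1, k2, k3⟩ := hi.cr_nonneg
  have hb := cr_barycentric p q r m u v
  rw [hm0, zero_mul] at hb
  -- A sum of nonnegative terms vanishes: each product of a vertex's height above `uv` with its
  -- weight in `m` is zero.
  have hb' : (cr u v w * cr u v p) * (cr q r m / cr p q r) +
      (cr u v w * cr u v q) * (cr r p m / cr p q r) +
      (cr u v w * cr u v r) * (cr p q m / cr p q r) = 0 := by
    field_simp
    linear_combination - cr u v w * hb
  have l1 := mul_nonneg (nn p hp).1 k1
  have l2 := mul_nonneg (nn q hq).1 k2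
  have l3 := mul_nonneg (nn r hr).1 k3
  have z1 : p ≠ u → p ≠ v → cr q r m / cr p q r = 0 := fun h1 h2 =>
    (mul_eq_zero.1 (le_antisymm (by linarith) l1)).resolve_left ((nn p hp).2 h1 h2).ne'
  have z2 : q ≠ u → q ≠ v → cr r p m / cr p q r = 0 := fun h1 h2 =>
    (mul_eq_zero.1 (le_antisymm (by linarith) l2)).resolve_left ((nn q hq).2 h1 h2).ne'
  have z3 : r ≠ u → r ≠ v → cr p q m / cr p q r = 0 := fun h1 h2 =>
    (mul_eq_zero.1 (le_antisymm (by linarith) l3)).resolve_left ((nn r hr).2 h1 h2).ne'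
  have hsum : cr q r m / cr p q r + cr r p m / cr p q r + cr p q m / cr p q r = 1 := by
    field_simp; exact cr_sum p q r m
  have hmb := eq_barycentric hpqr m
  have n12 : ¬ (cr q r m / cr p q r = 0 ∧ cr r p m / cr p q r = 0) := by
    rintro ⟨a1, a2⟩
    rw [a1, a2, zero_add, zero_add] at hsum
    rw [a1, a2, hsum] at hmb
    apply hmP; rw [hmb]; simpa using hr
  have n13 : ¬ (cr q r m / cr p q r = 0 ∧ cr p q m / cr p q r = 0) := by
    rintro ⟨a1, a2⟩
    rw [a1, a2, zero_add, add_zero] at hsum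
    rw [a1, a2, hsum] at hmb
    apply hmP; rw [hmb]; simpa using hq
  have n23 : ¬ (cr r p m / cr p q r = 0 ∧ cr p q m / cr p q r = 0) := by
    rintro ⟨a1, a2⟩
    rw [a1, a2, add_zero, add_zero] at hsum
    rw [a1, a2, hsum] at hmb
    apply hmP; rw [hmb]; simpa using hp
  by_cases p1 : p = u
  · subst p1
    by_cases q1 : q = v
    · subst q1; exact ⟨r, hF⟩
    · have : r = v := by
        by_contra r1
        exact n23 ⟨z2 npq.symm q1, z3 npr.symm r1⟩
      subst this; exact ⟨q, hF.rot.rot.swap⟩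
  by_cases p2 : p = v
  · subst p2
    by_cases q1 : q = u
    · subst q1; exact ⟨r, hF.swap⟩
    · have : r = u := by
        by_contra r1
        exact n23 ⟨z2 q1 npq.symm, z3 r1 npr.symm⟩
      subst this; exact ⟨q, hF.rot.rot⟩
  have zp := z1 p1 p2
  by_cases q1 : q = u
  · subst q1
    have : r = v := by
      by_contra r1
      exact n13 ⟨zp, z3 nqr.symm r1⟩
    subst this; exact ⟨p, hF.rot⟩
  by_cases q2 : q = v
  · subst q2
    have : r = u := by
      by_contra r1
      exact n13 ⟨zp, z3 r1 nqr.symm⟩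
    subst this; exact ⟨p, hF.rot.swap⟩
  exact absurd ⟨zp, z2 q1 q2⟩ n12

end

/-! ### Fan, flip and cone constructions -/

/-- `G` together with the edges from `a` to the points of `Q` visible from `a`. -/
def fanGraph (G : SimpleGraph Plane) (Q : Finset Plane) (a : Plane) : SimpleGraph Plane where
  Adj u v := G.Adj u v ∨ u ≠ v ∧ (u = a ∧ Vis Q a v ∨ v = a ∧ Vis Q a u)
  symm := ⟨by rintro u v (h | h); exacts [.inl h.symm, .inr ⟨h.1.symm, h.2.symm⟩]⟩
  loopless := ⟨by rintro u (h | h); exacts [h.ne rfl, h.1 rfl]⟩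

/-- `G` with the edge `uv` replaced by `az`. -/
def flipGraph (G : SimpleGraph Plane) (u v a z : Plane) : SimpleGraph Plane where
  Adj x y := (G.Adj x y ∧ s(x, y) ≠ s(u, v)) ∨ (x ≠ y ∧ s(x, y) = s(a, z))
  symm := ⟨by
    rintro x y (h | h)
    · exact .inl ⟨h.1.symm, by rw [Sym2.eq_swap]; exact h.2⟩
    · exact .inr ⟨h.1.symm, by rw [Sym2.eq_swap]; exact h.2⟩⟩
  loopless := ⟨by rintro u (h | h); exacts [h.1.ne rfl, h.1 rfl]⟩

/-- The edges from `b` to all points of `S`, and the edges of the convex hull of `S`. -/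
def coneGraph (S : Finset Plane) (b : Plane) : SimpleGraph Plane where
  Adj u v := u ∈ S ∧ v ∈ S ∧ u ≠ v ∧ (u = b ∨ v = b ∨ HullEdge S u v)
  symm := ⟨by
    rintro u v ⟨h1, h2, h3, h4⟩
    exact ⟨h2, h1, h3.symm, by rcases h4 with h | h | h; exacts [.inr (.inl h), .inl h, .inr (.inr h.symm)]⟩⟩
  loopless := ⟨by rintro u h; exact h.2.2.1 rfl⟩

section
variable [DecidableEq Plane]

theorem generic_mono {P Q : Finset Plane} {x : Plane} (h : Generic P x) (hQ : Q ⊆ P) :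
    Generic Q x :=
  ⟨fun h' => h.1 (hQ h'), h.2.mono (Finset.insert_subset_insert _ hQ)⟩

/-- Inside the old hull the old faces remain. Outside it, `exists_entry` gives a hull edge `uv`
facing `a` with the point in `auv`; both ends are visible, and `uv` is an old edge because it
carries a face. -/
theorem fan_tri {Q : Finset Plane} {G : SimpleGraph Plane} {a : Plane} (hT : Tri Q G)
    (hgp : GP (insert a Q)) (haQ : a ∉ Q) (ha : ¬ InHull Q a) (hcard : 3 ≤ Q.card) :
    Tri (insert a Q) (fanGraph G Q a) where
  mem := by
    rintro u v (h | ⟨-, ⟨rfl, -⟩ | ⟨-, h⟩⟩)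
    · exact Finset.mem_insert_of_mem (hT.mem h)
    · simp
    · exact Finset.mem_insert_of_mem h.1
  plane := by
    have key : ∀ {u w x}, Vis Q a u → (fanGraph G Q a).Adj w x → ¬ Cross a u w x := by
      rintro u w x hv (h | ⟨-, ⟨rfl, -⟩ | ⟨rfl, -⟩⟩) hc
      · exact hv.2 w (hT.mem h) x (hT.mem h.symm) hc
      · exact hc.ne.2.1 rfl
      · exact hc.ne.2.2.1 rfl
    rintro u v w x h1 h2 hc
    have h2' := h2
    rcases h1 with h1 | ⟨-, ⟨rfl, h1⟩ | ⟨rfl, h1⟩⟩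
    · rcases h2 with h2 | ⟨-, ⟨rfl, h2⟩ | ⟨rfl, h2⟩⟩
      · exact hT.plane h1 h2 hc
      · exact h2.2 u (hT.mem h1) v (hT.mem h1.symm) (Cross.comm.1 hc)
      · exact h2.2 u (hT.mem h1) v (hT.mem h1.symm) (Cross.swap.1 (Cross.comm.1 hc))
    · exact key h1 h2' hc
    · exact key h1 h2' (Cross.swap.1 hc)
  cover := by
    intro x hx hin
    have hxQ := generic_mono hx (Finset.subset_insert a Q)
    by_cases hQ : InHull Q x
    · obtain ⟨u, v, w, hF, hi⟩ := hT.cover hxQ hQ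
      refine ⟨u, v, w, ⟨.inl hF.1, .inl hF.2.1, .inl hF.2.2.1, ?_⟩, hi⟩
      intro p hp
      rcases Finset.mem_insert.1 hp with rfl | hp
      · exact fun h => ha ⟨u, hT.mem hF.1, v, hT.mem hF.2.1, w, hT.mem hF.2.1.symm, h⟩
      · exact hF.2.2.2 p hp
    · have hgp' : GP (insert a (insert x Q)) := by
        rw [Finset.insert_comm]; exact hx.2
      have h0 : ∃ u ∈ Q, ∃ v ∈ Q, InTri a u v x := by
        obtain ⟨u, hu, v, hv, w, hw, hi⟩ := hin
        have n := hi.ne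
        rw [Finset.mem_insert] at hu hv hw
        rcases hu with rfl | hu
        · exact ⟨v, by tauto, w, by tauto, hi⟩
        rcases hv with rfl | hv
        · exact ⟨u, by tauto, w, by tauto, InTri.swap.1 hi⟩
        rcases hw with rfl | hw
        · exact ⟨u, by tauto, v, by tauto, InTri.rot.2 hi⟩
        exact absurd ⟨u, hu, v, hv, w, hw, hi⟩ hQ
      obtain ⟨u, hu, v, hv, hi, ho⟩ := exists_entry hgp' hxQ.1 haQ hQ ha h0
      have huv := hi.ne.2.2.1
      have hE : HullEdge Q u v := hullEdge_of_oppSide hu hv huv ho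
      obtain ⟨z, hz⟩ := hT.exists_face_of_hullEdge (hgp.mono (Finset.subset_insert _ _)) hcard hE
      have vu := vis_of_oppSide hgp haQ hu hv huv ho
      have vv := vis_of_oppSide hgp haQ hv hu huv.symm
        (fun w hw h1 h2 => OppSide.swap.1 (ho w hw h2 h1))
      refine ⟨a, u, v, ⟨.inr ⟨hi.ne.1, .inl ⟨rfl, vu⟩⟩, .inl hz.1,
        .inr ⟨hi.ne.2.1, .inl ⟨rfl, vv⟩⟩, ?_⟩, hi⟩
      intro p hp hip
      have n := hip.ne
      refine (InTri.sameSide (hgp.gen4 (by simp) (by simp [hu]) (by simp [hv]) hp ?_)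
        hip).not_oppSide (ho p ?_ n.2.2.2.2.1 n.2.2.2.2.2)
      · grind
      · exact Finset.mem_of_mem_insert_of_ne hp n.2.2.2.1

/-- The triangle `azu` contains no other end `w`, since apart from the diagonal it is covered by the
two empty faces at `uv`. An edge reaching `az` from such a `w` would therefore cross `au` or `zu`.
-/
theorem face_edge_flip {P : Finset Plane} {G : SimpleGraph Plane} (hT : Tri P G) (hgp : GP P)
    {u v a z w x : Plane} (h1 : Face P G u v a) (h2 : Face P G u v z) (hc : Cross a z u v)
    (hwx : G.Adj w x) (hc' : Cross a z w x) (hs : SameSide a z u w) : w = u := by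
  by_contra hwu
  have hu := hT.mem h1.1
  have hv := hT.mem h1.2.1
  have ha := hT.mem h1.2.1.symm
  have hz := hT.mem h2.2.1.symm
  have hw := hT.mem hwx
  have hx := hT.mem hwx.symm
  have hwv : w ≠ v := by rintro rfl; exact hs.not_oppSide hc.1
  have hxu : x ≠ u := by rintro rfl; exact (SameSide.comm.1 hs).not_oppSide hc'.1
  have n1 := hc.ne
  have n2 := hc'.ne
  have hi : ¬ InTri a z u w := fun h => by
    rcases inTri_flip (hgp.gen5 ha hz hu hv hw (by grind)) hc h with h | h
    · exact h1.2.2.2 w hw h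
    · exact h2.2.2.2 w hw h
  rcases cross_side (hgp.gen5 ha hz hu hw hx (by grind)) hc' hs hi with h | h
  · exact hT.plane hwx h1.2.2.1.symm h
  · exact hT.plane hwx h2.2.2.1.symm h

/-- Two different apexes on one side of `uv` would either lie one in the other's triangle or give
crossing sides. -/
theorem face_unique {P : Finset Plane} {G : SimpleGraph Plane} (hT : Tri P G) (hgp : GP P)
    {u v r a : Plane} (h1 : Face P G u v r) (h2 : Face P G u v a) (hs : SameSide u v r a) :
    r = a := by
  by_contra hra
  have hu := hT.mem h1.1
  have hv := hT.mem h1.2.1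
  have ha := hT.mem h2.2.1.symm
  have hr := hT.mem h1.2.1.symm
  have n := hs.ne
  rcases cross_of_sameSide (hgp.gen4 hu hv hr ha (by grind)) hs (h2.2.2.2 r hr)
    (h1.2.2.2 a ha) with h | h
  · exact hT.plane h1.2.2.1 h2.2.1 h
  · exact hT.plane h2.2.2.1 h1.2.1 h

theorem flip_empty {P : Finset Plane} {G : SimpleGraph Plane} (hT : Tri P G) (hgp : GP P)
    {u v a z : Plane} (h1 : Face P G u v a) (h2 : Face P G u v z) (hc : Cross a z u v) :
    ∀ y ∈ P, ¬ InTri a z u y := by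
  have hu := hT.mem h1.1
  have hv := hT.mem h1.2.1
  have ha := hT.mem h1.2.1.symm
  have hz := hT.mem h2.2.1.symm
  have nc := hc.ne
  intro y hy hiy
  have n := hiy.ne
  by_cases hyv : y = v
  · subst hyv
    have := InTri.sameSide (hgp.gen4 hu ha hz hy (by grind)) (InTri.rot.1 (InTri.rot.1 hiy))
    exact this.not_oppSide hc.1
  rcases inTri_flip (hgp.gen5 ha hz hu hv hy (by grind)) hc hiy with h | h
  · exact h1.2.2.2 y hy h
  · exact h2.2.2.2 y hy h

/-- By `face_edge_flip` at both ends, `uv` is the only edge crossing the new diagonal. By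
`face_unique` only the two given faces use `uv`, and the triangles `azu`, `azv` cover the generic
points of both. -/
theorem flip_tri {P : Finset Plane} {G : SimpleGraph Plane} (hT : Tri P G) (hgp : GP P)
    {u v a z : Plane} (h1 : Face P G u v a) (h2 : Face P G u v z) (hc : Cross a z u v) :
    Tri P (flipGraph G u v a z) := by
  have hu := hT.mem h1.1
  have hv := hT.mem h1.2.1
  have ha := hT.mem h1.2.1.symm
  have hz := hT.mem h2.2.1.symm
  have nc := hc.ne
  have key : ∀ {w x}, G.Adj w x → s(w, x) ≠ s(u, v) → ¬ Cross a z w x := by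
    intro w x hwx hne hc'
    have hcs : Cross a z v u := Cross.swap_right.1 hc
    have c1 : cr a z u ≠ 0 := by
      have := nc
      exact hgp a ha z hz u hu (by grind) (by grind) (by grind)
    have n := hc'.ne
    have c2 : cr a z w ≠ 0 := hgp a ha z hz w (hT.mem hwx) (by grind) (by grind) (by grind)
    have hc'' : Cross a z x w := Cross.swap_right.1 hc'
    rcases sameSide_or_oppSide c1 c2 with h | h
    · have e1 := face_edge_flip hT hgp h1 h2 hc hwx hc' h
      have h' : SameSide a z v x := (OppSide.comm.1 hc.1).trans (e1 ▸ hc'.1)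
      have e2 := face_edge_flip hT hgp h1.swap h2.swap hcs hwx.symm hc'' h'
      exact hne (by rw [e1, e2])
    · have h' : SameSide a z v w := (OppSide.comm.1 hc.1).trans h
      have e1 := face_edge_flip hT hgp h1.swap h2.swap hcs hwx hc' h'
      have h'' : SameSide a z u x := h.trans hc'.1
      have e2 := face_edge_flip hT hgp h1 h2 hc hwx.symm hc'' h''
      exact hne (by rw [e1, e2, Sym2.eq_swap])
  have adj : ∀ {x y}, G.Adj x y → ¬ (x = u ∧ y = v) → ¬ (x = v ∧ y = u) →
      (flipGraph G u v a z).Adj x y := by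
    intro x y h h1 h2
    refine .inl ⟨h, ?_⟩
    rw [Ne, Sym2.eq_iff]
    tauto
  have new : (flipGraph G u v a z).Adj a z := .inr ⟨nc.1, rfl⟩
  refine ⟨?_, ?_, ?_⟩
  · rintro x y (h | ⟨-, h⟩)
    · exact hT.mem h.1
    · rw [Sym2.eq_iff] at h
      rcases h with ⟨rfl, rfl⟩ | ⟨rfl, rfl⟩ <;> assumption
  · have key2 : ∀ {w x}, (flipGraph G u v a z).Adj w x → ¬ Cross a z w x := by
      rintro w x (⟨h, h'⟩ | ⟨-, h⟩) hc'
      · exact key h h' hc'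
      · have n := hc'.ne
        rw [Sym2.eq_iff] at h
        rcases h with ⟨rfl, rfl⟩ | ⟨rfl, rfl⟩ <;> tauto
    rintro p q w x k1 k2 hc'
    have k2' := k2
    rcases k1 with ⟨k1, k1'⟩ | ⟨-, k1⟩
    · rcases k2 with ⟨k2, -⟩ | ⟨-, k2⟩
      · exact hT.plane k1 k2 hc'
      · rw [Sym2.eq_iff] at k2
        rcases k2 with ⟨rfl, rfl⟩ | ⟨rfl, rfl⟩
        · exact key k1 k1' (Cross.comm.1 hc')
        · exact key k1 k1' (Cross.swap.1 (Cross.comm.1 hc'))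
    · rw [Sym2.eq_iff] at k1
      rcases k1 with ⟨rfl, rfl⟩ | ⟨rfl, rfl⟩
      · exact key2 k2' hc'
      · exact key2 k2' (Cross.swap.1 hc')
  · intro x hx hin
    obtain ⟨p, q, r, hF, hi⟩ := hT.cover hx hin
    have hxP := hx.1
    have faceu : Face P (flipGraph G u v a z) a z u :=
      ⟨new, adj h2.2.2.1.symm (by grind) (by grind), adj h1.2.2.1.symm (by grind) (by grind),
        flip_empty hT hgp h1 h2 hc⟩
    have facev : Face P (flipGraph G u v a z) a z v :=
      ⟨new, adj h2.2.1.symm (by grind) (by grind), adj h1.2.1.symm (by grind) (by grind),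
        flip_empty hT hgp h1.swap h2.swap (Cross.swap_right.1 hc)⟩
    have done : ∀ r, Face P G u v r → InTri u v r x →
        ∃ p q r, Face P (flipGraph G u v a z) p q r ∧ InTri p q r x := by
      intro r hF hi
      have hr := hT.mem hF.2.1.symm
      have n := hi.ne
      have hI : ∀ {y}, y ∈ P → y ∈ insert x P := fun h => Finset.mem_insert_of_mem h
      have hxa : x ≠ a := by rintro rfl; exact hxP ha
      have hxz : x ≠ z := by rintro rfl; exact hxP hz
      have c1 : cr u v r ≠ 0 := hi.cr_ne
      have c2 : cr u v a ≠ 0 := hgp u hu v hv a ha (by grind) (by grind) (by grind)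
      rcases sameSide_or_oppSide c1 c2 with h | h
      · have e := face_unique hT hgp hF h1 h
        subst e
        rcases inTri_flip_symm (hx.2.gen5 (hI ha) (hI hz) (hI hu) (hI hv) (Finset.mem_insert_self _ _)
          (by grind)) hc hi with h | h
        · exact ⟨_, _, _, faceu, h⟩
        · exact ⟨_, _, _, facev, h⟩
      · have e := face_unique hT hgp hF h2 (h.trans hc.2)
        subst e
        have hc2 : Cross r a u v := Cross.swap.1 hc
        rcases inTri_flip_symm (hx.2.gen5 (hI hz) (hI ha) (hI hu) (hI hv) (Finset.mem_insert_self _ _)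
          (by grind)) hc2 hi with h | h
        · exact ⟨_, _, _, faceu, InTri.swap.1 h⟩
        · exact ⟨_, _, _, facev, InTri.swap.1 h⟩
    by_cases e1 : s(p, q) = s(u, v)
    · rw [Sym2.eq_iff] at e1
      rcases e1 with ⟨rfl, rfl⟩ | ⟨rfl, rfl⟩
      · exact done r hF hi
      · exact done r hF.swap (InTri.swap.1 hi)
    by_cases e2 : s(q, r) = s(u, v)
    · rw [Sym2.eq_iff] at e2
      rcases e2 with ⟨rfl, rfl⟩ | ⟨rfl, rfl⟩
      · exact done p hF.rot (InTri.rot.1 hi)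
      · exact done p hF.rot.swap (InTri.swap.1 (InTri.rot.1 hi))
    by_cases e3 : s(p, r) = s(u, v)
    · rw [Sym2.eq_iff] at e3
      rcases e3 with ⟨rfl, rfl⟩ | ⟨rfl, rfl⟩
      · exact done q hF.rot.rot.swap (InTri.swap.1 (InTri.rot.1 (InTri.rot.1 hi)))
      · exact done q hF.rot.rot (InTri.rot.1 (InTri.rot.1 hi))
    exact ⟨p, q, r, ⟨.inl ⟨hF.1, e1⟩, .inl ⟨hF.2.1, e2⟩, .inl ⟨hF.2.2.1, e3⟩, hF.2.2.2⟩, hi⟩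

/-- The argument of `exists_entry` with the ratio maximised: it finds the last segment met by the
ray from `b` through `x`, beyond which no point of `S` lies. -/
theorem exists_exit {S : Finset Plane} {b x : Plane} (hx : Generic S x) (hb : b ∈ S)
    (h : InHull S x) :
    ∃ u ∈ S, ∃ v ∈ S, InTri b u v x ∧ ∀ w ∈ S, w ≠ u → w ≠ v → w ≠ b → SameSide u v b w := by
  have hQ : ∀ {y}, y ∈ S → y ∈ insert x S := by intro y hy; simp [hy]
  have hxI : x ∈ insert x S := by simp
  have hxS := hx.1
  have hgp := hx.2
  have h0 : ∃ u ∈ S, ∃ v ∈ S, InTri b u v x := by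
    obtain ⟨p, hp, q, hq, r, hr, hi⟩ := h
    have n := hi.ne
    by_cases h1 : b = p
    · subst h1; exact ⟨q, hq, r, hr, hi⟩
    by_cases h2 : b = q
    · subst h2; exact ⟨p, hp, r, hr, InTri.swap.1 hi⟩
    by_cases h3 : b = r
    · subst h3; exact ⟨p, hp, q, hq, InTri.rot.2 hi⟩
    have hxb : x ≠ b := by rintro rfl; exact hxS hb
    rcases inTri_cone (hgp.gen5 (hQ hp) (hQ hq) (hQ hr) hxI (hQ hb) (by grind)) hi with h | h | h
    · exact ⟨p, hp, q, hq, h⟩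
    · exact ⟨q, hq, r, hr, h⟩
    · exact ⟨p, hp, r, hr, h⟩
  let f : Plane × Plane → ℝ := fun p => cr p.1 p.2 x / cr p.1 p.2 b
  have fsymm : ∀ u v, f (u, v) = f (v, u) := by
    intro u v
    simp only [f]
    rw [cr_swap v u x, cr_swap v u b, neg_div_neg_eq]
  have key : ∀ u ∈ S, ∀ v ∈ S, ∀ w ∈ S, InTri b u v x → OppSide u v b w → SameSide b x u w →
      InTri b w v x ∧ f (u, v) < f (w, v) := by
    intro u hu v hv w hw hi h1 h2
    have n1 := hi.ne
    have n2 := h1.ne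
    have n3 := h2.ne
    have hstep := exit_step (hgp.gen5 (hQ hb) (hQ hu) (hQ hv) hxI (hQ hw) (by grind)) hi h1 h2
    refine ⟨hstep.1, ?_⟩
    have e := cr_exchange b u v w x
    refine div_lt_div_of_same_sign ?_ ?_
    · have := hstep.2; tauto
    · rcases hstep.2 with ⟨s1, s2, -⟩ | ⟨s1, s2, -⟩
      · have := mul_pos s1 s2
        linarith
      · have := mul_pos_of_neg_of_neg s1 s2
        linarith
  classical
  obtain ⟨u₀, hu₀, v₀, hv₀, hi₀⟩ := h0
  obtain ⟨⟨u, v⟩, huv, hmax⟩ := Finset.exists_max_image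
    ((S ×ˢ S).filter fun p => InTri b p.1 p.2 x) f ⟨(u₀, v₀), by simp [hu₀, hv₀, hi₀]⟩
  simp only [Finset.mem_filter, Finset.mem_product, and_imp, Prod.forall] at huv hmax
  obtain ⟨⟨hu, hv⟩, hi⟩ := huv
  refine ⟨u, hu, v, hv, hi, ?_⟩
  intro w hw hwu hwv hwb
  have n1 := hi.ne
  have c1 : cr u v b ≠ 0 := hgp _ (hQ hu) _ (hQ hv) _ (hQ hb) n1.2.2.1 n1.1.symm n1.2.1.symm
  have c2 : cr u v w ≠ 0 := hgp _ (hQ hu) _ (hQ hv) _ (hQ hw) n1.2.2.1 hwu.symm hwv.symm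
  rcases sameSide_or_oppSide c1 c2 with h1 | h1
  · exact h1
  · exfalso
    have hxw : x ≠ w := by rintro rfl; exact hxS hw
    have c3 : cr b x u ≠ 0 := hgp _ (hQ hb) _ hxI _ (hQ hu) n1.2.2.2.1.symm n1.1 n1.2.2.2.2.1
    have c4 : cr b x w ≠ 0 := hgp _ (hQ hb) _ hxI _ (hQ hw) n1.2.2.2.1.symm hwb.symm hxw
    rcases sameSide_or_oppSide c3 c4 with h2 | h2
    · obtain ⟨k1, k2⟩ := key u hu v hv w hw hi h1 h2
      exact absurd (hmax w v hw hv k1) (not_le.2 k2)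
    · have h3 : SameSide b x v w := (OppSide.comm.1 hi.oppSide_ray).trans h2
      obtain ⟨k1, k2⟩ := key v hv u hu w hw (InTri.swap_right.1 hi) (OppSide.swap.1 h1) h3
      rw [fsymm v u] at k2
      exact absurd (hmax w u hw hu k1) (not_le.2 k2)

theorem HullEdge.not_cross {S : Finset Plane} {u v w x : Plane} (h : HullEdge S u v) (hw : w ∈ S)
    (hx : x ∈ S) : ¬ Cross u v w x := by
  intro hc
  have n := hc.ne
  exact (h.2.2.2 w hw x hx (by grind) (by grind) (by grind) (by grind)).not_oppSide hc.1

/-- Hull edges are crossed by no segment between points of `S`, and two edges at `b` share an end.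
`exists_exit` puts each generic point in a triangle from `b` to a hull edge; it is empty by convex
position. -/
theorem cone_tri {S : Finset Plane} {b : Plane} (hS : ∀ p ∈ S, ¬ InHull S p)
    (hb : b ∈ S) : Tri S (coneGraph S b) where
  mem h := h.1
  plane := by
    rintro u v w x ⟨hu, hv, huv, h1⟩ ⟨hw, hx, hwx, h2⟩ hc
    have n := hc.ne
    rcases h1 with rfl | rfl | h1
    · rcases h2 with rfl | rfl | h2
      · tauto
      · tauto
      · exact h2.not_cross hu hv (Cross.comm.1 hc)
    · rcases h2 with rfl | rfl | h2
      · tauto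
      · tauto
      · exact h2.not_cross hu hv (Cross.comm.1 hc)
    · exact h1.not_cross hw hx hc
  cover := by
    intro x hx hin
    obtain ⟨u, hu, v, hv, hi, hs⟩ := exists_exit hx hb hin
    have n := hi.ne
    have hE : HullEdge S u v := by
      refine ⟨hu, hv, n.2.2.1, ?_⟩
      have aux : ∀ p ∈ S, p ≠ u → p ≠ v → SameSide u v b p := by
        intro p hp h1 h2
        by_cases hpb : p = b
        · subst hpb
          have c : cr u v p ≠ 0 := by rw [cr_rot]; exact hi.cr_ne
          rcases c.lt_or_gt with h | h
          · exact .inr ⟨h, h⟩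
          · exact .inl ⟨h, h⟩
        · exact hs p hp h1 h2 hpb
      intro p hp q hq h1 h2 h3 h4
      exact (SameSide.comm.1 (aux p hp h1 h2)).trans (aux q hq h3 h4)
    exact ⟨b, u, v, ⟨⟨hb, hu, n.1, .inl rfl⟩, ⟨hu, hv, n.2.2.1, .inr (.inr hE)⟩,
      ⟨hb, hv, n.2.1, .inl rfl⟩, fun p hp h => hS p hp ⟨b, hb, u, hu, v, hv, h⟩⟩, hi⟩

end

/-! ### Noncomplex and chord-free graphs under addition of an outer point -/

/-- Every triangle of `G` is empty or contains all of `P`. -/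
def NC (P : Finset Plane) (G : SimpleGraph Plane) : Prop :=
  ∀ u v w, G.Adj u v → G.Adj v w → G.Adj u w →
    (∀ p ∈ P, ¬ InTri u v w p) ∨ (∀ p ∈ P, p = u ∨ p = v ∨ p = w ∨ InTri u v w p)

/-- The edges of `G` joining vertices of the convex hull are edges of the convex hull. -/
def ChordFree (P : Finset Plane) (G : SimpleGraph Plane) : Prop :=
  ∀ u ∈ ext P, ∀ v ∈ ext P, G.Adj u v → HullEdge P u v

section
variable [DecidableEq Plane]

theorem ext_mono {P Q : Finset Plane} (hQ : Q ⊆ P) {p : Plane} (hp : p ∈ ext P) (hpQ : p ∈ Q) :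
    p ∈ ext Q :=
  mem_ext.2 ⟨hpQ, fun h => (mem_ext.1 hp).2 (h.mono hQ)⟩

theorem card_ext_erase (P : Finset Plane) (a : Plane) :
    (ext P).card ≤ (ext (P.erase a)).card + 1 := by
  have : (ext P).erase a ⊆ ext (P.erase a) := by
    intro p hp
    rw [Finset.mem_erase] at hp
    exact ext_mono (Finset.erase_subset _ _) hp.2
      (Finset.mem_erase.2 ⟨hp.1, ext_subset _ hp.2⟩)
  have h1 := Finset.card_le_card this
  have h2 := Finset.pred_card_le_card_erase (s := ext P) (a := a)
  omega

/-- A triangle containing all of `P` would have every extreme point among its three vertices. -/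
theorem NC.empty {P : Finset Plane} {G : SimpleGraph Plane} (h : NC P G) (hT : Tri P G)
    (hc : 4 ≤ (ext P).card) {u v w : Plane} (h1 : G.Adj u v) (h2 : G.Adj v w) (h3 : G.Adj u w) :
    ∀ p ∈ P, ¬ InTri u v w p := by
  rcases h u v w h1 h2 h3 with h | h
  · exact h
  · exfalso
    have : ext P ⊆ {u, v, w} := by
      intro p hp
      have := mem_ext.1 hp
      rcases h p this.1 with h | h | h | h
      · simp [h]
      · simp [h]
      · simp [h]
      · exact absurd ⟨u, hT.mem h1, v, hT.mem h2, w, hT.mem h2.symm, h⟩ this.2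
    have := Finset.card_le_card this
    have := Finset.card_le_three (a := u) (b := v) (c := w)
    omega

variable {Q : Finset Plane} {G : SimpleGraph Plane} {a : Plane}

/-- If `u` were inside a triangle of points of `Q`, the segment from the outer point `a` would have
to cross one of its sides. -/
theorem vis_mem_ext (hgp : GP (insert a Q)) (haQ : a ∉ Q) (ha : ¬ InHull Q a) {u : Plane}
    (h : Vis Q a u) : u ∈ ext Q := by
  refine mem_ext.2 ⟨h.1, ?_⟩
  rintro ⟨p, hp, q, hq, r, hr, hi⟩
  have n := hi.ne
  have hu := h.1
  have hne : ∀ {y}, y ∈ Q → y ≠ a := by rintro y hy rfl; exact haQ hy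
  have := hne hp
  have := hne hq
  have := hne hr
  have := hne hu
  have hI : ∀ {y}, y ∈ Q → y ∈ insert a Q := fun h => Finset.mem_insert_of_mem h
  rcases seg_enters (hgp.gen5 (hI hp) (hI hq) (hI hr) (hI hu) (Finset.mem_insert_self _ _)
    (by grind)) hi (fun h => ha ⟨p, hp, q, hq, r, hr, h⟩) with h' | h' | h'
  · exact h.2 _ hp _ hq h'
  · exact h.2 _ hq _ hr h'
  · exact h.2 _ hr _ hp h'

/-- Every other arrangement of the four points has `vw` blocking `au`, or `uw` blocking `av`, or `a`
inside `uvw`. -/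
theorem inTri_of_vis (hgp : GP (insert a Q)) (ha : ¬ InHull Q a)
    {u v w : Plane} (hu : Vis Q a u) (hv : Vis Q a v) (hw : w ∈ Q) (h : SameSide u v a w)
    (haw : a ≠ w) : InTri a u v w := by
  have n := h.ne
  have hI : ∀ {y}, y ∈ Q → y ∈ insert a Q := fun h => Finset.mem_insert_of_mem h
  exact inTri_of_not_cross (hgp.gen4 (Finset.mem_insert_self _ _) (hI hu.1) (hI hv.1) (hI hw)
    (by grind)) h (hu.2 _ hv.1 _ hw) (hv.2 _ hu.1 _ hw)
    (fun h => ha ⟨u, hu.1, v, hv.1, w, hw, h⟩)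

theorem fan_adj (hT : Tri Q G) (haQ : a ∉ Q) {y : Plane} :
    (fanGraph G Q a).Adj a y ↔ Vis Q a y := by
  constructor
  · rintro (h | ⟨h1, ⟨-, h⟩ | ⟨rfl, -⟩⟩)
    · exact absurd (hT.mem h) haQ
    · exact h
    · exact absurd rfl h1
  · intro h
    refine .inr ⟨?_, .inl ⟨rfl, h⟩⟩
    rintro rfl; exact haQ h.1

theorem fan_adj_of_ne {x y : Plane} (hx : x ≠ a) (hy : y ≠ a) :
    (fanGraph G Q a).Adj x y ↔ G.Adj x y := by
  simp [fanGraph, hx, hy]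

/-- The other points of `Q` all lie on one side of the hull edge `uv`. On the side of `a` they are
all in `auv` by visibility; on the far side none is. -/
theorem fan_nc_at (hgp : GP (insert a Q)) (ha : ¬ InHull Q a) {u v : Plane}
    (hu : Vis Q a u) (hv : Vis Q a v) (hE : HullEdge Q u v) :
    (∀ p ∈ insert a Q, ¬ InTri a u v p) ∨
      (∀ p ∈ insert a Q, p = a ∨ p = u ∨ p = v ∨ InTri a u v p) := by
  by_cases h : ∃ w ∈ Q, w ≠ u ∧ w ≠ v ∧ SameSide u v a w
  · right
    obtain ⟨w, hw, hwu, hwv, hs⟩ := h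
    intro p hp
    by_cases h1 : p = a
    · exact .inl h1
    by_cases h2 : p = u
    · exact .inr (.inl h2)
    by_cases h3 : p = v
    · exact .inr (.inr (.inl h3))
    have hpQ := Finset.mem_of_mem_insert_of_ne hp h1
    exact .inr (.inr (.inr (inTri_of_vis hgp ha hu hv hpQ
      (hs.trans (hE.2.2.2 w hw p hpQ hwu hwv h2 h3)) (Ne.symm h1))))
  · left
    intro p hp hi
    have n := hi.ne
    refine h ⟨p, Finset.mem_of_mem_insert_of_ne hp n.2.2.2.1, n.2.2.2.2.1, n.2.2.2.2.2, ?_⟩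
    exact InTri.sameSide (hgp.gen4 (by simp) (by simp [hu.1]) (by simp [hv.1]) hp (by grind)) hi

theorem fan_nc (hT : Tri Q G) (hgp : GP (insert a Q)) (haQ : a ∉ Q) (ha : ¬ InHull Q a)
    (h1 : ∀ u v w, G.Adj u v → G.Adj v w → G.Adj u w → ∀ p ∈ Q, ¬ InTri u v w p)
    (h2 : ∀ u v, G.Adj u v → Vis Q a u → Vis Q a v → HullEdge Q u v) :
    NC (insert a Q) (fanGraph G Q a) := by
  have key : ∀ u v, (fanGraph G Q a).Adj a u → (fanGraph G Q a).Adj a v →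
      (fanGraph G Q a).Adj u v → (∀ p ∈ insert a Q, ¬ InTri a u v p) ∨
      (∀ p ∈ insert a Q, p = a ∨ p = u ∨ p = v ∨ InTri a u v p) := by
    intro u v hau hav huv
    rw [fan_adj_of_ne hau.ne' hav.ne'] at huv
    rw [fan_adj hT haQ] at hau hav
    exact fan_nc_at hgp ha hau hav (h2 u v huv hau hav)
  intro u v w huv hvw huw
  by_cases hu : u = a
  · subst hu; exact key v w huv huw hvw
  by_cases hv : v = a
  · subst hv
    rcases key u w huv.symm hvw huw with h | h
    · exact .inl fun p hp hi => h p hp (InTri.swap.1 hi)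
    · refine .inr fun p hp => ?_
      have := h p hp
      rw [InTri.swap] at this; tauto
  by_cases hw : w = a
  · subst hw
    rcases key u v huw.symm hvw.symm huv with h | h
    · exact .inl fun p hp hi => h p hp (InTri.rot.2 hi)
    · refine .inr fun p hp => ?_
      have := h p hp
      rw [InTri.rot] at this; tauto
  rw [fan_adj_of_ne hu hv] at huv
  rw [fan_adj_of_ne hv hw] at hvw
  rw [fan_adj_of_ne hu hw] at huw
  left
  intro p hp hi
  rcases Finset.mem_insert.1 hp with rfl | hp
  · exact ha ⟨u, hT.mem huv, v, hT.mem hvw, w, hT.mem hvw.symm, hi⟩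
  · exact h1 u v w huv hvw huw p hp hi

/-- Points on both sides of the line `av` would block the view of `v`, or enclose `a`, or make `v`
interior. -/
theorem hullEdge_of_vis (hgp : GP (insert a Q)) (haQ : a ∉ Q) (ha : ¬ InHull Q a) {v : Plane}
    (hv : Vis Q a v) (hve : v ∈ ext (insert a Q)) : HullEdge (insert a Q) a v := by
  have hvQ := hv.1
  refine ⟨by simp, by simp [hvQ], by rintro rfl; exact haQ hvQ, ?_⟩
  intro p hp q hq h1 h2 h3 h4
  have hpQ := Finset.mem_of_mem_insert_of_ne hp h1
  have hqQ := Finset.mem_of_mem_insert_of_ne hq h3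
  have hav : a ≠ v := by rintro rfl; exact haQ hvQ
  have c1 : cr a v p ≠ 0 := hgp a (by simp) v (by simp [hvQ]) p hp hav h1.symm h2.symm
  have c2 : cr a v q ≠ 0 := hgp a (by simp) v (by simp [hvQ]) q hq hav h3.symm h4.symm
  rcases sameSide_or_oppSide c1 c2 with h | h
  · exact h
  · exfalso
    have n := h.ne
    rcases cross_or_inTri_of_oppSide (hgp.gen4 (by simp) (by simp [hvQ]) hp hq (by grind)) h
      with h | h | h
    · exact hv.2 p hpQ q hqQ h
    · exact ha ⟨v, hvQ, p, hpQ, q, hqQ, h⟩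
    · exact (mem_ext.1 hve).2 ⟨a, by simp, p, hp, q, hq, h⟩

theorem HullEdge.insert (hgp : GP (insert a Q)) (haQ : a ∉ Q) {u v : Plane}
    (h : HullEdge Q u v) (hw : ¬ ∀ w ∈ Q, w ≠ u → w ≠ v → OppSide u v a w) :
    HullEdge (insert a Q) u v := by
  push Not at hw
  obtain ⟨w, hw, hwu, hwv, hs⟩ := hw
  obtain ⟨hu, hv, huv, hE⟩ := h
  have hau : a ≠ u := by rintro rfl; exact haQ hu
  have hav : a ≠ v := by rintro rfl; exact haQ hv
  have hs : SameSide u v a w := by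
    refine (sameSide_or_oppSide ?_ ?_).resolve_right hs
    · exact hgp u (by simp [hu]) v (by simp [hv]) a (by simp) huv hau.symm hav.symm
    · exact hgp u (by simp [hu]) v (by simp [hv]) w (by simp [hw]) huv hwu.symm hwv.symm
  have aux : ∀ p ∈ Insert.insert a Q, p ≠ u → p ≠ v → SameSide u v w p := by
    intro p hp h1 h2
    rcases Finset.mem_insert.1 hp with rfl | hp
    · exact SameSide.comm.1 hs
    · exact hE w hw p hp hwu hwv h1 h2
  exact ⟨by simp [hu], by simp [hv], huv, fun p hp q hq h1 h2 h3 h4 =>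
    (SameSide.comm.1 (aux p hp h1 h2)).trans (aux q hq h3 h4)⟩

/-- The second hypothesis excludes the only source of a new chord: a hull edge of `Q` facing `a`
whose two ends both remain extreme. -/
theorem fan_chordFree (hT : Tri Q G) (hgp : GP (insert a Q)) (haQ : a ∉ Q) (ha : ¬ InHull Q a)
    (h1 : ∀ u ∈ ext (insert a Q), ∀ v ∈ ext (insert a Q), G.Adj u v → HullEdge Q u v)
    (h2 : ∀ u ∈ ext (insert a Q), ∀ v ∈ ext (insert a Q), HullEdge Q u v →
      ¬ ∀ w ∈ Q, w ≠ u → w ≠ v → OppSide u v a w) :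
    ChordFree (insert a Q) (fanGraph G Q a) := by
  intro u hu v hv huv
  by_cases hua : u = a
  · subst hua
    exact hullEdge_of_vis hgp haQ ha ((fan_adj hT haQ).1 huv) hv
  by_cases hva : v = a
  · subst hva
    exact (hullEdge_of_vis hgp haQ ha ((fan_adj hT haQ).1 huv.symm) hu).symm
  rw [fan_adj_of_ne hua hva] at huv
  have := h1 u hu v hv huv
  exact this.insert hgp haQ (h2 u hu v hv this)

theorem fan_step (hT : Tri Q G) (hgp : GP (insert a Q)) (haQ : a ∉ Q) (ha : ¬ InHull Q a)
    (hN : NC Q G) (hC : ChordFree Q G) (hcard : 4 ≤ (ext Q).card) :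
    Tri (insert a Q) (fanGraph G Q a) ∧ NC (insert a Q) (fanGraph G Q a) := by
  have := Finset.card_le_card (ext_subset Q)
  exact ⟨fan_tri hT hgp haQ ha (by omega), fan_nc hT hgp haQ ha
    (fun u v w h1 h2 h3 => hN.empty hT hcard h1 h2 h3)
    (fun u v huv hu hv => hC u (vis_mem_ext hgp haQ ha hu) v (vis_mem_ext hgp haQ ha hv) huv)⟩

/-- The case excluded in `fan_chordFree`. Here `a` sees only `u` and `v`, and the fan turns `uv`
into a chord; it is flipped to `az`, where `z` is the apex of the old face at `uv`. -/
theorem flip_step (hT : Tri Q G) (hgp : GP (insert a Q)) (haQ : a ∉ Q) (ha : ¬ InHull Q a)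
    (hN : NC Q G) (hC : ChordFree Q G) (hcard : 4 ≤ (ext Q).card) {u v : Plane}
    (hu : u ∈ ext (insert a Q)) (hv : v ∈ ext (insert a Q)) (hE : HullEdge Q u v)
    (hopp : ∀ w ∈ Q, w ≠ u → w ≠ v → OppSide u v a w) :
    ∃ G', Tri (insert a Q) G' ∧ NC (insert a Q) G' ∧ ChordFree (insert a Q) G' := by
  have hcard' := Finset.card_le_card (ext_subset Q)
  have huQ := hE.1
  have hvQ := hE.2.1
  have huv := hE.2.2.1
  have hau : a ≠ u := by rintro rfl; exact haQ huQ
  have hav : a ≠ v := by rintro rfl; exact haQ hvQ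
  have haI : a ∈ insert a Q := by simp
  have hI : ∀ {y}, y ∈ Q → y ∈ insert a Q := fun h => Finset.mem_insert_of_mem h
  obtain ⟨z, hz⟩ := hT.exists_face_of_hullEdge (hgp.mono (Finset.subset_insert _ _)) (by omega) hE
  have hzQ := hT.mem hz.2.1.symm
  have hza : z ≠ a := by rintro rfl; exact haQ hzQ
  have vu := vis_of_oppSide hgp haQ huQ hvQ huv hopp
  have vv := vis_of_oppSide hgp haQ hvQ huQ huv.symm
    (fun w hw h1 h2 => OppSide.swap.1 (hopp w hw h2 h1))
  -- The segment `aq` passes between `u` and `v`: otherwise one of them would lie in a triangle with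
  -- `a`, `q` and the other, and would not be extreme.
  have hcross : ∀ q ∈ Q, q ≠ u → q ≠ v → Cross a q u v := by
    intro q hq h1 h2
    have haq : a ≠ q := by rintro rfl; exact haQ hq
    exact cross_of_oppSide (hgp.gen4 (hI huQ) (hI hvQ) haI (hI hq) (by grind)) (hopp q hq h1 h2)
      (fun h => (mem_ext.1 hu).2 ⟨_, haI, _, hI hq, _, hI hvQ, h⟩)
      (fun h => (mem_ext.1 hv).2 ⟨_, haI, _, hI hq, _, hI huQ, h⟩)
  have hvis : ∀ y, Vis Q a y → y = u ∨ y = v := by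
    intro y hy
    by_contra! h
    exact hy.2 u huQ v hvQ (hcross y hy.1 h.1 h.2)
  have hT1 := fan_tri hT hgp haQ ha (by omega)
  have f1 : Face (insert a Q) (fanGraph G Q a) u v a := by
    refine ⟨.inl hz.1, ((fan_adj hT haQ).2 vv).symm, ((fan_adj hT haQ).2 vu).symm, ?_⟩
    intro p hp hi
    have n := hi.ne
    have := InTri.sameSide (hgp.gen4 haI (hI huQ) (hI hvQ) hp (by grind)) (InTri.rot.2 hi)
    exact this.not_oppSide (hopp p (Finset.mem_of_mem_insert_of_ne hp (by grind))
      (by grind) (by grind))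
  have f2 : Face (insert a Q) (fanGraph G Q a) u v z := by
    refine ⟨.inl hz.1, .inl hz.2.1, .inl hz.2.2.1, ?_⟩
    intro p hp hi
    rcases Finset.mem_insert.1 hp with rfl | hp
    · exact ha ⟨u, huQ, v, hvQ, z, hzQ, hi⟩
    · exact hz.2.2.2 p hp hi
  have hc := hcross z hzQ hz.2.2.1.ne' hz.2.1.ne'
  have e1 := flip_empty hT1 hgp f1 f2 hc
  have e2 := flip_empty hT1 hgp f1.swap f2.swap (Cross.swap_right.1 hc)
  have adja : ∀ {y}, (flipGraph (fanGraph G Q a) u v a z).Adj a y → y = u ∨ y = v ∨ y = z := by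
    rintro y (⟨h, -⟩ | ⟨-, h⟩)
    · have := hvis y ((fan_adj hT haQ).1 h); tauto
    · rw [Sym2.eq_iff] at h; grind
  have adjn : ∀ {x y}, x ≠ a → y ≠ a → (flipGraph (fanGraph G Q a) u v a z).Adj x y →
      G.Adj x y ∧ s(x, y) ≠ s(u, v) := by
    rintro x y hx hy (⟨h, h'⟩ | ⟨-, h⟩)
    · exact ⟨(fan_adj_of_ne hx hy).1 h, h'⟩
    · rw [Sym2.eq_iff] at h; grind
  refine ⟨flipGraph (fanGraph G Q a) u v a z, flip_tri hT1 hgp f1 f2 hc, ?_, ?_⟩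
  · have key : ∀ x y, (flipGraph (fanGraph G Q a) u v a z).Adj a x →
        (flipGraph (fanGraph G Q a) u v a z).Adj a y →
        (flipGraph (fanGraph G Q a) u v a z).Adj x y → ∀ p ∈ insert a Q, ¬ InTri a x y p := by
      intro x y hx hy hxy p hp hi
      have h := adjn hx.ne' hy.ne' hxy
      have hne := hxy.ne
      rw [Ne, Sym2.eq_iff] at h
      rcases adja hx with rfl | rfl | rfl <;> rcases adja hy with rfl | rfl | rfl
      · exact hne rfl
      · exact h.2 (.inl ⟨rfl, rfl⟩)
      · exact e1 p hp (InTri.swap_right.1 hi)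
      · exact h.2 (.inr ⟨rfl, rfl⟩)
      · exact hne rfl
      · exact e2 p hp (InTri.swap_right.1 hi)
      · exact e1 p hp hi
      · exact e2 p hp hi
      · exact hne rfl
    intro x y w hxy hyw hxw
    left
    intro p hp hi
    by_cases hx : x = a
    · subst hx; exact key y w hxy hxw hyw p hp hi
    by_cases hy : y = a
    · subst hy; exact key x w hxy.symm hyw hxw p hp (InTri.swap.1 hi)
    by_cases hw : w = a
    · subst hw; exact key x y hxw.symm hyw.symm hxy p hp (InTri.rot.2 hi)
    have h1 := (adjn hx hy hxy).1
    have h2 := (adjn hy hw hyw).1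
    have h3 := (adjn hx hw hxw).1
    rcases Finset.mem_insert.1 hp with rfl | hp
    · exact ha ⟨x, hT.mem h1, y, hT.mem h2, w, hT.mem h2.symm, hi⟩
    · exact hN.empty hT hcard h1 h2 h3 p hp hi
  -- The new edge `az` is not a chord: if `z` were extreme, chord-freeness would make `uz` and `vz`
  -- hull edges of `Q`, whose hull would then be the triangle `uvz`.
  · have hzext : z ∉ ext (insert a Q) := by
      intro hze
      have hzQe := ext_mono (Finset.subset_insert a Q) hze hzQ
      have E1 := hC u (ext_mono (Finset.subset_insert a Q) hu huQ) z hzQe hz.2.2.1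
      have E2 := hC v (ext_mono (Finset.subset_insert a Q) hv hvQ) z hzQe hz.2.1
      have : ext Q ⊆ {u, v, z} := by
        intro q hq
        have hqQ := mem_ext.1 hq
        by_contra hn
        simp only [Finset.mem_insert, Finset.mem_singleton, not_or] at hn
        have nz := hz.2.2.1.ne
        have nz' := hz.2.1.ne
        exact hqQ.2 ⟨u, huQ, v, hvQ, z, hzQ, inTri_of_sameSide
          (hgp.gen4 (hI huQ) (hI hvQ) (hI hzQ) (hI hqQ.1) (by grind))
          (hE.2.2.2 z hzQ q hqQ.1 (by grind) (by grind) (by grind) (by grind))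
          (E2.2.2.2 u huQ q hqQ.1 (by grind) (by grind) (by grind) (by grind))
          (E1.2.2.2 v hvQ q hqQ.1 (by grind) (by grind) (by grind) (by grind))⟩
      have := Finset.card_le_card this
      have := Finset.card_le_three (a := u) (b := v) (c := z)
      omega
    have keya : ∀ y, y ∈ ext (insert a Q) → (flipGraph (fanGraph G Q a) u v a z).Adj a y →
        HullEdge (insert a Q) a y := by
      intro y hye hy
      rcases adja hy with rfl | rfl | rfl
      · exact hullEdge_of_vis hgp haQ ha vu hye
      · exact hullEdge_of_vis hgp haQ ha vv hye
      · exact absurd hye hzext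
    intro x hx y hy hxy
    by_cases hxa : x = a
    · subst hxa; exact keya y hy hxy
    by_cases hya : y = a
    · subst hya; exact (keya x hx hxy.symm).symm
    have h := adjn hxa hya hxy
    have hxQ := hT.mem h.1
    have hyQ := hT.mem h.1.symm
    have hE' := hC x (ext_mono (Finset.subset_insert a Q) hx hxQ) y
      (ext_mono (Finset.subset_insert a Q) hy hyQ) h.1
    refine hE'.insert hgp haQ ?_
    intro ho
    have vx := hvis x (vis_of_oppSide hgp haQ hxQ hyQ hxy.ne ho)
    have vy := hvis y (vis_of_oppSide hgp haQ hyQ hxQ hxy.ne'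
      (fun w hw h1 h2 => OppSide.swap.1 (ho w hw h2 h1)))
    have := h.2
    have := hxy.ne
    rw [Ne, Sym2.eq_iff] at *
    grind

end

/-! ### Hulls with at least four vertices -/

theorem InTri.cr_mul_nonneg {r s t q u v : Plane} {c : ℝ} (h : InTri r s t q)
    (h1 : 0 ≤ c * cr u v r) (h2 : 0 ≤ c * cr u v s) (h3 : 0 ≤ c * cr u v t) :
    0 ≤ c * cr u v q := by
  obtain ⟨α, β, γ, ha, hb, hc, hs, rfl⟩ := exists_combo_of_inTri h
  rw [cr_combo _ _ _ _ _ hs]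
  have := mul_nonneg ha.le h1
  have := mul_nonneg hb.le h2
  have := mul_nonneg hc.le h3
  linarith

theorem sameSide_of_mul_pos {u v p q : Plane} (h : 0 < cr u v p * cr u v q) :
    SameSide u v p q := by
  rcases pos_and_pos_or_neg_and_neg_of_mul_pos h with h | h
  · exact .inl h
  · exact .inr h

theorem SameSide.mul_pos {u v p q : Plane} (h : SameSide u v p q) :
    0 < cr u v p * cr u v q := by
  rcases h with ⟨h1, h2⟩ | ⟨h1, h2⟩
  · exact _root_.mul_pos h1 h2
  · exact mul_pos_of_neg_of_neg h1 h2

section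
variable [DecidableEq Plane]

theorem cone_adj {S : Finset Plane} {b u v : Plane} (h : (coneGraph S b).Adj u v) :
    u = b ∨ v = b ∨ HullEdge S u v := h.2.2.2

/-- A line through two extreme points having all extreme points on one side supports `P`. -/
theorem sameSide_of_ext {P : Finset Plane} (hgp : GP P) {u v p : Plane} (hu : u ∈ P) (hv : v ∈ P)
    (h : ∀ y ∈ ext P, y ≠ u → y ≠ v → SameSide u v p y) (hp : cr u v p ≠ 0) {q : Plane}
    (hq : q ∈ P) (hqu : q ≠ u) (hqv : q ≠ v) : SameSide u v p q := by
  have huv : u ≠ v := by rintro rfl; exact hp (cr_self_left _ _)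
  by_cases hqe : q ∈ ext P
  · exact h q hqe hqu hqv
  have aux : ∀ y ∈ ext P, 0 ≤ cr u v p * cr u v y := by
    intro y hy
    by_cases h1 : y = u
    · simp [h1, cr_self_outer]
    by_cases h2 : y = v
    · simp [h2, cr_self_right]
    exact (h y hy h1 h2).mul_pos.le
  -- A non-extreme point is a convex combination of extreme ones, so it inherits their weak
  -- inequality; general position makes this strict.
  obtain ⟨r, hr, s, hs, t, ht, hi⟩ := exists_ext_triple hgp hq hqe
  have h0 := hi.cr_mul_nonneg (aux r hr) (aux s hs) (aux t ht)
  have hcq : cr u v q ≠ 0 := hgp u hu v hv q hq huv hqu.symm hqv.symm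
  exact sameSide_of_mul_pos (lt_of_le_of_ne h0 (mul_ne_zero hp hcq).symm)

/-- `P` has a plane triangulation with no chords and no complex triangles. -/
def Good (P : Finset Plane) : Prop :=
  ∃ G, Tri P G ∧ NC P G ∧ ChordFree P G

theorem good_of_fan {P : Finset Plane} (hgp : GP P) {a : Plane} (ha : a ∈ ext P)
    (hQ : Good (P.erase a)) (hcard : 4 ≤ (ext (P.erase a)).card)
    (hear : ∀ u ∈ ext P, ∀ v ∈ ext P, HullEdge (P.erase a) u v →
      ¬ ∀ w ∈ P.erase a, w ≠ u → w ≠ v → OppSide u v a w) : Good P := by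
  have haP := mem_ext.1 ha
  have hP := Finset.insert_erase haP.1
  obtain ⟨G, hT, hN, hC⟩ := hQ
  have hgp' : GP (insert a (P.erase a)) := by rwa [hP]
  have haQ : a ∉ P.erase a := by simp
  have hin : ¬ InHull (P.erase a) a := fun h => haP.2 (h.mono (Finset.erase_subset _ _))
  have h1 := fan_step hT hgp' haQ hin hN hC hcard
  refine ⟨fanGraph G (P.erase a) a, ?_⟩
  rw [← hP]
  refine ⟨by simpa using h1.1, by simpa using h1.2, ?_⟩
  have h2 := fan_chordFree hT hgp' haQ hin (fun u hu v hv huv => ?_) (by rwa [hP])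
  · simpa using h2
  · rw [hP] at hu hv
    exact hC u (ext_mono (Finset.erase_subset _ _) hu (hT.mem huv)) v
      (ext_mono (Finset.erase_subset _ _) hv (hT.mem huv.symm)) huv

theorem good_of_flip {P : Finset Plane} (hgp : GP P) {a u v : Plane} (ha : a ∈ ext P)
    (hQ : Good (P.erase a)) (hcard : 4 ≤ (ext (P.erase a)).card)
    (hu : u ∈ ext P) (hv : v ∈ ext P) (hE : HullEdge (P.erase a) u v)
    (hopp : ∀ w ∈ P.erase a, w ≠ u → w ≠ v → OppSide u v a w) : Good P := by
  have haP := mem_ext.1 ha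
  have hP := Finset.insert_erase haP.1
  obtain ⟨G, hT, hN, hC⟩ := hQ
  have := flip_step (a := a) hT (by rwa [hP]) (by simp)
    (fun h => haP.2 (h.mono (Finset.erase_subset _ _))) hN hC hcard
    (by rwa [hP]) (by rwa [hP]) hE hopp
  rwa [hP] at this

/-- The hull is a quadrilateral with diagonals `p₁p₃` and `p₂p₄`. Deleting the corner on the side of
`p₂p₄` where `d` lies leaves at least four hull vertices, and `d` keeps `p₂p₄` from becoming a chord
of the type handled by `flip_step`. -/
theorem good_of_four {P : Finset Plane} (hgp : GP P) {p₁ p₂ p₃ p₄ d : Plane}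
    (hext : ext P = {p₁, p₂, p₃, p₄}) (hc : Cross p₁ p₃ p₂ p₄) (hd : d ∈ P) (hde : d ∉ ext P)
    (hs : SameSide p₂ p₄ p₁ d)
    (IH : ∀ Q : Finset Plane, Q.card < P.card → GP Q → 4 ≤ (ext Q).card → (∃ d ∈ Q, d ∉ ext Q) →
      Good Q) : Good P := by
  have n := hc.ne
  have m1 : p₁ ∈ ext P := by simp [hext]
  have m2 : p₂ ∈ ext P := by simp [hext]
  have m3 : p₃ ∈ ext P := by simp [hext]
  have m4 : p₄ ∈ ext P := by simp [hext]
  have i1 := ext_subset P m1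
  have i2 := ext_subset P m2
  have i3 := ext_subset P m3
  have i4 := ext_subset P m4
  set Q := P.erase p₁ with hQdef
  have q2 : p₂ ∈ Q := by simp [Q, i2, n.2.1.symm]
  have q3 : p₃ ∈ Q := by simp [Q, i3, n.1.symm]
  have q4 : p₄ ∈ Q := by simp [Q, i4, n.2.2.1.symm]
  have hd1 : d ≠ p₁ := by rintro rfl; exact hde m1
  have hd2 : d ≠ p₂ := by rintro rfl; exact hde m2
  have hd3 : d ≠ p₃ := by rintro rfl; exact hde m3
  have hd4 : d ≠ p₄ := by rintro rfl; exact hde m4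
  have qd : d ∈ Q := by simp [Q, hd, hd1]
  have hQP : Q ⊆ P := Finset.erase_subset _ _
  have hgpQ : GP Q := hgp.mono hQP
  have s32 : SameSide p₃ p₂ p₁ p₄ :=
    Cross.sameSide (hgp.gen4 i1 i3 i2 i4 (by grind)) hc
  have s34 : SameSide p₃ p₄ p₁ p₂ :=
    Cross.sameSide (hgp.gen4 i1 i3 i4 i2 (by grind)) (Cross.swap_right.1 hc)
  have hear : ∀ u ∈ ext P, ∀ v ∈ ext P, HullEdge Q u v →
      ¬ ∀ w ∈ Q, w ≠ u → w ≠ v → OppSide u v p₁ w := by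
    intro u hu v hv hE ho
    have a1 : u ≠ p₁ := Finset.ne_of_mem_erase hE.1
    have a2 : v ≠ p₁ := Finset.ne_of_mem_erase hE.2.1
    have a3 := hE.2.2.1
    simp only [hext, Finset.mem_insert, Finset.mem_singleton] at hu hv
    have b1 : OppSide p₃ p₂ p₁ p₄ → False := s32.not_oppSide
    have b2 : OppSide p₃ p₄ p₁ p₂ → False := s34.not_oppSide
    have b3 : OppSide p₂ p₄ p₁ d → False := hs.not_oppSide
    rcases hu with rfl | rfl | rfl | rfl
    · exact a1 rfl
    · rcases hv with rfl | rfl | rfl | rfl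
      · exact a2 rfl
      · exact a3 rfl
      · exact b1 (OppSide.swap.1 (ho _ q4 (by grind) (by grind)))
      · exact b3 (ho _ qd (by grind) (by grind))
    · rcases hv with rfl | rfl | rfl | rfl
      · exact a2 rfl
      · exact b1 (ho _ q4 (by grind) (by grind))
      · exact a3 rfl
      · exact b2 (ho _ q2 (by grind) (by grind))
    · rcases hv with rfl | rfl | rfl | rfl
      · exact a2 rfl
      · exact b3 (OppSide.swap.1 (ho _ qd (by grind) (by grind)))
      · exact b2 (OppSide.swap.1 (ho _ q2 (by grind) (by grind)))
      · exact a3 rfl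
  have e2 : p₂ ∈ ext Q := ext_mono hQP m2 q2
  have e3 : p₃ ∈ ext Q := ext_mono hQP m3 q3
  have e4 : p₄ ∈ ext Q := ext_mono hQP m4 q4
  have hsub : ({p₂, p₃, p₄} : Finset Plane) ⊆ ext Q := by
    intro y hy
    simp only [Finset.mem_insert, Finset.mem_singleton] at hy
    rcases hy with rfl | rfl | rfl <;> assumption
  have hcard3 : ({p₂, p₃, p₄} : Finset Plane).card = 3 := by
    rw [Finset.card_eq_three]; exact ⟨p₂, p₃, p₄, by grind, by grind, by grind, rfl⟩
  -- If only `p₂`, `p₃`, `p₄` were extreme, `d` would lie on the side of `p₂p₄` containing `p₃`,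
  -- opposite to `p₁`.
  have hcard : 4 ≤ (ext Q).card := by
    by_contra hlt
    have hle := Finset.card_le_card hsub
    have heq : {p₂, p₃, p₄} = ext Q := Finset.eq_of_subset_of_card_le hsub (by omega)
    have hdQ : d ∉ ext Q := by rw [← heq]; simp [hd2, hd3, hd4]
    have c1 : cr p₂ p₄ p₃ ≠ 0 := hgp _ i2 _ i4 _ i3 (by grind) (by grind) (by grind)
    have := sameSide_of_ext hgpQ q2 q4 (p := p₃) (fun y hy h1 h2 => by
      rw [← heq] at hy
      simp only [Finset.mem_insert, Finset.mem_singleton] at hy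
      have : y = p₃ := by tauto
      subst this
      exact sameSide_of_mul_pos (mul_self_pos.2 c1)) c1 qd hd2 hd4
    exact (hs.trans (SameSide.comm.1 this)).not_oppSide hc.2
  by_cases hne : ∃ d ∈ Q, d ∉ ext Q
  · exact good_of_fan hgp m1 (IH Q (Finset.card_erase_lt_of_mem i1) hgpQ hcard hne) hcard hear
  · push Not at hne
    have hin : ¬ InHull Q p₁ := fun h => (mem_ext.1 m1).2 (h.mono hQP)
    have hP : insert p₁ Q = P := Finset.insert_erase i1
    have hgp' : GP (insert p₁ Q) := by rwa [hP]
    have hnQ : p₁ ∉ Q := by simp [Q]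
    have hQe : ∀ p ∈ Q, ¬ InHull Q p := fun p hp => (mem_ext.1 (hne p hp)).2
    have hT := cone_tri hQe q3
    have hcardQ : 4 ≤ Q.card := hcard.trans (Finset.card_le_card (ext_subset Q))
    -- When `Q` is convex, coning from `p₃` works because `p₁` does not see `p₃`: cone edges with
    -- both ends visible from `p₁` are hull edges. The only old hull vertices joined to `p₃` are its
    -- hull neighbours `p₂` and `p₄`.
    have hv3 : ¬ Vis Q p₁ p₃ := fun h => h.2 _ q2 _ q4 hc
    have E32 : HullEdge Q p₃ p₂ := by
      have aux : ∀ q ∈ Q, q ≠ p₃ → q ≠ p₂ → SameSide p₃ p₂ p₁ q := by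
        intro q hq h1 h2
        have c1 : cr p₃ p₂ p₁ ≠ 0 := hgp _ i3 _ i2 _ i1 (by grind) (by grind) (by grind)
        refine sameSide_of_ext hgp i3 i2 (fun y hy h1 h2 => ?_) c1 (hQP hq) h1 h2
        simp only [hext, Finset.mem_insert, Finset.mem_singleton] at hy
        obtain rfl | rfl : y = p₁ ∨ y = p₄ := by tauto
        · exact sameSide_of_mul_pos (mul_self_pos.2 c1)
        · exact s32
      exact ⟨q3, q2, by grind, fun p hp q hq h1 h2 h3 h4 =>
        (SameSide.comm.1 (aux p hp h1 h2)).trans (aux q hq h3 h4)⟩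
    have E34 : HullEdge Q p₃ p₄ := by
      have aux : ∀ q ∈ Q, q ≠ p₃ → q ≠ p₄ → SameSide p₃ p₄ p₁ q := by
        intro q hq h1 h2
        have c1 : cr p₃ p₄ p₁ ≠ 0 := hgp _ i3 _ i4 _ i1 (by grind) (by grind) (by grind)
        refine sameSide_of_ext hgp i3 i4 (fun y hy h1 h2 => ?_) c1 (hQP hq) h1 h2
        simp only [hext, Finset.mem_insert, Finset.mem_singleton] at hy
        obtain rfl | rfl : y = p₁ ∨ y = p₂ := by tauto
        · exact sameSide_of_mul_pos (mul_self_pos.2 c1)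
        · exact s34
      exact ⟨q3, q4, by grind, fun p hp q hq h1 h2 h3 h4 =>
        (SameSide.comm.1 (aux p hp h1 h2)).trans (aux q hq h3 h4)⟩
    have E3 : ∀ v ∈ ext P, v ∈ Q → v ≠ p₃ → HullEdge Q p₃ v := by
      intro v hv hvQ h3
      simp only [hext, Finset.mem_insert, Finset.mem_singleton] at hv
      rcases hv with rfl | rfl | rfl | rfl
      · exact absurd hvQ hnQ
      · exact E32
      · exact absurd rfl h3
      · exact E34
    refine ⟨fanGraph (coneGraph Q p₃) Q p₁, ?_⟩
    have R1 := fan_tri hT hgp' hnQ hin (by omega)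
    have R2 := fan_nc hT hgp' hnQ hin
      (fun u v w h1 h2 h3 p hp hi => hQe p hp ⟨u, hT.mem h1, v, hT.mem h2, w, hT.mem h2.symm, hi⟩)
      (fun u v huv hu hv => by
        rcases cone_adj huv with rfl | rfl | h
        · exact absurd hu hv3
        · exact absurd hv hv3
        · exact h)
    have R3 := fan_chordFree hT hgp' hnQ hin
      (fun u hu v hv huv => by
        rw [hP] at hu hv
        rcases cone_adj huv with rfl | rfl | h
        · exact E3 v hv (hT.mem huv.symm) huv.ne'
        · exact (E3 u hu (hT.mem huv) huv.ne).symm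
        · exact h)
      (by rwa [hP])
    rw [hP] at R1 R2 R3
    exact ⟨R1, R2, R3⟩

theorem exists_cross_of_ext {P : Finset Plane} (hgp : GP P) {a b c d : Plane} (ha : a ∈ ext P)
    (hb : b ∈ ext P) (hc : c ∈ ext P) (hd : d ∈ ext P)
    (hn : a ≠ b ∧ a ≠ c ∧ a ≠ d ∧ b ≠ c ∧ b ≠ d ∧ c ≠ d) :
    Cross a b c d ∨ Cross a c b d ∨ Cross a d b c := by
  have ha' := mem_ext.1 ha
  have hb' := mem_ext.1 hb
  have hc' := mem_ext.1 hc
  have hd' := mem_ext.1 hd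
  rcases four_cases (hgp.gen4 ha'.1 hb'.1 hc'.1 hd'.1 hn) with h | h | h | h | h
  · exact absurd ⟨_, ha'.1, _, hb'.1, _, hc'.1, h⟩ hd'.2
  · exact absurd ⟨_, ha'.1, _, hb'.1, _, hd'.1, h⟩ hc'.2
  · exact absurd ⟨_, ha'.1, _, hc'.1, _, hd'.1, h⟩ hb'.2
  · exact absurd ⟨_, hb'.1, _, hc'.1, _, hd'.1, h⟩ ha'.2
  · exact h

/-- A point set whose hull has at least four vertices and which is not in convex position has a
triangulation with no chords and no complex triangles. -/
theorem good_of_four_le (P : Finset Plane) (hgp : GP P) (hcard : 4 ≤ (ext P).card)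
    (hd : ∃ d ∈ P, d ∉ ext P) : Good P := by
  induction hn : P.card using Nat.strong_induction_on generalizing P with
  | _ n ih =>
    have IH : ∀ Q : Finset Plane, Q.card < P.card → GP Q → 4 ≤ (ext Q).card →
        (∃ d ∈ Q, d ∉ ext Q) → Good Q :=
      fun Q hQ h1 h2 h3 => ih Q.card (hn ▸ hQ) Q h1 h2 h3 rfl
    obtain ⟨d, hdP, hde⟩ := hd
    rcases hcard.lt_or_eq with h5 | h4
    · obtain ⟨p, hp, q, hq, r, hr, hi⟩ := exists_ext_triple hgp hdP hde
      -- The deleted vertex avoids an extreme triangle around `d`, so that `d` stays non-extreme and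
      -- the induction hypothesis applies.
      obtain ⟨a, ha, han⟩ : ∃ a ∈ ext P, a ∉ ({p, q, r} : Finset Plane) := by
        by_contra! h
        have := Finset.card_le_card (show ext P ⊆ {p, q, r} from h)
        have := Finset.card_le_three (a := p) (b := q) (c := r)
        omega
      simp only [Finset.mem_insert, Finset.mem_singleton, not_or] at han
      have haP := ext_subset P ha
      have hda : d ≠ a := by rintro rfl; exact hde ha
      have hce := card_ext_erase P a
      have hQ : Good (P.erase a) := by
        refine IH _ (Finset.card_erase_lt_of_mem haP) (hgp.mono (Finset.erase_subset _ _))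
          (by omega) ⟨d, by simp [hdP, hda], fun h => (mem_ext.1 h).2 ?_⟩
        exact ⟨p, by simp [ext_subset P hp, Ne.symm han.1], q, by
          simp [ext_subset P hq, Ne.symm han.2.1], r, by simp [ext_subset P hr, Ne.symm han.2.2],
          hi⟩
      by_cases hear : ∀ u ∈ ext P, ∀ v ∈ ext P, HullEdge (P.erase a) u v →
          ¬ ∀ w ∈ P.erase a, w ≠ u → w ≠ v → OppSide u v a w
      · exact good_of_fan hgp ha hQ (by omega) hear
      · push Not at hear
        obtain ⟨u, hu, v, hv, hE, ho⟩ := hear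
        exact good_of_flip hgp ha hQ (by omega) hu hv hE ho
    · obtain ⟨p, t, hpt, hpe, htc⟩ := Finset.card_eq_succ.1 h4.symm
      obtain ⟨q, r, s, hqr, hqs, hrs, rfl⟩ := Finset.card_eq_three.1 htc
      simp only [Finset.mem_insert, Finset.mem_singleton, not_or] at hpt
      have mp : p ∈ ext P := by simp [← hpe]
      have mq : q ∈ ext P := by simp [← hpe]
      have mr : r ∈ ext P := by simp [← hpe]
      have ms : s ∈ ext P := by simp [← hpe]
      have main : ∀ p₁ p₂ p₃ p₄, ext P = {p₁, p₂, p₃, p₄} → Cross p₁ p₃ p₂ p₄ → Good P := by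
        intro p₁ p₂ p₃ p₄ hext hc
        have n := hc.ne
        have m1 : p₁ ∈ ext P := by simp [hext]
        have m2 : p₂ ∈ ext P := by simp [hext]
        have m4 : p₄ ∈ ext P := by simp [hext]
        have hd1 : p₁ ≠ d := by rintro rfl; exact hde m1
        have hd2 : p₂ ≠ d := by rintro rfl; exact hde m2
        have hd4 : p₄ ≠ d := by rintro rfl; exact hde m4
        have i1 := ext_subset P m1
        have i2 := ext_subset P m2
        have i4 := ext_subset P m4
        have c1 : cr p₂ p₄ p₁ ≠ 0 := hgp _ i2 _ i4 _ i1 (by grind) (by grind) (by grind)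
        have c2 : cr p₂ p₄ d ≠ 0 := hgp _ i2 _ i4 _ hdP (by grind) (by grind) (by grind)
        -- Whichever side of the diagonal `p₂p₄` contains `d`, the corner on that side plays the
        -- role of `p₁`.
        rcases sameSide_or_oppSide c1 c2 with h | h
        · exact good_of_four hgp hext hc hdP hde h IH
        · refine good_of_four (p₁ := p₃) (p₂ := p₂) (p₃ := p₁) (p₄ := p₄) hgp ?_ (Cross.swap.1 hc)
            hdP hde ((OppSide.comm.1 hc.2).trans h) IH
          rw [hext]; ext y; simp; tauto
      rcases exists_cross_of_ext hgp mp mq mr ms ⟨hpt.1, hpt.2.1, hpt.2.2, hqr, hqs, hrs⟩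
        with h | h | h
      · exact main p r q s (by rw [← hpe]; ext y; simp; tauto) h
      · exact main p q r s hpe.symm h
      · exact main p q s r (by rw [← hpe]; ext y; simp; tauto) h

end

/-! ### Adding the third hull vertex to a triangular hull -/

theorem InTri.pos_of_pos {a b c x : Plane} (h : InTri a b c x) (h0 : 0 < cr a b c) :
    0 < cr a b x ∧ 0 < cr b c x ∧ 0 < cr c a x := by
  obtain ⟨h1, h2, h3⟩ := h.cr_pos
  rw [div_pos_iff_of_pos_right h0] at h1 h2 h3
  exact ⟨h3, h1, h2⟩

section
variable [DecidableEq Plane]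

/-- Every nonempty triangle of `G` uses the edge `pb`, so flipping `pb` to `az` destroys them all.
Among the possible neighbours `p`, `b`, `c`, `z` of `a`, the triangle `abc` contains everything,
`apc`, `azp` and `azb` are empty, and `azc` is excluded because `z` and `c` are not adjacent. -/
theorem flip_outer {Q : Finset Plane} {G : SimpleGraph Plane} {a p b c z : Plane} (hT : Tri Q G)
    (hgp : GP (insert a Q)) (haQ : a ∉ Q) (ha : ¬ InHull Q a) (hext : ext Q = {p, b, c})
    (hpb : p ≠ b) (hpc : p ≠ c) (hbc : b ≠ c) (hcard : 3 ≤ Q.card)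
    (o1 : ∀ w ∈ Q, w ≠ p → w ≠ b → OppSide p b a w)
    (o2 : ∀ w ∈ Q, w ≠ p → w ≠ c → OppSide p c a w)
    (habc : ∀ q ∈ insert a Q, q = a ∨ q = b ∨ q = c ∨ InTri a b c q)
    (hface : Face Q G p b z)
    (hN : ∀ u v w, G.Adj u v → G.Adj v w → G.Adj u w → (∃ q ∈ Q, InTri u v w q) →
      (p = u ∨ p = v ∨ p = w) ∧ (b = u ∨ b = v ∨ b = w))
    (hc : Cross a z p b) (hzc : ¬ G.Adj z c) :
    ∃ G', Tri (insert a Q) G' ∧ NC (insert a Q) G' := by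
  have hpQ : p ∈ Q := ext_subset Q (by simp [hext])
  have hbQ : b ∈ Q := ext_subset Q (by simp [hext])
  have hcQ : c ∈ Q := ext_subset Q (by simp [hext])
  have vp := vis_of_oppSide hgp haQ hpQ hbQ hpb o1
  have vb := vis_of_oppSide hgp haQ hbQ hpQ hpb.symm
    (fun w hw h1 h2 => OppSide.swap.1 (o1 w hw h2 h1))
  have haI : a ∈ insert a Q := by simp
  have hI : ∀ {y}, y ∈ Q → y ∈ insert a Q := fun h => Finset.mem_insert_of_mem h
  have hap : a ≠ p := by rintro rfl; exact haQ hpQ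
  have hab : a ≠ b := by rintro rfl; exact haQ hbQ
  have hac : a ≠ c := by rintro rfl; exact haQ hcQ
  have hT1 := fan_tri hT hgp haQ ha hcard
  have hvis : ∀ y, Vis Q a y → y = p ∨ y = b ∨ y = c := by
    intro y hy
    have := vis_mem_ext hgp haQ ha hy
    simpa [hext] using this
  have f1 : Face (insert a Q) (fanGraph G Q a) p b a := by
    refine ⟨.inl hface.1, ((fan_adj hT haQ).2 vb).symm, ((fan_adj hT haQ).2 vp).symm, ?_⟩
    intro q hq hi
    have n := hi.ne
    have := InTri.sameSide (hgp.gen4 haI (hI hpQ) (hI hbQ) hq (by grind)) (InTri.rot.2 hi)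
    exact this.not_oppSide (o1 q (Finset.mem_of_mem_insert_of_ne hq (by grind))
      (by grind) (by grind))
  have f2 : Face (insert a Q) (fanGraph G Q a) p b z := by
    refine ⟨.inl hface.1, .inl hface.2.1, .inl hface.2.2.1, ?_⟩
    intro q hq hi
    rcases Finset.mem_insert.1 hq with rfl | hq
    · exact ha ⟨p, hpQ, b, hbQ, z, hT.mem hface.2.1.symm, hi⟩
    · exact hface.2.2.2 q hq hi
  have e0 : ∀ q ∈ insert a Q, ¬ InTri a p c q := by
    intro q hq hi
    have n := hi.ne
    have := InTri.sameSide (hgp.gen4 haI (hI hpQ) (hI hcQ) hq (by grind)) hi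
    exact this.not_oppSide (o2 q (Finset.mem_of_mem_insert_of_ne hq (by grind))
      (by grind) (by grind))
  have e1 := flip_empty hT1 hgp f1 f2 hc
  have e2 := flip_empty hT1 hgp f1.swap f2.swap (Cross.swap_right.1 hc)
  have adja : ∀ {y}, (flipGraph (fanGraph G Q a) p b a z).Adj a y →
      y = p ∨ y = b ∨ y = c ∨ y = z := by
    rintro y (⟨h, -⟩ | ⟨-, h⟩)
    · have := hvis y ((fan_adj hT haQ).1 h); tauto
    · rw [Sym2.eq_iff] at h; grind
  have adjn : ∀ {x y}, x ≠ a → y ≠ a → (flipGraph (fanGraph G Q a) p b a z).Adj x y →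
      G.Adj x y ∧ s(x, y) ≠ s(p, b) := by
    rintro x y hx hy (⟨h, h'⟩ | ⟨-, h⟩)
    · exact ⟨(fan_adj_of_ne hx hy).1 h, h'⟩
    · rw [Sym2.eq_iff] at h; grind
  refine ⟨flipGraph (fanGraph G Q a) p b a z, flip_tri hT1 hgp f1 f2 hc, ?_⟩
  have key : ∀ x y, (flipGraph (fanGraph G Q a) p b a z).Adj a x →
      (flipGraph (fanGraph G Q a) p b a z).Adj a y →
      (flipGraph (fanGraph G Q a) p b a z).Adj x y → (∀ q ∈ insert a Q, ¬ InTri a x y q) ∨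
      (∀ q ∈ insert a Q, q = a ∨ q = x ∨ q = y ∨ InTri a x y q) := by
    intro x y hx hy hxy
    have h := adjn hx.ne' hy.ne' hxy
    have hne := hxy.ne
    rw [Ne, Sym2.eq_iff] at h
    obtain ⟨hG, h⟩ := h
    rcases adja hx with rfl | rfl | rfl | rfl <;> rcases adja hy with rfl | rfl | rfl | rfl
    · exact absurd rfl hne
    · exact absurd (.inl ⟨rfl, rfl⟩) h
    · exact .inl e0
    · exact .inl fun q hq hi => e1 q hq (InTri.swap_right.1 hi)
    · exact absurd (.inr ⟨rfl, rfl⟩) h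
    · exact absurd rfl hne
    · exact .inr habc
    · exact .inl fun q hq hi => e2 q hq (InTri.swap_right.1 hi)
    · exact .inl fun q hq hi => e0 q hq (InTri.swap_right.1 hi)
    · refine .inr fun q hq => ?_
      have := habc q hq
      rw [InTri.swap_right] at this; tauto
    · exact absurd rfl hne
    · exact absurd hG.symm hzc
    · exact .inl e1
    · exact .inl e2
    · exact absurd hG hzc
    · exact absurd rfl hne
  intro x y w hxy hyw hxw
  by_cases hx : x = a
  · subst hx; exact key y w hxy hxw hyw
  by_cases hy : y = a
  · subst hy
    rcases key x w hxy.symm hyw hxw with h | h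
    · exact .inl fun q hq hi => h q hq (InTri.swap.1 hi)
    · refine .inr fun q hq => ?_
      have := h q hq
      rw [InTri.swap] at this; tauto
  by_cases hw : w = a
  · subst hw
    rcases key x y hxw.symm hyw.symm hxy with h | h
    · exact .inl fun q hq hi => h q hq (InTri.rot.2 hi)
    · refine .inr fun q hq => ?_
      have := h q hq
      rw [InTri.rot] at this; tauto
  have h1 := adjn hx hy hxy
  have h2 := adjn hy hw hyw
  have h3 := adjn hx hw hxw
  left
  intro q hq hi
  rcases Finset.mem_insert.1 hq with rfl | hq
  · exact ha ⟨x, hT.mem h1.1, y, hT.mem h2.1, w, hT.mem h2.1.symm, hi⟩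
  · have := hN x y w h1.1 h2.1 h3.1 ⟨q, hq, hi⟩
    have k1 := h1.2
    have k2 := h2.2
    have k3 := h3.2
    rw [Ne, Sym2.eq_iff] at k1 k2 k3
    grind

theorem inTri_of_ext_three {Q : Finset Plane} (hgp : GP Q) {x y z q : Plane}
    (hext : ext Q = {x, y, z}) (hq : q ∈ Q) (hx : q ≠ x) (hy : q ≠ y) (hz : q ≠ z) :
    InTri x y z q := by
  obtain ⟨u, hu, v, hv, w, hw, hi⟩ := exists_ext_triple hgp hq (by simp [hext, hx, hy, hz])
  have n := hi.ne
  simp only [hext, Finset.mem_insert, Finset.mem_singleton] at hu hv hw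
  rcases hu with rfl | rfl | rfl <;> rcases hv with rfl | rfl | rfl <;>
    rcases hw with rfl | rfl | rfl
  any_goals (exfalso; grind)
  · exact hi
  · exact InTri.swap_right.1 hi
  · exact InTri.swap.1 hi
  · exact InTri.rot.2 hi
  · exact InTri.rot.1 hi
  · exact InTri.swap.1 (InTri.rot.1 hi)

/-! ### Nested triangular hulls -/

/-- The configuration in which removing any hull vertex of a triangle leaves a triangle. -/
structure Nested (P : Finset Plane) (a b c a' b' c' : Plane) : Prop where
  gp : GP P
  ext_eq : ext P = {a, b, c}
  ab : a ≠ b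
  ac : a ≠ c
  bc : b ≠ c
  ext_a : ext (P.erase a) = {a', b, c}
  ext_b : ext (P.erase b) = {a, b', c}
  ext_c : ext (P.erase c) = {a, b, c'}
  a'b : a' ≠ b
  a'c : a' ≠ c
  b'a : b' ≠ a
  b'c : b' ≠ c
  c'a : c' ≠ a
  c'b : c' ≠ b
  card : 5 ≤ P.card

namespace Nested
variable {P : Finset Plane} {a b c a' b' c' : Plane}

theorem swap_bc (h : Nested P a b c a' b' c') : Nested P a c b a' c' b' where
  gp := h.gp
  ext_eq := by rw [h.ext_eq]; ext y; simp; tauto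
  ab := h.ac
  ac := h.ab
  bc := h.bc.symm
  ext_a := by rw [h.ext_a]; ext y; simp; tauto
  ext_b := by rw [h.ext_c]; ext y; simp; tauto
  ext_c := by rw [h.ext_b]; ext y; simp; tauto
  a'b := h.a'c
  a'c := h.a'b
  b'a := h.c'a
  b'c := h.c'b
  c'a := h.b'a
  c'b := h.b'c
  card := h.card

theorem swap_ab (h : Nested P a b c a' b' c') : Nested P b a c b' a' c' where
  gp := h.gp
  ext_eq := by rw [h.ext_eq]; ext y; simp; tauto
  ab := h.ab.symm
  ac := h.bc
  bc := h.ac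
  ext_a := by rw [h.ext_b]; ext y; simp; tauto
  ext_b := by rw [h.ext_a]; ext y; simp; tauto
  ext_c := by rw [h.ext_c]; ext y; simp; tauto
  a'b := h.b'a
  a'c := h.b'c
  b'a := h.a'b
  b'c := h.a'c
  c'a := h.c'b
  c'b := h.c'a
  card := h.card

theorem mem_a (h : Nested P a b c a' b' c') : a ∈ P := ext_subset P (by simp [h.ext_eq])
theorem mem_b (h : Nested P a b c a' b' c') : b ∈ P := h.swap_ab.mem_a
theorem mem_c (h : Nested P a b c a' b' c') : c ∈ P := h.swap_bc.mem_b
theorem mem_a' (h : Nested P a b c a' b' c') : a' ∈ P ∧ a' ≠ a := by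
  have := ext_subset (P.erase a) (show a' ∈ _ by simp [h.ext_a])
  rw [Finset.mem_erase] at this
  exact this.symm
theorem mem_b' (h : Nested P a b c a' b' c') : b' ∈ P ∧ b' ≠ b := h.swap_ab.mem_a'
theorem mem_c' (h : Nested P a b c a' b' c') : c' ∈ P ∧ c' ≠ c := h.swap_bc.mem_b'

theorem inTri (h : Nested P a b c a' b' c') {q : Plane} (hq : q ∈ P) (ha : q ≠ a) (hb : q ≠ b)
    (hc : q ≠ c) : InTri a b c q := inTri_of_ext_three h.gp h.ext_eq hq ha hb hc

theorem inTri_a (h : Nested P a b c a' b' c') {q : Plane} (hq : q ∈ P) (ha : q ≠ a) (hb : q ≠ b)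
    (hc : q ≠ c) (ha' : q ≠ a') : InTri a' b c q :=
  inTri_of_ext_three (h.gp.mono (Finset.erase_subset _ _)) h.ext_a (by simp [hq, ha]) ha' hb hc

theorem inTri_b (h : Nested P a b c a' b' c') {q : Plane} (hq : q ∈ P) (ha : q ≠ a) (hb : q ≠ b)
    (hc : q ≠ c) (hb' : q ≠ b') : InTri a b' c q :=
  InTri.swap.1 (h.swap_ab.inTri_a hq hb ha hc hb')

theorem inTri_c (h : Nested P a b c a' b' c') {q : Plane} (hq : q ∈ P) (ha : q ≠ a) (hb : q ≠ b)
    (hc : q ≠ c) (hc' : q ≠ c') : InTri a b c' q :=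
  InTri.swap_right.1 (h.swap_bc.inTri_b hq ha hc hb hc')

/-- If they coincided, a fifth point would lie in both `a'bc` and `aa'c`, which are disjoint pieces
of `abc`. -/
theorem a'_ne_b' (h : Nested P a b c a' b' c') : a' ≠ b' := by
  intro e
  obtain ⟨q, hq, hqn⟩ : ∃ q ∈ P, q ∉ ({a, b, c, a'} : Finset Plane) := by
    by_contra! hsub
    have := Finset.card_le_card (show P ⊆ {a, b, c, a'} from hsub)
    have := Finset.card_le_four (a := a) (b := b) (c := c) (d := a')
    have := h.card
    omega
  simp only [Finset.mem_insert, Finset.mem_singleton, not_or] at hqn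
  have ha' := h.mem_a'
  have i1 := h.inTri ha'.1 ha'.2 h.a'b h.a'c
  have i2 := h.inTri_a hq hqn.1 hqn.2.1 hqn.2.2.1 hqn.2.2.2
  have i3 := h.inTri_b hq hqn.1 hqn.2.1 hqn.2.2.1 (e ▸ hqn.2.2.2)
  rw [← e] at i3
  have n1 := i1.ne
  have n2 := i2.ne
  have n3 := i3.ne
  exact nested_not_inTri (h.gp.gen5 h.mem_a h.mem_b h.mem_c ha'.1 hq (by grind)) i1 i2 i3

theorem a'_ne_c' (h : Nested P a b c a' b' c') : a' ≠ c' := h.swap_bc.a'_ne_b'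
theorem b'_ne_c' (h : Nested P a b c a' b' c') : b' ≠ c' := h.swap_ab.a'_ne_c'

/-- The nested triangles fix the orientations needed for `nested_orient`, which gives that of
`a'b'c'`. Consequently `c'` remains non-extreme after `a` and `b` are both deleted, so deleting `b`
from `P \ {a}` cannot leave convex position. -/
theorem inner_pos (h : Nested P a b c a' b' c') (h0 : 0 < cr a b c) : InTri c a' b' c' := by
  have ha' := h.mem_a'
  have hb' := h.mem_b'
  have hc' := h.mem_c'
  have n1 := h.a'_ne_b'
  have n2 := h.a'_ne_c'
  have n3 := h.b'_ne_c'
  have ia := (h.inTri ha'.1 ha'.2 h.a'b h.a'c).pos_of_pos h0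
  have ib := (h.inTri hb'.1 h.b'a hb'.2 h.b'c).pos_of_pos h0
  have ic := (h.inTri hc'.1 h.c'a h.c'b hc'.2).pos_of_pos h0
  have oa : 0 < cr a' b c := by rw [← cr_rot]; exact ia.2.1
  have ob : 0 < cr a b' c := by rw [cr_rot]; exact ib.2.2
  have oc : 0 < cr a b c' := ic.1
  have j1 := (h.inTri_b ha'.1 ha'.2 h.a'b h.a'c n1).pos_of_pos ob
  have j2 := (h.inTri_b hc'.1 h.c'a h.c'b hc'.2 n3.symm).pos_of_pos ob
  have j3 := (h.inTri_a hc'.1 h.c'a h.c'b hc'.2 n2.symm).pos_of_pos oa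
  have j4 := (h.inTri_c ha'.1 ha'.2 h.a'b h.a'c n2).pos_of_pos oc
  have := nested_orient (h.gp.gen5 h.mem_a h.mem_c ha'.1 hb'.1 hc'.1
    ⟨h.ac, ha'.2.symm, h.b'a.symm, h.c'a.symm, h.a'c.symm, h.b'c.symm, hc'.2.symm, n1, n2, n3⟩)
    j1.1 j1.2.1 j1.2.2 j2.1 j2.2.1 j2.2.2 j3.2.2 j4.2.2
  exact .inl ⟨j3.2.2, this, j2.2.1⟩

theorem inner (h : Nested P a b c a' b' c') : InTri c a' b' c' := by
  have h0 : cr a b c ≠ 0 := h.gp _ h.mem_a _ h.mem_b _ h.mem_c h.ab h.ac h.bc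
  rcases h0.lt_or_gt with h0 | h0
  · have : 0 < cr b a c := by rw [cr_swap]; linarith
    exact InTri.swap_right.1 (h.swap_ab.inner_pos this)
  · exact h.inner_pos h0

theorem inner' (h : Nested P a b c a' b' c') : InTri b a' c' b' := h.swap_bc.inner

theorem cross (h : Nested P a b c a' b' c') : Cross a b' a' b := by
  have ha' := h.mem_a'
  have hb' := h.mem_b'
  have n1 := h.a'_ne_b'
  exact nested_cross (h.gp.gen5 h.mem_a h.mem_b h.mem_c ha'.1 hb'.1
    ⟨h.ab, h.ac, ha'.2.symm, h.b'a.symm, h.bc, h.a'b.symm, hb'.2.symm, h.a'c.symm, h.b'c.symm, n1⟩)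
    (h.inTri ha'.1 ha'.2 h.a'b h.a'c) (h.inTri hb'.1 h.b'a hb'.2 h.b'c)
    (h.inTri_a hb'.1 h.b'a hb'.2 h.b'c n1.symm) (h.inTri_b ha'.1 ha'.2 h.a'b h.a'c n1)

/-- Except for its ends, the remaining set lies in the triangle `a'bc`, together with its vertex
`c`, beyond the line `a'b` as seen from `a`. -/
theorem opp_b (h : Nested P a b c a' b' c') : ∀ w ∈ P.erase a, w ≠ a' → w ≠ b →
    OppSide a' b a w := by
  intro w hw h1 h2
  rw [Finset.mem_erase] at hw
  have ha' := h.mem_a'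
  have ia := h.inTri ha'.1 ha'.2 h.a'b h.a'c
  have n := ia.ne
  by_cases hwc : w = c
  · subst hwc
    exact InTri.oppSide_vertex (h.gp.gen4 h.mem_a h.mem_b h.mem_c ha'.1 (by grind)) ia
  · have i2 := h.inTri_a hw.2 hw.1 h2 hwc h1
    have n2 := i2.ne
    exact nested_oppSide (h.gp.gen5 h.mem_a h.mem_b h.mem_c ha'.1 hw.2 (by grind)) ia i2

theorem opp_c (h : Nested P a b c a' b' c') : ∀ w ∈ P.erase a, w ≠ a' → w ≠ c →
    OppSide a' c a w := h.swap_bc.opp_b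

theorem not_inHull (h : Nested P a b c a' b' c') : ¬ InHull (P.erase a) a := fun hi =>
  (mem_ext.1 (show a ∈ ext P by simp [h.ext_eq])).2 (hi.mono (Finset.erase_subset _ _))

theorem hull_bc (h : Nested P a b c a' b' c') : HullEdge (P.erase a) b c := by
  have ha' := h.mem_a'
  have aux : ∀ q ∈ P.erase a, q ≠ b → q ≠ c → SameSide b c a' q := by
    intro q hq hb hc
    rw [Finset.mem_erase] at hq
    by_cases hqa : q = a'
    · subst hqa
      have : cr b c q ≠ 0 := h.gp _ h.mem_b _ h.mem_c _ ha'.1 h.bc hb.symm hc.symm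
      exact sameSide_of_mul_pos (mul_self_pos.2 this)
    · have i := h.inTri_a hq.2 hq.1 hb hc hqa
      have n := i.ne
      exact InTri.sameSide (h.gp.gen4 ha'.1 h.mem_b h.mem_c hq.2 (by grind)) i
  exact ⟨by simp [h.mem_b, h.ab.symm], by simp [h.mem_c, h.ac.symm], h.bc,
    fun p hp q hq h1 h2 h3 h4 => (SameSide.comm.1 (aux p hp h1 h2)).trans (aux q hq h3 h4)⟩

theorem card_erase (h : Nested P a b c a' b' c') : 4 ≤ (P.erase a).card := by
  have := Finset.card_erase_of_mem h.mem_a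
  have := h.card
  omega

theorem all_inTri (h : Nested P a b c a' b' c') {q : Plane} (hq : q ∈ insert a (P.erase a)) :
    q = a ∨ q = b ∨ q = c ∨ InTri a b c q := by
  rw [Finset.insert_erase h.mem_a] at hq
  by_cases h1 : q = a
  · exact .inl h1
  by_cases h2 : q = b
  · exact .inr (.inl h2)
  by_cases h3 : q = c
  · exact .inr (.inr (.inl h3))
  exact .inr (.inr (.inr (h.inTri hq h1 h2 h3)))

/-- Adding the hull vertex `a` to a good triangulation of the other points, when the third vertex
of the face at `a'b` is visible through `a'b`. -/
theorem exists_nc_of_sameSide (h : Nested P a b c a' b' c') {G : SimpleGraph Plane}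
    (hT : Tri (P.erase a) G) (hN : NC (P.erase a) G) {z : Plane}
    (hz : Face (P.erase a) G a' b z) (hs : SameSide a a' b z) : ∃ G', Tri P G' ∧ NC P G' := by
  have hP := Finset.insert_erase h.mem_a
  have hgpQ : GP (P.erase a) := h.gp.mono (Finset.erase_subset _ _)
  have hc4 := h.card_erase
  have ha' := h.mem_a'
  have hb' := h.mem_b'
  have hc' := h.mem_c'
  have ma' : a' ∈ P.erase a := by simp [ha']
  have mb : b ∈ P.erase a := by simp [h.mem_b, h.ab.symm]
  have mc : c ∈ P.erase a := by simp [h.mem_c, h.ac.symm]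
  have mb' : b' ∈ P.erase a := by simp [hb', h.b'a]
  have mc' : c' ∈ P.erase a := by simp [hc', h.c'a]
  have mz := hT.mem hz.2.1.symm
  have hzP := Finset.mem_erase.1 mz
  have ib' := h.inTri_a hb'.1 h.b'a hb'.2 h.b'c h.a'_ne_b'.symm
  have ic' := h.inTri_a hc'.1 h.c'a h.c'b hc'.2 h.a'_ne_c'.symm
  have hzc : z ≠ c := by
    rintro rfl
    exact hz.2.2.2 b' mb' ib'
  have hza' := hz.2.2.1.ne'
  have hzb := hz.2.1.ne'
  have iz := h.inTri_a hzP.2 hzP.1 hzb hzc hza'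
  have ia := h.inTri ha'.1 ha'.2 h.a'b h.a'c
  have n1 := iz.ne
  have n2 := ia.ne
  have hcross : Cross a z a' b := cross_of_sameSide_cevian
    (h.gp.gen5 h.mem_a h.mem_b h.mem_c ha'.1 hzP.2 (by grind)) ia iz hs
  have hemp : ∀ {u v w}, G.Adj u v → G.Adj v w → G.Adj u w → (∃ q ∈ P.erase a, InTri u v w q) →
      ∀ q ∈ ext (P.erase a), q = u ∨ q = v ∨ q = w := by
    rintro u v w h1 h2 h3 ⟨q, hq, hi⟩ y hy
    rcases hN u v w h1 h2 h3 with h' | h'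
    · exact absurd hi (h' q hq)
    · rcases h' y (ext_subset _ hy) with h' | h' | h' | h'
      · exact .inl h'
      · exact .inr (.inl h')
      · exact .inr (.inr h')
      · exact absurd ⟨u, hT.mem h1, v, hT.mem h2, w, hT.mem h2.symm, h'⟩ (mem_ext.1 hy).2
  have ea' : a' ∈ ext (P.erase a) := by simp [h.ext_a]
  have eb : b ∈ ext (P.erase a) := by simp [h.ext_a]
  have ec : c ∈ ext (P.erase a) := by simp [h.ext_a]
  have res := flip_outer hT (by rw [hP]; exact h.gp) (by simp) h.not_inHull h.ext_a h.a'b h.a'c h.bc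
    (by omega) h.opp_b h.opp_c (fun q hq => h.all_inTri hq) hz
    (fun u v w h1 h2 h3 h4 => by
      have k1 := hemp h1 h2 h3 h4 a' ea'
      have k2 := hemp h1 h2 h3 h4 b eb
      exact ⟨k1, k2⟩) hcross ?_
  · rwa [hP] at res
  · intro hadj
    obtain ⟨y, hy⟩ := hT.exists_face_of_hullEdge hgpQ (by omega)
      (hullEdge_of_oppSide (a := a) ma' mc h.a'c h.opp_c)
    obtain ⟨x, hx⟩ := hT.exists_face_of_hullEdge hgpQ (by omega) h.hull_bc
    -- An edge `zc` would split `a'bc` into the face `a'bz` and the triangles `zbc`, `za'c`. Each of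
    -- the latter misses a hull vertex, so it is empty; then `z` would be the only point inside
    -- `a'bc`, although `b'` and `c'` both lie there.
    have hzE : ∀ q ∈ P.erase a, q ≠ z → InTri a' b c q → False := by
      intro q hq hqz hi
      have n3 := hi.ne
      rcases inTri_cone (h.gp.gen5 ha'.1 h.mem_b h.mem_c (Finset.mem_erase.1 hq).2 hzP.2
        (by grind)) hi with h' | h' | h'
      · exact hz.2.2.2 q hq (InTri.rot.1 h')
      · have := hemp hz.2.1.symm hx.1 hadj ⟨q, hq, h'⟩ a' ea'
        rcases this with e | e | e
        · exact hza' e.symm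
        · exact h.a'b e
        · exact h.a'c e
      · have := hemp hz.2.2.1.symm hy.1 hadj ⟨q, hq, h'⟩ b eb
        rcases this with e | e | e
        · exact hzb e.symm
        · exact h.a'b e.symm
        · exact h.bc e
    by_cases hb'z : b' = z
    · exact hzE c' mc' (by rw [← hb'z]; exact h.b'_ne_c'.symm) ic'
    · exact hzE b' mb' hb'z ib'

/-- Let `z` and `y` be the apexes of the faces at `a'b` and `a'c`. If the line `aa'` leaves `z` on
the side of `b`, the edge `a'b` is flipped; if it leaves `y` on the side of `c`, the edge `a'c` is.
If neither holds, `y` lies in the face `a'bz` or the edges `a'y` and `bz` cross. -/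
theorem exists_nc_of_erase (h : Nested P a b c a' b' c') {G : SimpleGraph Plane}
    (hT : Tri (P.erase a) G) (hN : NC (P.erase a) G) : ∃ G', Tri P G' ∧ NC P G' := by
  have hgpQ : GP (P.erase a) := h.gp.mono (Finset.erase_subset _ _)
  have hc4 := h.card_erase
  have ha' := h.mem_a'
  have hb' := h.mem_b'
  have ma' : a' ∈ P.erase a := by simp [ha']
  have mb : b ∈ P.erase a := by simp [h.mem_b, h.ab.symm]
  have mc : c ∈ P.erase a := by simp [h.mem_c, h.ac.symm]
  have mb' : b' ∈ P.erase a := by simp [hb', h.b'a]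
  have ib' := h.inTri_a hb'.1 h.b'a hb'.2 h.b'c h.a'_ne_b'.symm
  obtain ⟨z, hz⟩ := hT.exists_face_of_hullEdge hgpQ (by omega)
    (hullEdge_of_oppSide (a := a) ma' mb h.a'b h.opp_b)
  obtain ⟨y, hy⟩ := hT.exists_face_of_hullEdge hgpQ (by omega)
    (hullEdge_of_oppSide (a := a) ma' mc h.a'c h.opp_c)
  have mz := hT.mem hz.2.1.symm
  have my := hT.mem hy.2.1.symm
  have hzP := Finset.mem_erase.1 mz
  have hyP := Finset.mem_erase.1 my
  have c1 : cr a a' b ≠ 0 := h.gp _ h.mem_a _ ha'.1 _ h.mem_b ha'.2.symm h.ab h.a'b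
  have c2 : cr a a' z ≠ 0 := h.gp _ h.mem_a _ ha'.1 _ hzP.2 ha'.2.symm hzP.1.symm hz.2.2.1.ne
  have c3 : cr a a' c ≠ 0 := h.gp _ h.mem_a _ ha'.1 _ h.mem_c ha'.2.symm h.ac h.a'c
  have c4 : cr a a' y ≠ 0 := h.gp _ h.mem_a _ ha'.1 _ hyP.2 ha'.2.symm hyP.1.symm hy.2.2.1.ne
  rcases sameSide_or_oppSide c1 c2 with hs | hs
  · exact h.exists_nc_of_sameSide hT hN hz hs
  rcases sameSide_or_oppSide c3 c4 with hs' | hs'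
  · exact h.swap_bc.exists_nc_of_sameSide hT hN hy hs'
  exfalso
  have ia := h.inTri ha'.1 ha'.2 h.a'b h.a'c
  have n2 := ia.ne
  have hbc : OppSide a a' b c := OppSide.swap.1
    (InTri.oppSide_vertex (h.gp.gen4 h.mem_b h.mem_a h.mem_c ha'.1 (by grind)) (InTri.swap.1 ia))
  have hsy : SameSide a a' b y := hbc.trans hs'
  have hyb : y ≠ b := by
    rintro rfl
    exact hy.2.2.2 b' mb' (InTri.swap_right.1 ib')
  have hzy : z ≠ y := by rintro rfl; exact hsy.not_oppSide hs
  have hya' := hy.2.2.1.ne'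
  have hza' := hz.2.2.1.ne'
  have hzb := hz.2.1.ne'
  rcases cross_or_inTri_of_rays (h.gp.gen5 h.mem_a ha'.1 h.mem_b hzP.2 hyP.2 (by grind))
    (h.opp_b z mz hza' hzb) (h.opp_b y my hya' hyb) hs hsy with h' | h'
  · exact hz.2.2.2 y my h'
  · exact hT.plane hy.2.2.1 hz.2.1 h'

/-- The convex set is coned from `b`, then `a'` is added by a fan. Every nonempty triangle of the
result uses both `a'` and `b`, and `b'` is the apex of the face at `a'b`, so adding `a` and flipping
`a'b` to `ab'` succeeds. -/
theorem exists_nc_of_convex (h : Nested P a b c a' b' c')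
    (hS : ∀ q ∈ (P.erase a).erase a', ¬ InHull ((P.erase a).erase a') q) :
    ∃ G', Tri P G' ∧ NC P G' := by
  have hP := Finset.insert_erase h.mem_a
  have hgpQ : GP (P.erase a) := h.gp.mono (Finset.erase_subset _ _)
  have hc4 := h.card_erase
  have ha' := h.mem_a'
  have hb' := h.mem_b'
  have hc' := h.mem_c'
  have n1 := h.a'_ne_b'
  have n2 := h.a'_ne_c'
  have n3 := h.b'_ne_c'
  have ma' : a' ∈ P.erase a := by simp [ha']
  set S := (P.erase a).erase a' with hSdef
  have hQ : insert a' S = P.erase a := Finset.insert_erase ma'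
  have sb : b ∈ S := by simp [S, h.mem_b, h.ab.symm, h.a'b.symm]
  have sc : c ∈ S := by simp [S, h.mem_c, h.ac.symm, h.a'c.symm]
  have sb' : b' ∈ S := by simp [S, hb', h.b'a, n1.symm]
  have sc' : c' ∈ S := by simp [S, hc', h.c'a, n2.symm]
  have hcS : 3 ≤ S.card := by
    have h1 := Finset.card_erase_of_mem ma'
    rw [← hSdef] at h1
    omega
  have sP : ∀ {y}, y ∈ S → y ∈ P ∧ y ≠ a ∧ y ≠ a' := by
    intro y hy
    simp only [S, Finset.mem_erase] at hy
    tauto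
  have ha'S : a' ∉ S := by simp [S]
  have hgpS : GP (insert a' S) := by rwa [hQ]
  have ha'H : ¬ InHull S a' := fun hi =>
    (mem_ext.1 (show a' ∈ ext (P.erase a) by simp [h.ext_a])).2
      (hi.mono (Finset.erase_subset _ _))
  have hT0 : Tri S (coneGraph S b) := cone_tri hS sb
  have hT := fan_tri hT0 hgpS ha'S ha'H hcS
  rw [hQ] at hT
  have ib := h.inTri hb'.1 h.b'a hb'.2 h.b'c
  have ia'b' := h.inTri_a hb'.1 h.b'a hb'.2 h.b'c n1.symm
  have k1 := ib.ne
  have k2 := ia'b'.ne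
  -- every other point lies beyond the line `b'c` as seen from `b`
  have hbeyond : ∀ w ∈ S, w ≠ b → w ≠ c → w ≠ b' → OppSide b' c b w := by
    intro w hw hwb hwc hwb'
    have hwP := sP hw
    have i := h.inTri_b hwP.1 hwP.2.1 hwb hwc hwb'
    have k3 := i.ne
    have e1 : SameSide b' c a w :=
      InTri.sameSide (h.gp.gen4 h.mem_a hb'.1 h.mem_c hwP.1 (by grind)) i
    have e2 : OppSide b' c b a := InTri.oppSide_vertex
      (h.gp.gen4 h.mem_b h.mem_c h.mem_a hb'.1 (by grind)) (InTri.rot.1 ib)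
    exact e2.trans_same e1
  have hopp : ∀ w ∈ S, w ≠ b → w ≠ b' → OppSide b b' a' w := by
    intro w hw hwb hwb'
    have e1 : OppSide b b' a' c := OppSide.swap.1 (InTri.oppSide_vertex
      (h.gp.gen4 ha'.1 h.mem_b h.mem_c hb'.1 (by grind)) ia'b')
    by_cases hwc : w = c
    · rw [hwc]; exact e1
    have hwP := sP hw
    have i := h.inTri_a hwP.1 hwP.2.1 hwb hwc hwP.2.2
    have k3 := i.ne
    have e2 : SameSide b c a' w :=
      InTri.sameSide (h.gp.gen4 ha'.1 h.mem_b h.mem_c hwP.1 (by grind)) i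
    have e3 : SameSide b c a' b' :=
      InTri.sameSide (h.gp.gen4 ha'.1 h.mem_b h.mem_c hb'.1 (by grind)) ia'b'
    refine e1.trans_same (sameSide_of_not_inTri
      (h.gp.gen4 h.mem_b h.mem_c hb'.1 hwP.1 (by grind))
      ((SameSide.comm.1 e3).trans e2) (hbeyond w hw hwb hwc hwb') ?_)
    exact fun hi => hS b' sb' ⟨b, sb, c, sc, w, hw, hi⟩
  have vb := vis_of_oppSide hgpS ha'S sb sb' hb'.2.symm hopp
  have vb' := vis_of_oppSide hgpS ha'S sb' sb hb'.2
    (fun w hw h1 h2 => OppSide.swap.1 (hopp w hw h2 h1))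
  have hface : Face (P.erase a) (fanGraph (coneGraph S b) S a') a' b b' := by
    refine ⟨(fan_adj hT0 ha'S).2 vb, .inl ⟨sb, sb', hb'.2.symm, .inl rfl⟩,
      (fan_adj hT0 ha'S).2 vb', ?_⟩
    intro q hq hi
    have k3 := hi.ne
    have hqS : q ∈ S := Finset.mem_erase.2 ⟨k3.2.2.2.1, hq⟩
    exact (InTri.sameSide (h.gp.gen4 ha'.1 h.mem_b hb'.1 (sP hqS).1 (by grind)) hi).not_oppSide
      (hopp q hqS (by grind) (by grind))
  have hext_b : b ∈ ext (P.erase a) := by simp [h.ext_a]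
  -- A triangle at `a'` avoiding `b` stands on a hull edge of `S`. It is empty or contains
  -- everything, and the latter fails because `b` is extreme.
  have hNa : ∀ u v, (fanGraph (coneGraph S b) S a').Adj a' u →
      (fanGraph (coneGraph S b) S a').Adj a' v → (fanGraph (coneGraph S b) S a').Adj u v →
      (∃ q ∈ P.erase a, InTri a' u v q) → b = u ∨ b = v := by
    rintro u v hu hv huv ⟨q, hq, hi⟩
    rw [fan_adj_of_ne hu.ne' hv.ne'] at huv
    rw [fan_adj hT0 ha'S] at hu hv
    rcases cone_adj huv with e | e | hE
    · exact .inl e.symm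
    · exact .inr e.symm
    · have := fan_nc_at hgpS ha'H hu hv hE
      rw [hQ] at this
      rcases this with h' | h'
      · exact absurd hi (h' q hq)
      · rcases h' b (ext_subset _ hext_b) with e | e | e | e
        · exact absurd e.symm h.a'b
        · exact .inl e
        · exact .inr e
        · exact absurd ⟨a', ma', u, Finset.mem_of_mem_erase hu.1, v,
            Finset.mem_of_mem_erase hv.1, e⟩ (mem_ext.1 hext_b).2
  have res := flip_outer hT (by rw [hP]; exact h.gp) (by simp) h.not_inHull h.ext_a h.a'b h.a'c h.bc
    (by omega) h.opp_b h.opp_c (fun q hq => h.all_inTri hq) hface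
    (fun u v w h1 h2 h3 h4 => ?_) h.cross ?_
  · rwa [hP] at res
  · by_cases hu : u = a'
    · subst hu
      rcases hNa v w h1 h3 h2 h4 with e | e
      · exact ⟨.inl rfl, .inr (.inl e)⟩
      · exact ⟨.inl rfl, .inr (.inr e)⟩
    by_cases hv : v = a'
    · subst hv
      obtain ⟨q, hq, hi⟩ := h4
      rcases hNa u w h1.symm h2 h3 ⟨q, hq, InTri.swap.1 hi⟩ with e | e
      · exact ⟨.inr (.inl rfl), .inl e⟩
      · exact ⟨.inr (.inl rfl), .inr (.inr e)⟩
    by_cases hw : w = a'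
    · subst hw
      obtain ⟨q, hq, hi⟩ := h4
      rcases hNa u v h3.symm h2.symm h1 ⟨q, hq, InTri.rot.2 hi⟩ with e | e
      · exact ⟨.inr (.inr rfl), .inl e⟩
      · exact ⟨.inr (.inr rfl), .inr (.inl e)⟩
    exfalso
    rw [fan_adj_of_ne hu hv] at h1
    rw [fan_adj_of_ne hv hw] at h2
    obtain ⟨q, hq, hi⟩ := h4
    have hin : InHull S q := ⟨u, h1.1, v, h2.1, w, h2.2.1, hi⟩
    by_cases hqa : q = a'
    · exact ha'H (hqa ▸ hin)
    · exact hS q (Finset.mem_erase.2 ⟨hqa, hq⟩) hin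
  -- An edge `b'c` of the cone would have to be a hull edge of `S`, but `b` and `c'` lie on opposite
  -- sides of it.
  · intro hadj
    rw [fan_adj_of_ne n1.symm h.a'c.symm] at hadj
    rcases cone_adj hadj with e | e | hE
    · exact hb'.2 e
    · exact h.bc e.symm
    · exact (hE.2.2.2 b sb c' sc' hb'.2.symm h.bc n3.symm hc'.2).not_oppSide
        (hbeyond c' sc' h.c'b hc'.2 n3.symm)

end Nested

/-! ### Induction for triangular hulls -/

theorem exists_third {Q : Finset Plane} (hgp : GP Q) {b c : Plane} (hb : b ∈ ext Q) (hc : c ∈ ext Q)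
    (hbc : b ≠ c) (hcard : 4 ≤ Q.card) (hlt : (ext Q).card < 4) :
    ∃ x, x ≠ b ∧ x ≠ c ∧ ext Q = {x, b, c} := by
  have h3 : (ext Q).card = 3 := by
    have : 3 ≤ (ext Q).card := by
      by_cases hne : ∃ q ∈ Q, q ∉ ext Q
      · obtain ⟨q, hq, hqe⟩ := hne
        obtain ⟨u, hu, v, hv, w, hw, hi⟩ := exists_ext_triple hgp hq hqe
        have n := hi.ne
        have hs : ({u, v, w} : Finset Plane) ⊆ ext Q := by
          intro y hy
          simp only [Finset.mem_insert, Finset.mem_singleton] at hy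
          rcases hy with rfl | rfl | rfl <;> assumption
        have := Finset.card_le_card hs
        have e : ({u, v, w} : Finset Plane).card = 3 :=
          Finset.card_eq_three.2 ⟨u, v, w, n.1, n.2.1, n.2.2.1, rfl⟩
        omega
      · push Not at hne
        have := Finset.card_le_card (show Q ⊆ ext Q from hne)
        omega
    omega
  have h1 : (((ext Q).erase b).erase c).card = 1 := by
    rw [Finset.card_erase_of_mem (by simp [hc, hbc.symm]), Finset.card_erase_of_mem hb, h3]
  obtain ⟨x, hx⟩ := Finset.card_eq_one.1 h1
  have hmem : ∀ y, (y ≠ c ∧ y ≠ b ∧ y ∈ ext Q) ↔ y = x := by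
    intro y
    have : y ∈ ((ext Q).erase b).erase c ↔ y = x := by simp [hx]
    simpa [and_assoc] using this
  have hxx := (hmem x).2 rfl
  refine ⟨x, hxx.2.1, hxx.1, ?_⟩
  ext y
  simp only [Finset.mem_insert, Finset.mem_singleton]
  constructor
  · intro hy
    by_cases h1 : y = b
    · tauto
    by_cases h2 : y = c
    · tauto
    · exact .inl ((hmem y).1 ⟨h2, h1, hy⟩)
  · rintro (rfl | rfl | rfl)
    · exact hxx.2.2
    · exact hb
    · exact hc

/-- A point set with triangular hull which is not anomalous has a triangulation without complex
triangles. -/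
theorem exists_nc_of_not_anomalous (P : Finset Plane) (hgp : GP P) (hcard : 5 ≤ P.card)
    (h3 : (ext P).card = 3)
    (hna : ∀ p ∈ ext P, ∃ q ∈ P.erase p, q ∉ ext (P.erase p)) : ∃ G, Tri P G ∧ NC P G := by
  induction hn : P.card using Nat.strong_induction_on generalizing P with
  | _ n ih =>
    by_cases hbig : ∃ x ∈ ext P, 4 ≤ (ext (P.erase x)).card
    · obtain ⟨x, hx, hx4⟩ := hbig
      have hxP := mem_ext.1 hx
      have hP := Finset.insert_erase hxP.1
      obtain ⟨G, hT, hN, hC⟩ := good_of_four_le (P.erase x) (hgp.mono (Finset.erase_subset _ _)) hx4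
        (hna x hx)
      have := fan_step (a := x) hT (by rwa [hP]) (by simp)
        (fun h => hxP.2 (h.mono (Finset.erase_subset _ _))) hN hC hx4
      rw [hP] at this
      exact ⟨_, this⟩
    · push Not at hbig
      obtain ⟨a, b, c, hab, hac, hbc, hext⟩ := Finset.card_eq_three.1 h3
      have ea : a ∈ ext P := by simp [hext]
      have eb : b ∈ ext P := by simp [hext]
      have ec : c ∈ ext P := by simp [hext]
      have third : ∀ x y z, x ∈ ext P → y ∈ ext P → z ∈ ext P → y ≠ x → z ≠ x → y ≠ z →
          ∃ w, w ≠ y ∧ w ≠ z ∧ ext (P.erase x) = {w, y, z} := by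
        intro x y z hx hy hz hyx hzx hyz
        refine exists_third (hgp.mono (Finset.erase_subset _ _))
          (ext_mono (Finset.erase_subset _ _) hy (by simp [ext_subset P hy, hyx]))
          (ext_mono (Finset.erase_subset _ _) hz (by simp [ext_subset P hz, hzx])) hyz ?_ (hbig x hx)
        rw [Finset.card_erase_of_mem (ext_subset P hx)]; omega
      obtain ⟨a', a1, a2, a3⟩ := third a b c ea eb ec hab.symm hac.symm hbc
      obtain ⟨b', b1, b2, b3⟩ := third b a c eb ea ec hab hbc.symm hac
      obtain ⟨c', c1, c2, c3⟩ := third c a b ec ea eb hac hbc hab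
      have hnest : Nested P a b c a' b' c' := ⟨hgp, hext, hab, hac, hbc, a3,
        by rw [b3]; ext y; simp; tauto, by rw [c3]; ext y; simp; tauto, a1, a2, b1, b2, c1, c2,
        hcard⟩
      by_cases hS : ∀ q ∈ (P.erase a).erase a', ¬ InHull ((P.erase a).erase a') q
      · exact hnest.exists_nc_of_convex hS
      · push Not at hS
        have ma' := hnest.mem_a'
        have mb' := hnest.mem_b'
        have mc' := hnest.mem_c'
        have n1 := hnest.a'_ne_b'
        have n2 := hnest.a'_ne_c'
        have n3 := hnest.b'_ne_c'
        have hlt := Finset.card_erase_lt_of_mem (ext_subset P ea)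
        have hstep : 5 ≤ (P.erase a).card → (ext (P.erase a)).card = 3 →
            (∀ p ∈ ext (P.erase a), ∃ q ∈ (P.erase a).erase p, q ∉ ext ((P.erase a).erase p)) →
            ∃ G, Tri P G ∧ NC P G := by
          intro k1 k2 k3
          obtain ⟨G, hT, hN⟩ := ih (P.erase a).card (by omega) (P.erase a)
            (hgp.mono (Finset.erase_subset _ _)) k1 k2 k3 rfl
          exact hnest.exists_nc_of_erase hT hN
        apply hstep
        -- The distinct points `a'`, `b`, `c`, `b'`, `c'` survive the deletion of `a`, so the bound
        -- of five is preserved.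
        · have hsub : ({a', b, c, b', c'} : Finset Plane) ⊆ P.erase a := by
            intro y hy
            simp only [Finset.mem_insert, Finset.mem_singleton] at hy
            have := hnest.mem_b
            have := hnest.mem_c
            rw [Finset.mem_erase]
            rcases hy with rfl | rfl | rfl | rfl | rfl
            · exact ma'.symm
            · exact ⟨hab.symm, this⟩
            · exact ⟨hac.symm, this⟩
            · exact ⟨b1, mb'.1⟩
            · exact ⟨c1, mc'.1⟩
          have h5 : ({a', b, c, b', c'} : Finset Plane).card = 5 := by
            rw [Finset.card_insert_of_notMem, Finset.card_insert_of_notMem,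
              Finset.card_insert_of_notMem, Finset.card_pair n3]
            · simp [Ne.symm b2, mc'.2.symm]
            · simp [hbc, mb'.2.symm, Ne.symm c2]
            · simp [a1, a2, n1, n2]
          have := Finset.card_le_card hsub
          omega
        · rw [a3]; exact Finset.card_eq_three.2 ⟨a', b, c, a1, a2, hbc, rfl⟩
        · intro p hp
          rw [a3] at hp
          simp only [Finset.mem_insert, Finset.mem_singleton] at hp
          rcases hp with rfl | rfl | rfl
          · obtain ⟨q, hq, hi⟩ := hS
            exact ⟨q, hq, fun h => (mem_ext.1 h).2 hi⟩
          -- Besides `a'`, covered by the case hypothesis, the hull vertices to test are `b` and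
          -- `c`; `c'` and `b'` respectively stay interior.
          · refine ⟨c', by simp [mc', c1, c2], fun h => (mem_ext.1 h).2 ?_⟩
            exact ⟨c, by simp [hnest.mem_c, hac.symm, hbc.symm], a', by simp [ma', a1],
              b', by simp [mb', b1], hnest.inner⟩
          · refine ⟨b', by simp [mb', b1, b2], fun h => (mem_ext.1 h).2 ?_⟩
            exact ⟨b, by simp [hnest.mem_b, hab.symm, hbc], a', by simp [ma', a2],
              c', by simp [mc', c1], hnest.inner'⟩

end

/-! ### From sign predicates to segments, interiors and frontiers -/

theorem eq_combo_of_cr_eq_zero {a b c : Plane} (hab : a ≠ b) (h : cr a b c = 0) :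
    ∃ t : ℝ, c = t • (b - a) + a := by
  unfold cr at h
  by_cases h0 : b 0 - a 0 = 0
  · have h1 : b 1 - a 1 ≠ 0 := by
      intro h1
      apply hab
      ext i
      fin_cases i
      · exact (sub_eq_zero.1 h0).symm
      · exact (sub_eq_zero.1 h1).symm
    refine ⟨(c 1 - a 1) / (b 1 - a 1), ?_⟩
    have h2 : c 0 - a 0 = 0 := by
      rw [h0, zero_mul, zero_sub, neg_eq_zero] at h
      exact (mul_eq_zero.1 h).resolve_left h1
    ext i
    fin_cases i
    · simp [h0]; linarith
    · simp; field_simp; ring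
  · refine ⟨(c 0 - a 0) / (b 0 - a 0), ?_⟩
    ext i
    fin_cases i
    · simp; field_simp; ring
    · simp; field_simp; linarith

theorem GeneralPosition.gp {P : Finset Plane} (h : GeneralPosition (P : Set Plane)) : GP P := by
  intro a ha b hb c hc hab hac hbc h0
  refine h a ha b hb c hc hab hac hbc ?_
  rw [collinear_iff_of_mem (p₀ := a) (by simp)]
  obtain ⟨t, ht⟩ := eq_combo_of_cr_eq_zero hab h0
  refine ⟨b - a, ?_⟩
  rintro p (rfl | rfl | rfl)
  · exact ⟨0, by simp⟩
  · exact ⟨1, by simp⟩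
  · exact ⟨t, ht⟩

theorem isOpen_inTri (a b c : Plane) : IsOpen {x | InTri a b c x} := by
  have h1 := continuous_cr a b
  have h2 := continuous_cr b c
  have h3 := continuous_cr c a
  exact ((isOpen_lt continuous_const h1).inter ((isOpen_lt continuous_const h2).inter
    (isOpen_lt continuous_const h3))).union ((isOpen_lt h1 continuous_const).inter
    ((isOpen_lt h2 continuous_const).inter (isOpen_lt h3 continuous_const)))

/-- At an interior point on the bounding line, a small step along the normal `d` would stay in `S`
and make the form negative. -/
theorem cr_pos_of_mem_interior {S : Set Plane} {u v x : Plane} (huv : u ≠ v) {k : ℝ} (hk : k ≠ 0)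
    (hS : ∀ y ∈ S, 0 ≤ k * cr u v y) (hx : x ∈ interior S) : 0 < k * cr u v x := by
  refine (hS x (interior_subset hx)).lt_of_ne fun h0 => ?_
  have h0 : cr u v x = 0 := by simpa [hk] using h0.symm
  set d : Plane := !₂[k * (v - u) 1, - (k * (v - u) 0)] with hd
  have hev := (tendsto_arc x d 0).eventually (isOpen_interior.mem_nhds hx)
  obtain ⟨ε, hε, hpos⟩ := (hev.and self_mem_nhdsWithin).exists
  have h1 := hS _ (interior_subset hε)
  rw [cr_arc, h0] at h1
  have h2 : wedge (v - u) d = - (k * ((v - u) 0 ^ 2 + (v - u) 1 ^ 2)) := by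
    simp [wedge, hd]; ring
  have h3 : 0 < (v - u) 0 ^ 2 + (v - u) 1 ^ 2 := by
    by_contra hc
    apply huv
    have e0 : (v - u) 0 = 0 := by nlinarith [sq_nonneg ((v - u) 0), sq_nonneg ((v - u) 1)]
    have e1 : (v - u) 1 = 0 := by nlinarith [sq_nonneg ((v - u) 0), sq_nonneg ((v - u) 1)]
    symm
    rw [← sub_eq_zero]
    ext i
    fin_cases i
    · exact e0
    · exact e1
  have h4 : wedge (v - u) 0 = 0 := by simp [wedge]
  rw [h2, h4] at h1
  have hk2 : 0 < k * k := mul_self_pos.2 hk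
  have := mul_pos (mul_pos hpos hk2) h3
  nlinarith

theorem interior_convexHull_triple {a b c : Plane} (h : cr a b c ≠ 0) :
    interior (convexHull ℝ {a, b, c}) = {x | InTri a b c x} := by
  have n := cr_ne h
  apply Set.Subset.antisymm
  · intro x hx
    have key : ∀ y ∈ convexHull ℝ {a, b, c}, 0 ≤ cr a b c * cr a b y ∧
        0 ≤ cr a b c * cr b c y ∧ 0 ≤ cr a b c * cr c a y := by
      intro y hy
      obtain ⟨h1, h2, h3⟩ := ((mem_convexHull_triple_iff h y).1 hy).cr_nonneg
      have aux : ∀ r : ℝ, 0 ≤ r / cr a b c → 0 ≤ cr a b c * r := by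
        intro r hr
        have : cr a b c * r = r / cr a b c * (cr a b c * cr a b c) := by field_simp
        rw [this]
        exact mul_nonneg hr (mul_self_nonneg _)
      exact ⟨aux _ h3, aux _ h1, aux _ h2⟩
    exact inTri_of_mul_pos (cr_pos_of_mem_interior n.1 h (fun y hy => (key y hy).1) hx)
      (cr_pos_of_mem_interior n.2.2 h (fun y hy => (key y hy).2.1) hx)
      (cr_pos_of_mem_interior n.2.1.symm h (fun y hy => (key y hy).2.2) hx)
  · exact interior_maximal (fun x hx => (mem_convexHull_triple_iff h x).2 hx.closed)
      (isOpen_inTri a b c)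

theorem InTriClosed.mem_segment {a b c x : Plane} (h : cr a b c ≠ 0) (hx : InTriClosed a b c x)
    (hn : ¬ InTri a b c x) : x ∈ segment ℝ a b ∨ x ∈ segment ℝ b c ∨ x ∈ segment ℝ a c := by
  have h1 := hx.cr_nonneg
  have h2 := cr_sum a b c x
  have h3 := eq_barycentric h x
  have h4 : cr b c x / cr a b c + cr c a x / cr a b c + cr a b x / cr a b c = 1 := by
    field_simp; exact h2
  set α := cr b c x / cr a b c
  set β := cr c a x / cr a b c
  set γ := cr a b x / cr a b c
  by_cases hα : α = 0
  · right; left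
    exact ⟨β, γ, h1.2.1, h1.2.2, by linarith, by rw [h3, hα]; simp⟩
  by_cases hβ : β = 0
  · right; right
    exact ⟨α, γ, h1.1, h1.2.2, by linarith, by rw [h3, hβ]; simp⟩
  by_cases hγ : γ = 0
  · left
    exact ⟨α, β, h1.1, h1.2.1, by linarith, by rw [h3, hγ]; simp⟩
  exfalso
  apply hn
  have e1 : cr b c x ≠ 0 := fun e => hα (by simp [α, e])
  have e2 : cr c a x ≠ 0 := fun e => hβ (by simp [β, e])
  have e3 : cr a b x ≠ 0 := fun e => hγ (by simp [γ, e])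
  rcases hx with ⟨p1, p2, p3⟩ | ⟨p1, p2, p3⟩
  · exact .inl ⟨p1.lt_of_ne e3.symm, p2.lt_of_ne e1.symm, p3.lt_of_ne e2.symm⟩
  · exact .inr ⟨p1.lt_of_ne e3, p2.lt_of_ne e1, p3.lt_of_ne e2⟩

theorem cr_of_mem_segment {u v x : Plane} (h : x ∈ segment ℝ u v) : cr u v x = 0 := by
  obtain ⟨α, β, -, -, hs, rfl⟩ := h
  rw [cr_combo_two _ _ _ _ hs, cr_self_outer, cr_self_right]; ring

theorem oppSide_of_mem_openSegment {a b c d x : Plane} (ha : cr c d a ≠ 0) (hx : x ∈ openSegment ℝ a b)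
    (h0 : cr c d x = 0) : OppSide c d a b := by
  obtain ⟨α, β, hα, hβ, hs, rfl⟩ := hx
  rw [cr_combo_two _ _ _ _ hs] at h0
  rcases ha.lt_or_gt with h | h
  · right; refine ⟨h, ?_⟩
    by_contra hc
    nlinarith [mul_neg_of_pos_of_neg hα h, not_lt.1 hc]
  · left; refine ⟨h, ?_⟩
    by_contra hc
    nlinarith [mul_pos hα h, mul_nonneg hβ.le (not_lt.1 hc)]

theorem cross_of_mem_openSegment {a b c d x : Plane} (h : cr c d a ≠ 0) (h' : cr a b c ≠ 0)
    (hx : x ∈ openSegment ℝ a b) (hx' : x ∈ openSegment ℝ c d) : Cross a b c d :=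
  ⟨oppSide_of_mem_openSegment h' hx' (cr_of_mem_segment (openSegment_subset_segment ℝ _ _ hx)),
   oppSide_of_mem_openSegment h hx (cr_of_mem_segment (openSegment_subset_segment ℝ _ _ hx'))⟩

theorem Cross.exists_mem {a b c d : Plane} (h : Cross a b c d) :
    ∃ x, x ∈ openSegment ℝ a b ∧ x ∈ openSegment ℝ c d := by
  set D := cr c d b - cr c d a with hD
  have hD' : D = cr a b c - cr a b d := by simp only [hD, cr]; ring
  have p : 0 < cr c d b / D ∧ 0 < - cr c d a / D := by
    rcases h.2 with ⟨h1, h2⟩ | ⟨h1, h2⟩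
    · exact ⟨div_pos_of_neg_of_neg h2 (by linarith), div_pos_of_neg_of_neg (by linarith) (by linarith)⟩
    · exact ⟨div_pos h2 (by linarith), div_pos (by linarith) (by linarith)⟩
  have q : 0 < - cr a b d / D ∧ 0 < cr a b c / D := by
    rcases h.1 with ⟨h1, h2⟩ | ⟨h1, h2⟩
    · exact ⟨div_pos (by linarith) (by linarith), div_pos h1 (by linarith)⟩
    · exact ⟨div_pos_of_neg_of_neg (by linarith) (by linarith), div_pos_of_neg_of_neg h1 (by linarith)⟩
  have hD0 : D ≠ 0 := by intro h0; simp [h0] at p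
  -- The weights on each segment are proportional to the distances of its opposite ends from the
  -- other line; both sets share the denominator `D`.
  refine ⟨_, ⟨_, _, p.1, p.2, by field_simp; rw [hD]; ring, rfl⟩, ⟨_, _, q.1, q.2,
    by field_simp; rw [hD']; ring, ?_⟩⟩
  ext i
  simp only [PiLp.add_apply, PiLp.smul_apply, smul_eq_mul]
  field_simp
  fin_cases i <;> simp [cr] <;> ring

theorem not_mem_openSegment {u v w : Plane} (h : cr u v w ≠ 0) : w ∉ openSegment ℝ u v :=
  fun hw => h (cr_of_mem_segment (openSegment_subset_segment ℝ _ _ hw))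

theorem not_mem_openSegment_of_shared {u v w x : Plane} (h : cr u v w ≠ 0)
    (hx : x ∈ openSegment ℝ u v) : x ∉ openSegment ℝ u w := by
  intro hx'
  have h1 := cr_of_mem_segment (openSegment_subset_segment ℝ _ _ hx)
  have := oppSide_of_mem_openSegment (a := w) (b := u) (c := u) (d := v) h
    (by rwa [openSegment_symm]) h1
  exact (this.ne).2.2.2.1 rfl

theorem GP.not_mem_openSegment {P : Finset Plane} (hgp : GP P) {u v w : Plane} (hu : u ∈ P)
    (hv : v ∈ P) (hw : w ∈ P) (huv : u ≠ v) : w ∉ openSegment ℝ u v := by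
  intro h
  by_cases h1 : w = u
  · subst h1; exact huv (left_mem_openSegment_iff.1 h)
  by_cases h2 : w = v
  · subst h2; exact huv (right_mem_openSegment_iff.1 h)
  exact _root_.not_mem_openSegment (hgp u hu v hv w hw huv (Ne.symm h1) (Ne.symm h2)) h

/-- Two distinct segments between points in general position meet only if they cross. -/
theorem GP.cross_or_eq {P : Finset Plane} (hgp : GP P) {u v w x y : Plane} (hu : u ∈ P)
    (hv : v ∈ P) (hw : w ∈ P) (hx : x ∈ P) (huv : u ≠ v) (hwx : w ≠ x)
    (h : y ∈ openSegment ℝ u v) (h' : y ∈ openSegment ℝ w x) :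
    Cross u v w x ∨ (u = w ∧ v = x) ∨ (u = x ∧ v = w) := by
  have aux : ∀ {u v x}, u ∈ P → v ∈ P → x ∈ P → u ≠ v → u ≠ x → y ∈ openSegment ℝ u v →
      y ∈ openSegment ℝ u x → v = x := by
    intro u v x hu hv hx h1 h2 h h'
    by_contra h3
    exact not_mem_openSegment_of_shared (hgp u hu v hv x hx h1 h2 h3) h h'
  have hs := openSegment_symm ℝ u v ▸ h
  have hs' := openSegment_symm ℝ w x ▸ h'
  by_cases h1 : u = w
  · subst h1; exact .inr (.inl ⟨rfl, aux hu hv hx huv hwx h h'⟩)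
  by_cases h2 : u = x
  · subst h2; exact .inr (.inr ⟨rfl, aux hu hv hw huv hwx.symm h hs'⟩)
  by_cases h3 : v = w
  · subst h3; exact absurd (aux hv hu hx huv.symm hwx hs h') h2
  by_cases h4 : v = x
  · subst h4; exact absurd (aux hv hu hw huv.symm hwx.symm hs hs') h1
  exact .inl (cross_of_mem_openSegment (hgp w hw x hx u hu hwx (Ne.symm h1) (Ne.symm h2))
    (hgp u hu v hv w hw huv h1 h3) h h')

theorem mem_openSegment_of_mem_segment {u v x : Plane} (h : x ∈ segment ℝ u v) (h1 : x ≠ u)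
    (h2 : x ≠ v) : x ∈ openSegment ℝ u v := mem_openSegment_of_ne_left_right h1.symm h2.symm h

/-- Otherwise the interiors of `t` and of its complement would disconnect `s`. -/
theorem IsPreconnected.inter_frontier_nonempty {s t : Set Plane} (hs : IsPreconnected s)
    (h1 : (s ∩ t).Nonempty) (h2 : (s ∩ tᶜ).Nonempty) : (s ∩ frontier t).Nonempty := by
  by_contra hc
  rw [Set.not_nonempty_iff_eq_empty] at hc
  have := hs (interior t) (interior tᶜ) isOpen_interior isOpen_interior ?_ ?_ ?_
  · obtain ⟨x, -, h3, h4⟩ := this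
    exact interior_subset h4 (interior_subset h3)
  · intro x hx
    by_contra hcon
    rw [Set.mem_union, not_or, interior_compl, Set.notMem_compl_iff] at hcon
    exact (Set.ext_iff.1 hc x).1 ⟨hx, hcon.2, hcon.1⟩
  · obtain ⟨x, hx, hxt⟩ := h1
    refine ⟨x, hx, ?_⟩
    by_contra hcon
    exact (Set.ext_iff.1 hc x).1 ⟨hx, subset_closure hxt, hcon⟩
  · obtain ⟨x, hx, hxt⟩ := h2
    refine ⟨x, hx, ?_⟩
    rw [interior_compl]
    intro hcon
    exact (Set.ext_iff.1 hc x).1 ⟨hx, hcon, fun h => hxt (interior_subset h)⟩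

/-! ### Topology of a triangular hull -/

/-- The convex hull of `P` is the triangle `abc`. -/
structure HullTriangle (P : Finset Plane) (a b c : Plane) : Prop where
  gp : GP P
  ext_eq : ext P = {a, b, c}
  ab : a ≠ b
  ac : a ≠ c
  bc : b ≠ c

namespace HullTriangle

variable {P : Finset Plane} {a b c : Plane}

theorem rot (h : HullTriangle P a b c) : HullTriangle P b c a :=
  ⟨h.gp, by rw [h.ext_eq]; ext; simp; tauto, h.bc, h.ab.symm, h.ac.symm⟩

theorem mem_left (h : HullTriangle P a b c) : a ∈ P := ext_subset P (by simp [h.ext_eq])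

theorem cr_ne (h : HullTriangle P a b c) : cr a b c ≠ 0 :=
  h.gp _ h.mem_left _ h.rot.mem_left _ h.rot.rot.mem_left h.ab h.ac h.bc

theorem inTri (h : HullTriangle P a b c) {q : Plane} (hq : q ∈ P) (ha : q ≠ a) (hb : q ≠ b)
    (hc : q ≠ c) : InTri a b c q :=
  inTri_of_ext_three h.gp h.ext_eq hq ha hb hc

theorem hullEdge (h : HullTriangle P a b c) : HullEdge P a b := by
  have aux : ∀ q ∈ P, q ≠ a → q ≠ b → SameSide a b c q := by
    intro q hq ha hb
    by_cases hc : q = c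
    · subst hc
      exact sameSide_of_mul_pos (mul_self_pos.2 h.cr_ne)
    · have i := h.inTri hq ha hb hc
      have n := i.ne
      exact InTri.sameSide (h.gp.gen4 h.rot.rot.mem_left h.mem_left h.rot.mem_left hq (by grind))
        (InTri.rot.2 i)
  exact ⟨h.mem_left, h.rot.mem_left, h.ab, fun p hp q hq h1 h2 h3 h4 =>
    (SameSide.comm.1 (aux p hp h1 h2)).trans (aux q hq h3 h4)⟩

theorem hullEdge_of_mem_ext (h : HullTriangle P a b c) {u v : Plane} (hu : u ∈ ext P)
    (hv : v ∈ ext P) (huv : u ≠ v) : HullEdge P u v := by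
  simp only [h.ext_eq, Finset.mem_insert, Finset.mem_singleton] at hu hv
  rcases hu with rfl | rfl | rfl <;> rcases hv with rfl | rfl | rfl <;>
    first
    | exact absurd rfl huv
    | exact h.hullEdge
    | exact h.hullEdge.symm
    | exact h.rot.hullEdge
    | exact h.rot.hullEdge.symm
    | exact h.rot.rot.hullEdge
    | exact h.rot.rot.hullEdge.symm

theorem convexHull_eq (h : HullTriangle P a b c) :
    convexHull ℝ (P : Set Plane) = convexHull ℝ {a, b, c} := by
  apply Set.Subset.antisymm
  · refine convexHull_min ?_ (convex_convexHull ℝ _)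
    intro q hq
    by_cases hqe : q = a ∨ q = b ∨ q = c
    · exact subset_convexHull ℝ _ (by simpa using hqe)
    · push Not at hqe
      exact (mem_convexHull_triple_iff h.cr_ne q).2 (h.inTri hq hqe.1 hqe.2.1 hqe.2.2).closed
  · refine convexHull_mono ?_
    rintro x (rfl | rfl | rfl)
    · exact h.mem_left
    · exact h.rot.mem_left
    · exact h.rot.rot.mem_left

theorem mem_frontier_iff (h : HullTriangle P a b c) {x : Plane} :
    x ∈ frontier (convexHull ℝ (P : Set Plane)) ↔ InTriClosed a b c x ∧ ¬ InTri a b c x := by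
  have hcl : IsClosed (convexHull ℝ (P : Set Plane)) :=
    (P.finite_toSet.isCompact_convexHull ℝ).isClosed
  rw [hcl.frontier_eq, Set.mem_sdiff, h.convexHull_eq, interior_convexHull_triple h.cr_ne,
    mem_convexHull_triple_iff h.cr_ne]
  rfl

theorem segment_subset_frontier (h : HullTriangle P a b c) :
    segment ℝ a b ⊆ frontier (convexHull ℝ (P : Set Plane)) := by
  intro x hx
  have h1 : x ∈ convexHull ℝ {a, b, c} :=
    segment_subset_convexHull (by simp) (by simp) hx
  refine h.mem_frontier_iff.2 ⟨(mem_convexHull_triple_iff h.cr_ne x).1 h1, fun hi => ?_⟩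
  have := hi.cr_pos.2.2
  simp [cr_of_mem_segment hx] at this

theorem segment_subset_frontier_of_mem_ext (h : HullTriangle P a b c) {u v : Plane}
    (hu : u ∈ ext P) (hv : v ∈ ext P) (huv : u ≠ v) :
    segment ℝ u v ⊆ frontier (convexHull ℝ (P : Set Plane)) := by
  simp only [h.ext_eq, Finset.mem_insert, Finset.mem_singleton] at hu hv
  have h1 := h.segment_subset_frontier
  have h2 := h.rot.segment_subset_frontier
  have h3 := h.rot.rot.segment_subset_frontier
  rcases hu with rfl | rfl | rfl <;> rcases hv with rfl | rfl | rfl <;>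
    first
    | exact absurd rfl huv
    | assumption
    | (rw [segment_symm]; assumption)

theorem isPreconnected_compl (h : HullTriangle P a b c) :
    IsPreconnected (convexHull ℝ (P : Set Plane))ᶜ := by
  have key : ∀ u v : Plane, Convex ℝ {y | cr a b c * cr u v y < 0} := by
    intro u v x hx y hy α β hα hβ hs
    simp only [Set.mem_ofPred_eq] at hx hy ⊢
    rw [cr_combo_two _ _ _ _ hs]
    rcases hα.eq_or_lt with rfl | hα
    · obtain rfl : β = 1 := by linarith
      simpa using hy
    · nlinarith [mul_neg_of_pos_of_neg hα hx, mul_nonneg hβ (neg_nonneg.2 hy.le)]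
  have hsq : 0 < cr a b c * cr a b c := mul_self_pos.2 h.cr_ne
  have e : (convexHull ℝ (P : Set Plane))ᶜ = ({y | cr a b c * cr a b y < 0} ∪
      {y | cr a b c * cr b c y < 0}) ∪ {y | cr a b c * cr c a y < 0} := by
    ext x
    rw [Set.mem_compl_iff, h.convexHull_eq, mem_convexHull_triple_iff h.cr_ne]
    have hs := cr_sum a b c x
    simp only [Set.mem_union, Set.mem_ofPred_eq]
    rcases h.cr_ne.lt_or_gt with h0 | h0
    · simp only [mul_neg_iff, h0, h0.not_gt, true_and, false_and, false_or, InTriClosed]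
      constructor
      · intro hn
        by_contra hc
        push Not at hc
        exact hn (.inr ⟨hc.1.1, hc.1.2, hc.2⟩)
      · rintro h1 (⟨p1, p2, p3⟩ | ⟨p1, p2, p3⟩)
        · linarith
        · rcases h1 with (h1 | h1) | h1 <;> linarith
    · simp only [mul_neg_iff, h0, h0.not_gt, true_and, false_and, or_false, InTriClosed]
      constructor
      · intro hn
        by_contra hc
        push Not at hc
        exact hn (.inl ⟨hc.1.1, hc.1.2, hc.2⟩)
      · rintro h1 (⟨p1, p2, p3⟩ | ⟨p1, p2, p3⟩)
        · rcases h1 with (h1 | h1) | h1 <;> linarith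
        · linarith
  have hcombo : ∀ u v x y z : Plane, cr u v ((-1 : ℝ) • x + (3 : ℝ) • y + (-1 : ℝ) • z) =
      - cr u v x + 3 * cr u v y - cr u v z := by
    intro u v x y z
    rw [cr_combo _ _ _ _ _ (by norm_num)]; ring
  rw [e]
  -- The complement is a union of three open half-planes. Barycentric weights `3, -1, -1` give a
  -- point beyond a vertex, common to the half-planes of the two sides meeting there.
  refine IsPreconnected.union' ⟨(-1 : ℝ) • a + (3 : ℝ) • c + (-1 : ℝ) • b, .inr ?_, ?_⟩
    (IsPreconnected.union' ⟨(-1 : ℝ) • a + (3 : ℝ) • b + (-1 : ℝ) • c, ?_, ?_⟩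
    (key _ _).isPreconnected (key _ _).isPreconnected) (key _ _).isPreconnected <;>
  · simp only [Set.mem_ofPred_eq, hcombo, cr_self_right, cr_self_outer,
      (cr_perm a b c).1, (cr_perm a b c).2.1]
    nlinarith

end HullTriangle

/-! ### Combinatorial triangulations are geometric ones -/

/-- The graph induced by `G` on the points of `P`. -/
def restrict (P : Finset Plane) (G : SimpleGraph Plane) : SimpleGraph (P : Set Plane) :=
  G.comap Subtype.val

section
variable {P : Finset Plane}

theorem IsPlane.of_not_cross (hgp : GP P) {T : SimpleGraph (P : Set Plane)}
    (h : ∀ u v w x, T.Adj u v → T.Adj w x → ¬ Cross (u : Plane) v w x) : IsPlane T := by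
  refine ⟨fun u v w huv =>
    hgp.not_mem_openSegment u.2 v.2 w.2 (fun e => huv.ne (Subtype.ext e)), ?_⟩
  intro u v w x huv hwx hne
  rw [Set.disjoint_left]
  intro y hy hy'
  rcases hgp.cross_or_eq u.2 v.2 w.2 x.2 (fun e => huv.ne (Subtype.ext e))
    (fun e => hwx.ne (Subtype.ext e)) hy hy' with hc | ⟨h1, h2⟩ | ⟨h1, h2⟩
  · exact h u v w x huv hwx hc
  · obtain rfl := Subtype.ext h1
    obtain rfl := Subtype.ext h2
    exact hne rfl
  · obtain rfl := Subtype.ext h1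
    obtain rfl := Subtype.ext h2
    exact hne Sym2.eq_swap

theorem mem_drawing_of_mem {T : SimpleGraph (P : Set Plane)} {p : Plane} (hp : p ∈ P) :
    p ∈ drawing T := .inl hp

theorem mem_drawing_of_adj {T : SimpleGraph (P : Set Plane)} {u v} (huv : T.Adj u v) {x : Plane}
    (hx : x ∈ segment ℝ (u : Plane) v) : x ∈ drawing T := .inr ⟨u, v, huv, hx⟩

theorem drawing_subset_convexHull (T : SimpleGraph (P : Set Plane)) :
    drawing T ⊆ convexHull ℝ (P : Set Plane) := by
  rintro x (hx | ⟨u, v, -, hx⟩)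
  · exact subset_convexHull ℝ _ hx
  · exact segment_subset_convexHull u.2 v.2 hx

theorem frontier_inTri_subset {a b c : Plane} (h : cr a b c ≠ 0) :
    frontier {x | InTri a b c x} ⊆ segment ℝ a b ∪ segment ℝ b c ∪ segment ℝ a c := by
  intro x hx
  rw [(isOpen_inTri a b c).frontier_eq] at hx
  have h1 : InTriClosed a b c x := by
    have : closure {x | InTri a b c x} ⊆ {x | InTriClosed a b c x} :=
      closure_minimal (fun x hx => InTri.closed hx) (isClosed_inTriClosed a b c)
    exact this hx.1
  rcases h1.mem_segment h hx.2 with h | h | h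
  · exact .inl (.inl h)
  · exact .inl (.inr h)
  · exact .inr h

theorem convex_inTri {a b c : Plane} (h : cr a b c ≠ 0) : Convex ℝ {x | InTri a b c x} := by
  rw [← interior_convexHull_triple h]
  exact (convex_convexHull ℝ _).interior

theorem not_inTri_of_mem_segment {u v w x : Plane} (hx : x ∈ segment ℝ u v) : ¬ InTri u v w x := by
  intro h
  have := h.cr_pos.2.2
  simp [cr_of_mem_segment hx] at this

theorem GP.eq_or_eq_of_mem_segment (hgp : GP P) {u v p : Plane} (hu : u ∈ P) (hv : v ∈ P)
    (hp : p ∈ P) (huv : u ≠ v) (h : p ∈ segment ℝ u v) : p = u ∨ p = v := by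
  by_contra hc
  push Not at hc
  exact hgp.not_mem_openSegment hu hv hp huv (mem_openSegment_of_mem_segment h hc.1 hc.2)

/-- The segment from a point inside a triangle of a plane graph along an edge to an endpoint of
that edge outside the triangle must end at a vertex of the triangle. -/
theorem IsPlane.endpoint_mem {T : SimpleGraph (P : Set Plane)} (h : IsPlane T) (hgp : GP P)
    {a b c p q : (P : Set Plane)} (hab : T.Adj a b) (hbc : T.Adj b c) (hac : T.Adj a c)
    (hpq : T.Adj p q) (hp : ¬ InTri (a : Plane) b c p) {x : Plane} (hx : InTri (a : Plane) b c x)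
    (hxpq : x ∈ openSegment ℝ (p : Plane) q) : p = a ∨ p = b ∨ p = c := by
  have hne : ∀ {u v}, T.Adj u v → (u : Plane) ≠ v := fun h e => h.ne (Subtype.ext e)
  -- Between `p` and `x` the edge meets the boundary of the triangle at some `y`. Planarity forbids
  -- meeting a side in the interior of the edge, unless the edge is that side, so `y = p`.
  obtain ⟨y, hy, hyf⟩ := IsPreconnected.inter_frontier_nonempty
    (s := segment ℝ (p : Plane) x) (t := {x | InTri (a : Plane) b c x})
    (convex_segment _ _).isPreconnected ⟨x, right_mem_segment _ _ _, hx⟩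
    ⟨p, left_mem_segment _ _ _, hp⟩
  have hyx : y ≠ x := by
    rintro rfl
    rw [(isOpen_inTri _ _ _).frontier_eq] at hyf
    exact hyf.2 hx
  have key : ∀ {u v}, T.Adj u v → y ∈ segment ℝ (u : Plane) v →
      ¬ x ∈ segment ℝ (u : Plane) v → p = u ∨ p = v := by
    intro u v huv hyuv hxuv
    by_cases hyp : y = p
    · rw [hyp] at hyuv
      exact (hgp.eq_or_eq_of_mem_segment u.2 v.2 p.2 (hne huv) hyuv).imp Subtype.ext Subtype.ext
    · exfalso
      have hyo : y ∈ openSegment ℝ (p : Plane) q := by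
        have hxs := openSegment_subset_segment ℝ _ _ hxpq
        have hys : y ∈ segment ℝ (p : Plane) q :=
          (convex_segment _ _).segment_subset (left_mem_segment _ _ _) hxs hy
        refine mem_openSegment_of_mem_segment hys hyp ?_
        rintro rfl
        obtain ⟨α, β, hα, hβ, hs, rfl⟩ := hxpq
        obtain ⟨γ, δ, hγ, hδ, hs', e⟩ := hy
        have e2 : (γ + δ * α) • ((q : Plane) - p) = 0 := by
          have : β = 1 - α := by linarith
          subst this
          have : γ = 1 - δ := by linarith
          subst this
          calc _ = (q : Plane) - ((1 - δ) • (p : Plane) + δ • (α • (p : Plane) + (1 - α) • (q : Plane)))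
              + 0 := by module
            _ = 0 := by rw [e]; simp
        rcases smul_eq_zero.1 e2 with e2 | e2
        · have : 0 ≤ δ * α := by positivity
          have hγ0 : γ = 0 := by linarith
          have hδ1 : δ = 1 := by linarith
          subst hγ0 hδ1
          linarith
        · exact hne hpq (sub_eq_zero.1 e2).symm
      by_cases h1 : y = u
      · exact h.1 p q u hpq (h1 ▸ hyo)
      by_cases h2 : y = v
      · exact h.1 p q v hpq (h2 ▸ hyo)
      have hyo' := mem_openSegment_of_mem_segment hyuv h1 h2
      by_cases he : s(p, q) = s(u, v)
      · apply hxuv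
        have hxs := openSegment_subset_segment ℝ _ _ hxpq
        rcases Sym2.eq_iff.1 he with ⟨rfl, rfl⟩ | ⟨rfl, rfl⟩
        · exact hxs
        · rwa [segment_symm]
      · exact Set.disjoint_left.1 (h.2 p q u v hpq huv he) hyo hyo'
  have hcr : cr (a : Plane) b c ≠ 0 :=
    hgp _ a.2 _ b.2 _ c.2 (hne hab) (hne hac) (hne hbc)
  rcases frontier_inTri_subset hcr hyf with (hs | hs) | hs
  · rcases key hab hs (fun h => not_inTri_of_mem_segment h hx) with h | h <;> simp [h]
  · rcases key hbc hs (fun h => not_inTri_of_mem_segment h (InTri.rot.1 hx)) with h | h <;> simp [h]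
  · rcases key hac hs (fun h => not_inTri_of_mem_segment h (InTri.swap_right.1 hx)) with h | h <;>
      simp [h]

/-- An edge entering an empty triangle has both ends among its vertices by `endpoint_mem`; it is
then a side and misses the interior. -/
theorem IsPlane.disjoint_drawing {T : SimpleGraph (P : Set Plane)} (h : IsPlane T) (hgp : GP P)
    {a b c : (P : Set Plane)} (hab : T.Adj a b) (hbc : T.Adj b c) (hac : T.Adj a c)
    (hemp : ∀ p ∈ P, ¬ InTri (a : Plane) b c p) {x : Plane} (hx : InTri (a : Plane) b c x) :
    x ∉ drawing T := by
  have hab' : segment ℝ (a : Plane) b ⊆ {x | ¬ InTri (a : Plane) b c x} :=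
    fun y hy => not_inTri_of_mem_segment hy
  have hbc' : segment ℝ (b : Plane) c ⊆ {x | ¬ InTri (a : Plane) b c x} :=
    fun y hy hi => not_inTri_of_mem_segment hy (InTri.rot.1 hi)
  have hac' : segment ℝ (a : Plane) c ⊆ {x | ¬ InTri (a : Plane) b c x} :=
    fun y hy hi => not_inTri_of_mem_segment hy (InTri.swap_right.1 hi)
  rintro (hxP | ⟨p, q, hpq, hxs⟩)
  · exact hemp x hxP hx
  · have hxo : x ∈ openSegment ℝ (p : Plane) q := by
      refine mem_openSegment_of_mem_segment hxs ?_ ?_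
      · rintro rfl; exact hemp _ p.2 hx
      · rintro rfl; exact hemp _ q.2 hx
    have h1 := h.endpoint_mem hgp hab hbc hac hpq (hemp _ p.2) hx hxo
    have h2 := h.endpoint_mem hgp hab hbc hac hpq.symm (hemp _ q.2) hx
      (by rwa [openSegment_symm])
    have hxs' := hxs
    rw [segment_symm] at hxs'
    have hne := hpq.ne
    rcases h1 with rfl | rfl | rfl <;> rcases h2 with rfl | rfl | rfl <;>
      first
      | exact absurd rfl hne
      | exact hab' hxs hx
      | exact hab' hxs' hx
      | exact hbc' hxs hx
      | exact hbc' hxs' hx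
      | exact hac' hxs hx
      | exact hac' hxs' hx

/-- A preconnected open set disjoint from a set containing its frontier is a component of the
complement. -/
theorem connectedComponentIn_eq_of_frontier_subset {D I : Set Plane} {x : Plane}
    (hI : IsPreconnected I) (hx : x ∈ I) (hD : Disjoint I D) (hf : frontier I ⊆ D) :
    connectedComponentIn Dᶜ x = I := by
  have hsub : I ⊆ Dᶜ := Set.disjoint_left.1 hD
  apply Set.Subset.antisymm
  · intro y hy
    by_contra hyI
    obtain ⟨z, hz, hzf⟩ := IsPreconnected.inter_frontier_nonempty (t := I)
      (isPreconnected_connectedComponentIn (F := Dᶜ) (x := x))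
      ⟨x, mem_connectedComponentIn (hsub hx), hx⟩ ⟨y, hy, hyI⟩
    exact connectedComponentIn_subset _ _ hz (hf hzf)
  · exact hI.subset_connectedComponentIn hx hsub

/-- A point off the drawing lies in an open empty triangle or outside the hull. Each of these
regions is connected, disjoint from the drawing and has its frontier in it, so it is a face. -/
theorem Tri.isTriangulation [DecidableEq Plane] {G : SimpleGraph Plane} (hT : Tri P G) {A B C : Plane}
    (hH : HullTriangle P A B C) (hcard : 3 ≤ P.card) : IsTriangulation (restrict P G) := by
  have hgp := hH.gp
  have hpl : IsPlane (restrict P G) :=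
    IsPlane.of_not_cross hgp fun u v w x huv hwx => hT.plane huv hwx
  have hfr : frontier (convexHull ℝ (P : Set Plane)) ⊆ drawing (restrict P G) := by
    intro x hx
    have aux : ∀ {u v w}, HullTriangle P u v w → x ∈ segment ℝ u v →
        x ∈ drawing (restrict P G) := by
      intro u v w h hx
      obtain ⟨z, hz⟩ := hT.exists_face_of_hullEdge hgp hcard h.hullEdge
      exact mem_drawing_of_adj (u := ⟨u, h.mem_left⟩) (v := ⟨v, h.rot.mem_left⟩) hz.1 hx
    rw [hH.mem_frontier_iff] at hx
    rcases hx.1.mem_segment hH.cr_ne hx.2 with h | h | h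
    · exact aux hH h
    · exact aux hH.rot h
    · exact aux hH.rot.rot (by rwa [segment_symm])
  have hface : ∀ x ∉ drawing (restrict P G), x ∈ convexHull ℝ (P : Set Plane) →
      ∃ u v w : (P : Set Plane), Face P G u v w ∧ InTri (u : Plane) v w x := by
    intro x hx hxH
    have hxi : InTri A B C x := by
      by_contra hn
      rw [hH.convexHull_eq, mem_convexHull_triple_iff hH.cr_ne] at hxH
      exact hx (hfr (hH.mem_frontier_iff.2 ⟨hxH, hn⟩))
    obtain ⟨u, v, w, hF, hi⟩ := hT.exists_face_closed hgp (by omega) (m := x) (d := !₂[1, 0])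
      (e := !₂[0, 1]) (by simp [wedge]) (by
        filter_upwards [(tendsto_arc x _ _).eventually ((isOpen_inTri A B C).mem_nhds hxi)] with ε hε
        exact ⟨A, hH.mem_left, B, hH.rot.mem_left, C, hH.rot.rot.mem_left, hε⟩)
    have hu := hT.mem hF.1
    have hv := hT.mem hF.2.1
    have hw := hT.mem hF.2.1.symm
    refine ⟨⟨u, hu⟩, ⟨v, hv⟩, ⟨w, hw⟩, hF, ?_⟩
    by_contra hn
    rcases hi.mem_segment (hgp u hu v hv w hw hF.1.ne hF.2.2.1.ne hF.2.1.ne) hn with h | h | h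
    · exact hx (mem_drawing_of_adj (u := ⟨u, hu⟩) (v := ⟨v, hv⟩) hF.1 h)
    · exact hx (mem_drawing_of_adj (u := ⟨v, hv⟩) (v := ⟨w, hw⟩) hF.2.1 h)
    · exact hx (mem_drawing_of_adj (u := ⟨u, hu⟩) (v := ⟨w, hw⟩) hF.2.2.1 h)
  have hfaces : ∀ F, IsFace (restrict P G) F → F = (convexHull ℝ (P : Set Plane))ᶜ ∨
      ∃ u v w : (P : Set Plane), Face P G u v w ∧
        F = interior (convexHull ℝ {(u : Plane), (v : Plane), (w : Plane)}) := by
    rintro F ⟨x, hx, rfl⟩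
    by_cases hxH : x ∈ convexHull ℝ (P : Set Plane)
    · right
      obtain ⟨u, v, w, hF, hi⟩ := hface x hx hxH
      have hcr := hgp u u.2 v v.2 w w.2 hF.1.ne hF.2.2.1.ne hF.2.1.ne
      refine ⟨u, v, w, hF, ?_⟩
      rw [interior_convexHull_triple hcr]
      refine connectedComponentIn_eq_of_frontier_subset (convex_inTri hcr).isPreconnected hi ?_ ?_
      · rw [Set.disjoint_left]
        exact fun y hy => hpl.disjoint_drawing hgp hF.1 hF.2.1 hF.2.2.1 hF.2.2.2 hy
      · intro y hy
        rcases frontier_inTri_subset hcr hy with (h | h) | h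
        · exact mem_drawing_of_adj (T := restrict P G) hF.1 h
        · exact mem_drawing_of_adj (T := restrict P G) hF.2.1 h
        · exact mem_drawing_of_adj (T := restrict P G) hF.2.2.1 h
    · left
      refine connectedComponentIn_eq_of_frontier_subset hH.isPreconnected_compl hxH ?_ ?_
      · rw [Set.disjoint_left]
        exact fun y hy hy' => hy (drawing_subset_convexHull _ hy')
      · rwa [frontier_compl]
  have hbdd : Bornology.IsBounded (convexHull ℝ (P : Set Plane)) :=
    (P.finite_toSet.isCompact_convexHull ℝ).isBounded
  refine ⟨hpl, ?_, ?_⟩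
  · intro F hF hub
    rcases hfaces F hF with rfl | ⟨u, v, w, -, rfl⟩
    · rw [frontier_compl]
    · refine absurd (hbdd.subset ?_) hub
      refine interior_subset.trans (convexHull_mono ?_)
      rintro y (rfl | rfl | rfl)
      · exact u.2
      · exact v.2
      · exact w.2
  · intro F hF hb
    rcases hfaces F hF with rfl | ⟨u, v, w, hF', rfl⟩
    · exfalso
      have := hbdd.union hb
      rw [Set.union_compl_self] at this
      exact NormedSpace.unbounded_univ ℝ Plane this
    · exact ⟨u, v, w, hF'.1, hF'.2.1, hF'.2.2.1, rfl⟩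

theorem Tri.admits [DecidableEq Plane] {G : SimpleGraph Plane} (hT : Tri P G) (hN : NC P G)
    {A B C : Plane} (hH : HullTriangle P A B C) (hcard : 3 ≤ P.card) :
    AdmitsNoncomplexTriangulation (P : Set Plane) := by
  refine ⟨restrict P G, hT.isTriangulation hH hcard, ?_, ?_⟩
  -- A triangular hull has no chords: any two of its vertices span a side.
  · rintro u v ⟨huv, hu, hv, hs⟩
    rw [hullVertices_eq_ext hH.gp] at hu hv
    exact hs (hH.segment_subset_frontier_of_mem_ext hu hv (fun e => huv.ne (Subtype.ext e)))
  · rintro a b c ⟨hab, hbc, hac, ⟨p, hp, hpi⟩, ⟨q, hq, hqo⟩⟩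
    have hcr := hH.gp a a.2 b b.2 c c.2 (fun e => hab.ne (Subtype.ext e))
      (fun e => hac.ne (Subtype.ext e)) (fun e => hbc.ne (Subtype.ext e))
    rw [interior_convexHull_triple hcr] at hpi
    rcases hN a b c hab hbc hac with h | h
    · exact h p hp hpi
    · rcases h q hq with rfl | rfl | rfl | h
      · exact hqo (subset_convexHull ℝ _ (by simp))
      · exact hqo (subset_convexHull ℝ _ (by simp))
      · exact hqo (subset_convexHull ℝ _ (by simp))
      · exact hqo ((mem_convexHull_triple_iff hcr q).2 h.closed)

end

/-! ### Every triangulation of an anomalous set is complex -/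

section
variable {P : Finset Plane}

theorem isClosed_drawing (T : SimpleGraph (P : Set Plane)) : IsClosed (drawing T) := by
  have e : drawing T = (P : Set Plane) ∪
      ⋃ e ∈ {e : ↥(P : Set Plane) × ↥(P : Set Plane) | T.Adj e.1 e.2},
        segment ℝ (e.1 : Plane) e.2 := by
    ext x
    simp only [drawing, Set.mem_union, Set.mem_ofPred_eq, Set.mem_iUnion, Prod.exists, exists_prop]
  rw [e]
  refine P.finite_toSet.isClosed.union ((Set.toFinite _).isClosed_biUnion fun e _ => ?_)
  rw [← convexHull_pair]
  exact ((Set.toFinite _).isCompact_convexHull ℝ).isClosed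

/-- A triangulation is a maximal plane graph. -/
theorem IsTriangulation.adj_or_exists_cross {T : SimpleGraph (P : Set Plane)}
    (h : IsTriangulation T) (hgp : GP P) {u v : (P : Set Plane)} (huv : u ≠ v) :
    T.Adj u v ∨ ∃ w x, T.Adj w x ∧ Cross (u : Plane) v w x := by
  by_contra hcon
  push Not at hcon
  obtain ⟨hna, hnc⟩ := hcon
  have huv' : (u : Plane) ≠ v := fun e => huv (Subtype.ext e)
  have hne : ∀ {u v}, T.Adj u v → (u : Plane) ≠ v := fun h e => h.ne (Subtype.ext e)
  have hout : openSegment ℝ (u : Plane) v ⊆ (drawing T)ᶜ := by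
    rintro y hy (hyP | ⟨w, x, hwx, hys⟩)
    · exact hgp.not_mem_openSegment u.2 v.2 hyP huv' hy
    · have hyo : y ∈ openSegment ℝ (w : Plane) x := by
        refine mem_openSegment_of_mem_segment hys ?_ ?_
        · rintro rfl; exact hgp.not_mem_openSegment u.2 v.2 w.2 huv' hy
        · rintro rfl; exact hgp.not_mem_openSegment u.2 v.2 x.2 huv' hy
      rcases hgp.cross_or_eq u.2 v.2 w.2 x.2 huv' (hne hwx) hy hyo with hc | ⟨h1, h2⟩ | ⟨h1, h2⟩
      · exact hnc w x hwx hc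
      · obtain rfl := Subtype.ext h1
        obtain rfl := Subtype.ext h2
        exact hna hwx
      · obtain rfl := Subtype.ext h1
        obtain rfl := Subtype.ext h2
        exact hna hwx.symm
  have hm := midpoint_mem_openSegment (𝕜 := ℝ) (u : Plane) (v : Plane)
  set m := midpoint ℝ (u : Plane) v
  set F := connectedComponentIn (drawing T)ᶜ m with hF
  have hface : IsFace T F := ⟨m, hout hm, rfl⟩
  have hsub : openSegment ℝ (u : Plane) v ⊆ F :=
    (convex_openSegment _ _).isPreconnected.subset_connectedComponentIn hm hout
  have hFd : F ⊆ (drawing T)ᶜ := connectedComponentIn_subset _ _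
  -- The open segment lies in the single face `F`. If `F` is an open triangle, `u` and `v` are in
  -- its closure but not inside it, so they are two of its adjacent vertices. If `F` is unbounded,
  -- its frontier is that of the hull; being open, `F` never meets this frontier, and having a point
  -- in the hull it stays there and is bounded.
  by_cases hb : Bornology.IsBounded F
  · obtain ⟨a, b, c, hab, hbc, hac, hFe⟩ := h.inner F hface hb
    have hcr := hgp a a.2 b b.2 c c.2 (hne hab) (hne hac) (hne hbc)
    have hcl : segment ℝ (u : Plane) v ⊆ convexHull ℝ {(a : Plane), (b : Plane), (c : Plane)} := by
      rw [← closure_openSegment]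
      refine closure_minimal (hsub.trans (hFe ▸ interior_subset)) ?_
      exact ((Set.toFinite _).isCompact_convexHull ℝ).isClosed
    rw [interior_convexHull_triple hcr] at hFe
    have key : ∀ p : (P : Set Plane), (p : Plane) ∈ segment ℝ (u : Plane) v →
        p = a ∨ p = b ∨ p = c := by
      intro p hp
      have h1 := (mem_convexHull_triple_iff hcr _).1 (hcl hp)
      have h2 : ¬ InTri (a : Plane) b c p := fun hi =>
        hFd (show (p : Plane) ∈ F by rw [hFe]; exact hi) (mem_drawing_of_mem p.2)
      have aux : ∀ {x y}, T.Adj x y → (p : Plane) ∈ segment ℝ (x : Plane) y → p = x ∨ p = y :=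
        fun hxy hs => (hgp.eq_or_eq_of_mem_segment (Subtype.prop _) (Subtype.prop _) p.2 (hne hxy)
          hs).imp Subtype.ext Subtype.ext
      rcases h1.mem_segment hcr h2 with hs | hs | hs
      · rcases aux hab hs with h | h <;> simp [h]
      · rcases aux hbc hs with h | h <;> simp [h]
      · rcases aux hac hs with h | h <;> simp [h]
    rcases key u (left_mem_segment _ _ _) with rfl | rfl | rfl <;>
      rcases key v (right_mem_segment _ _ _) with rfl | rfl | rfl <;>
      first
      | exact huv rfl
      | exact hna ‹_›
      | exact hna (SimpleGraph.Adj.symm ‹_›)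
  · have hfr := h.outer F hface hb
    have hFo : IsOpen F := (isClosed_drawing T).isOpen_compl.connectedComponentIn
    apply hb
    refine (P.finite_toSet.isCompact_convexHull ℝ).isBounded.subset (s := F) fun y hy => ?_
    by_contra hyH
    obtain ⟨z, hz, hzf⟩ := IsPreconnected.inter_frontier_nonempty
      (t := convexHull ℝ (P : Set Plane)) (isPreconnected_connectedComponentIn (F := (drawing T)ᶜ)
        (x := m))
      ⟨m, hsub hm, segment_subset_convexHull u.2 v.2 (openSegment_subset_segment ℝ _ _ hm)⟩
      ⟨y, hy, hyH⟩
    rw [← hfr, hFo.frontier_eq] at hzf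
    exact hzf.2 hz

variable [DecidableEq Plane]

/-- If all points other than the hull vertex `p` are in convex position, then `p` sees all of
them. -/
theorem HullTriangle.vis_of_convex {p b c : Plane} (h : HullTriangle P p b c)
    (hQ : ∀ q ∈ P.erase p, q ∈ ext (P.erase p)) {q : Plane} (hq : q ∈ P.erase p) :
    Vis (P.erase p) p q := by
  refine ⟨hq, fun w hw x hx hc => ?_⟩
  have n := hc.ne
  have hqP := Finset.mem_of_mem_erase hq
  by_cases hqe : q = b ∨ q = c
  · have hE : HullEdge P p q := h.hullEdge_of_mem_ext (by simp [h.ext_eq])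
      (by rw [h.ext_eq]; rcases hqe with rfl | rfl <;> simp) n.1
    exact hE.not_cross (Finset.mem_of_mem_erase hw) (Finset.mem_of_mem_erase hx) hc
  push Not at hqe
  have hi := h.inTri hqP n.1.symm hqe.1 hqe.2
  refine (not_mem_convexHull_erase_iff (h.gp.mono (Finset.erase_subset _ _)) hq).2 (hQ q hq) ?_
  obtain ⟨y, ⟨s, t, hs, ht, hst, hy⟩, hy'⟩ := hc.exists_mem
  obtain ⟨α, β, γ, hα, hβ, hγ, hsum, hqe'⟩ := exists_combo_of_inTri hi
  have hmem : ∀ {z}, z ∈ P → z ≠ p → z ≠ q →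
      z ∈ convexHull ℝ (((P.erase p).erase q : Finset Plane) : Set Plane) := by
    intro z hz h1 h2
    exact subset_convexHull ℝ _ (by simp [hz, h1, h2])
  have hyC : y ∈ convexHull ℝ (((P.erase p).erase q : Finset Plane) : Set Plane) :=
    (convex_convexHull ℝ _).segment_subset
      (hmem (Finset.mem_of_mem_erase hw) n.2.1.symm n.2.2.2.1.symm)
      (hmem (Finset.mem_of_mem_erase hx) n.2.2.1.symm n.2.2.2.2.1.symm)
      (openSegment_subset_segment ℝ _ _ hy')
  have hbC := hmem h.rot.mem_left h.ab.symm hqe.1.symm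
  have hcC := hmem h.rot.rot.mem_left h.ac.symm hqe.2.symm
  have hD : 0 < s + α * t := by positivity
  -- Eliminating `p` from `y = s p + t q` and `q = α p + β b + γ c` writes `q` as a convex
  -- combination of `y`, `b`, `c`, against its extremality in `P \ {p}`.
  have := combo_mem_convexHull hyC hbC hcC (α := α / (s + α * t)) (β := s * β / (s + α * t))
    (γ := s * γ / (s + α * t)) (by positivity) (by positivity) (by positivity) (by
      field_simp
      have : β = 1 - α - γ := by linarith
      subst this
      have : t = 1 - s := by linarith
      subst this
      ring)
  convert this using 1
  have e : (s + α * t) • q = α • y + (s * β) • b + (s * γ) • c := by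
    rw [← hy, add_smul]
    nth_rewrite 1 [hqe']
    module
  have e' := inv_smul_smul₀ hD.ne' q
  rw [e] at e'
  rw [← e']
  simp only [div_eq_inv_mul]
  module

theorem exists_cross_of_convex {Q : Finset Plane} (hgp : GP Q) (hQ : ∀ q ∈ Q, q ∈ ext Q)
    (hcard : 4 ≤ Q.card) : ∃ u ∈ Q, ∃ v ∈ Q, ∃ w ∈ Q, ∃ x ∈ Q, Cross u v w x := by
  obtain ⟨R, hRQ, hR⟩ := Finset.exists_subset_card_eq hcard
  obtain ⟨a, b, c, d, h1, h2, h3, h4, h5, h6, rfl⟩ := Finset.card_eq_four.1 hR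
  have ha : a ∈ Q := hRQ (by simp)
  have hb : b ∈ Q := hRQ (by simp)
  have hc : c ∈ Q := hRQ (by simp)
  have hd : d ∈ Q := hRQ (by simp)
  rcases exists_cross_of_ext hgp (hQ a ha) (hQ b hb) (hQ c hc) (hQ d hd) ⟨h1, h2, h3, h4, h5, h6⟩
    with h | h | h
  · exact ⟨a, ha, b, hb, c, hc, d, hd, h⟩
  · exact ⟨a, ha, c, hc, b, hb, d, hd, h⟩
  · exact ⟨a, ha, d, hd, b, hb, c, hc, h⟩

/-- Every triangulation of an anomalous set has a complex triangle. -/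
theorem IsTriangulation.exists_complex {T : SimpleGraph (P : Set Plane)} (hT : IsTriangulation T)
    {p b c : Plane} (h : HullTriangle P p b c) (hcard : 5 ≤ P.card)
    (hQ : ∀ q ∈ P.erase p, q ∈ ext (P.erase p)) : ∃ u v w, IsComplexTriangle T u v w := by
  have hgpQ : GP (P.erase p) := h.gp.mono (Finset.erase_subset _ _)
  have hsub : ∀ {y}, y ∈ P.erase p → y ∈ P := fun hy => Finset.mem_of_mem_erase hy
  have hvis := fun q hq => h.vis_of_convex hQ (q := q) hq
  have hpP := h.mem_left
  have hpe : p ∈ ext P := by simp [h.ext_eq]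
  have hadj : ∀ q (hq : q ∈ P.erase p), T.Adj ⟨p, hpP⟩ ⟨q, hsub hq⟩ := by
    intro q hq
    have hqp := Finset.ne_of_mem_erase hq
    refine (hT.adj_or_exists_cross h.gp (fun e => hqp (congrArg Subtype.val e).symm)).resolve_right ?_
    rintro ⟨w, x, -, hc⟩
    have n := hc.ne
    exact (hvis q hq).2 w (Finset.mem_erase.2 ⟨n.2.1.symm, w.2⟩) x
      (Finset.mem_erase.2 ⟨n.2.2.1.symm, x.2⟩) hc
  have hpc := Finset.card_erase_of_mem hpP
  obtain ⟨u, hu, v, hv, w, hw, x, hx, hc⟩ := exists_cross_of_convex hgpQ hQ (by omega)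
  have n := hc.ne
  -- Of two crossing segments, either the first is an edge, or by maximality some edge crosses it.
  -- That edge avoids `p`, because no segment between the other points blocks the view from `p`.
  obtain ⟨a, ha, d, hd, e, he, f, hf, had, hc⟩ : ∃ a, ∃ ha : a ∈ P.erase p, ∃ d,
      ∃ hd : d ∈ P.erase p, ∃ e ∈ P.erase p, ∃ f ∈ P.erase p,
      T.Adj ⟨a, hsub ha⟩ ⟨d, hsub hd⟩ ∧ Cross a d e f := by
    rcases hT.adj_or_exists_cross h.gp (u := ⟨u, hsub hu⟩) (v := ⟨v, hsub hv⟩)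
      (fun e => n.1 (congrArg Subtype.val e)) with h1 | ⟨y, z, hyz, hc'⟩
    · exact ⟨u, hu, v, hv, w, hw, x, hx, h1, hc⟩
    · have aux : ∀ {y z : (P : Set Plane)}, Cross u v y z → (y : Plane) ≠ p := by
        intro y' z' hc' e
        rw [e] at hc'
        have n := hc'.ne
        exact (hvis z' (Finset.mem_erase.2 ⟨n.2.2.2.2.2.symm, z'.2⟩)).2 u hu v hv (Cross.comm.1 hc')
      exact ⟨y, Finset.mem_erase.2 ⟨aux hc', y.2⟩, z,
        Finset.mem_erase.2 ⟨aux (Cross.swap_right.1 hc'), z.2⟩, u, hu, v, hv, hyz,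
        Cross.comm.1 hc'⟩
  have n := hc.ne
  have hpa := (Finset.ne_of_mem_erase ha).symm
  have hpd := (Finset.ne_of_mem_erase hd).symm
  -- Of `e` and `f`, the one on the side of `p` lies in `pad` because `p` sees `a` and `d`; the
  -- other is beyond `ad`, hence outside.
  have key : ∀ {e f}, e ∈ P.erase p → f ∈ P.erase p → OppSide a d e f → SameSide a d p e →
      ∃ u v w, IsComplexTriangle T u v w := by
    intro e f he hf ho hs
    have hins := Finset.insert_erase hpP
    have hi := inTri_of_vis (by rw [hins]; exact h.gp)
      (fun hi => (mem_ext.1 hpe).2 (hi.mono (Finset.erase_subset _ _)))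
      (hvis a ha) (hvis d hd) he hs (Finset.ne_of_mem_erase he).symm
    have hcr := hi.cr_ne
    refine ⟨⟨p, hpP⟩, ⟨a, hsub ha⟩, ⟨d, hsub hd⟩, hadj a ha, had, hadj d hd, ⟨e, hsub he, ?_⟩,
      ⟨f, hsub hf, ?_⟩⟩
    · rw [interior_convexHull_triple hcr]; exact hi
    · rw [mem_convexHull_triple_iff hcr]
      intro hf
      have h1 := hf.cr_nonneg.1
      rw [← cr_rot p a d] at h1
      rcases hs with ⟨s1, s2⟩ | ⟨s1, s2⟩ <;> rcases ho with ⟨o1, o2⟩ | ⟨o1, o2⟩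
      · exact absurd (div_neg_of_neg_of_pos o2 s1) h1.not_gt
      · linarith
      · linarith
      · exact absurd (div_neg_of_pos_of_neg o2 s1) h1.not_gt
  rcases sameSide_or_oppSide (h.gp _ (hsub ha) _ (hsub hd) _ hpP n.1 hpa.symm hpd.symm)
    (h.gp _ (hsub ha) _ (hsub hd) _ (hsub he) n.1 n.2.1 n.2.2.2.1) with hs | hs
  · exact key he hf hc.1 hs
  · exact key hf he (OppSide.comm.1 hc.1) (hs.trans hc.1)

theorem isAnomalous_iff (hgp : GP P) : IsAnomalous (P : Set Plane) ↔
    (ext P).card = 3 ∧ ∃ p ∈ ext P, ∀ q ∈ P.erase p, q ∈ ext (P.erase p) := by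
  have e : ∀ p : Plane, (P : Set Plane) \ {p} = (P.erase p : Finset Plane) := by
    intro p; simp
  unfold IsAnomalous
  simp only [e, hullVertices_eq_ext hgp, Set.ncard_coe_finset, Finset.mem_coe]
  refine and_congr_right fun _ => exists_congr fun p => and_congr_right fun _ => ?_
  rw [hullVertices_eq_ext (hgp.mono (Finset.erase_subset p P)), Finset.coe_subset]
  rfl

end

/-! ### The characterisation -/

theorem mainTheorem5 (P : Set Plane) (hfin : P.Finite) (hgen : GeneralPosition P)
    (hcard : 5 ≤ P.ncard) (hhull : (hullVertices P).ncard = 3) :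
    AdmitsNoncomplexTriangulation P ↔ ¬ IsAnomalous P := by
  classical
  obtain ⟨P, rfl⟩ := hfin.exists_finset_coe
  have hgp : GP P := hgen.gp
  rw [hullVertices_eq_ext hgp, Set.ncard_coe_finset] at hhull
  rw [Set.ncard_coe_finset] at hcard
  rw [isAnomalous_iff hgp]
  have htri : ∀ p ∈ ext P, ∃ b c, HullTriangle P p b c := by
    intro p hp
    obtain ⟨a, b, c, hab, hac, hbc, he⟩ := Finset.card_eq_three.1 hhull
    have h : HullTriangle P a b c := ⟨hgp, he, hab, hac, hbc⟩
    rw [he] at hp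
    simp only [Finset.mem_insert, Finset.mem_singleton] at hp
    rcases hp with rfl | rfl | rfl
    · exact ⟨_, _, h⟩
    · exact ⟨_, _, h.rot⟩
    · exact ⟨_, _, h.rot.rot⟩
  constructor
  · rintro ⟨T, hT, -, hN⟩ ⟨-, p, hp, hQ⟩
    obtain ⟨b, c, h⟩ := htri p hp
    obtain ⟨u, v, w, hc⟩ := hT.exists_complex h hcard hQ
    exact hN u v w hc
  · intro hna
    obtain ⟨G, hT, hN⟩ := exists_nc_of_not_anomalous P hgp hcard hhull (by
      intro p hp
      by_contra hcon
      push Not at hcon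
      exact hna ⟨hhull, p, hp, hcon⟩)
    obtain ⟨p, hp⟩ := Finset.card_pos.1 (show 0 < (ext P).card by omega)
    obtain ⟨b, c, h⟩ := htri p hp
    exact hT.admits hN h (by omega)
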